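/- Let $M$ be a compact complex manifold of dimension $m\ge 1$ and let $L\to M$ be a holomorphic line bundle with a smooth Hermitian metric $h$ whose curvature form $\omega=c_1(h)$, given locally by $-\frac{\sqrt{-1}}{\pi}\partial\bar\partial\log\|e_L\|_h$ for a nonvanishing local holomorphic section $e_L$, is strictly positive. Put $dV=\omega^m/\int_M\omega^m$. For $N\ge 1$ let $h_N$ be the metric induced by $h$ on $L^N=L^{\otimes N}$, and give $H^0(M,L^N)$ the inner product $\langle s_1,s_2\rangle=\int_M h_N(s_1,s_2)\,dV$. Let $S_1,\dots,S_d$ be an orthonormal basis of $H^0(M,L^N)$. Assume that $N$ is such that the map $\Phi_N:M\to\mathbb{CP}^{d-1}$, $\Phi_N(z)=[S_1(z):\dots:S_d(z)]$, is defined, i.e. that $S_1,\dots,S_d$ have no common zero (this holds for all sufficiently large $N$). For a section $s\in H^0(M,L^N)$ that does not vanish identically on any connected component of $M$, let $Z_s$ be the current of integration over the zero divisor of $s$ (with multiplicities), and let $\widetilde Z^N_s=\frac1N Z_s$. Let $\mu_N$ be the rotation invariant probability measure on the unit sphere $S^{2d-1}\subset\mathbb C^d$, identified with the unit sphere of $H^0(M,L^N)$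 by $a\mapsto s=\sum_j a_jS_j$, and let $\omega_{FS}=\frac{\sqrt{-1}}{2\pi}\partial\bar\partial\log|w|^2$ be the Fubini–Study form on $\mathbb{CP}^{d-1}$. Then $$E(\widetilde Z^N_s)=\frac1N\,\Phi_N^*\omega_{FS}$$ as $(1,1)$-currents on $M$: for every smooth $(m-1,m-1)$-form $\phi$ on $M$, the integral defining $(\widetilde Z^N_s,\phi)$ converges absolutely for $\mu_N$-almost every $s$, the function $s\mapsto(\widetilde Z^N_s,\phi)$ is $\mu_N$-integrable, and $$\int_{S^{2d-1}}(\widetilde Z^N_s,\phi)\,d\mu_N=\int_M\frac1N\,\Phi_N^*\omega_{FS}\wedge\phi .$$ -/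

import Mathlib

open scoped LinearAlgebra.Projectivization Manifold ContDiff TensorProduct Topology
open MeasureTheory

noncomputable section

namespace RandomZeros

/-! ### Multilinear algebra and calculus on `ℂᵏ` -/

/-- Complex-valued real-alternating `p`-forms on the real vector space underlying `ℂᵏ`. -/
abbrev Alt (k p : ℕ) : Type := (Fin k → ℂ) [⋀^Fin p]→ₗ[ℝ] ℂ

/-- The wedge product (sum over shuffles). -/
def wedge {k p q r : ℕ} (h : p + q = r) (a : Alt k p) (b : Alt k q) : Alt k r :=
  ((LinearMap.mul' ℝ ℂ).compAlternatingMap (a.domCoprod b)).domDomCongr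
    (finSumFinEquiv.trans (finCongr h))

/-- The `j`-th wedge power of a 2-form. -/
def wedgePow {k : ℕ} (a : Alt k 2) : (j : ℕ) → Alt k (2 * j)
  | 0 => (AlternatingMap.constOfIsEmpty ℝ (Fin k → ℂ) (Fin 0) (1 : ℂ) : Alt k 0)
  | j + 1 => wedge (by ring) (wedgePow a j) a

/-- The positively oriented real basis `e₁, i e₁, e₂, i e₂, …` of `ℂᵏ`. -/
def realBasis (k : ℕ) (j : Fin (2 * k)) : Fin k → ℂ :=
  Pi.single ⟨j.1 / 2, by omega⟩ (if j.1 % 2 = 0 then 1 else Complex.I)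

/-- `∂̄u` at `z`, the conjugate-linear part of `du`. -/
def dbar {k : ℕ} (u : (Fin k → ℂ) → ℂ) (z : Fin k → ℂ) : (Fin k → ℂ) →L[ℝ] ℂ :=
  (1 / 2 : ℂ) • (fderiv ℝ u z + Complex.I •
    (fderiv ℝ u z).comp (((Complex.I • ContinuousLinearMap.id ℂ (Fin k → ℂ)) :
      (Fin k → ℂ) →L[ℂ] (Fin k → ℂ)).restrictScalars ℝ))

/-- `∂∂̄u = d(∂̄u)` at `z`. -/
def ddbar {k : ℕ} (u : (Fin k → ℂ) → ℂ) (z : Fin k → ℂ) : Alt k 2 :=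
  (extDeriv (fun y => ContinuousAlternatingMap.ofSubsingleton ℝ (Fin k → ℂ) ℂ (0 : Fin 1)
    (dbar u y)) z).toAlternatingMap

/-- A complex linear map regarded as a real linear map. -/
def realLinear {k l : ℕ} (T : (Fin k → ℂ) →L[ℂ] (Fin l → ℂ)) : (Fin k → ℂ) →ₗ[ℝ] (Fin l → ℂ) :=
  (T : (Fin k → ℂ) →ₗ[ℂ] (Fin l → ℂ)).restrictScalars ℝ

/-- The vanishing order at `z` of a holomorphic function that does not vanish identically
near `z`. -/
def vanishingOrder {k : ℕ} (ψ : (Fin k → ℂ) → ℂ) (z : Fin k → ℂ) : ℕ :=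
  sInf {j : ℕ | iteratedFDeriv ℂ j ψ z ≠ 0}

/-! ### Differential forms on a complex manifold and their integrals -/

section Forms

variable {m : ℕ} (M : Type*) [TopologicalSpace M] [ChartedSpace (Fin m → ℂ) M]

/-- Differential `p`-forms on a complex `m`-manifold (no regularity imposed). The tangent space at
`x` is `ℂᵐ`, through the preferred chart at `x`, as for `TangentSpace`. -/
abbrev Form (m : ℕ) (M : Type*) (p : ℕ) : Type _ := M → Alt m p

variable {M}

/-- The value at `z` of the pullback of a form by a holomorphic map `g` from `ℂᵏ` to `M`. -/
def pullback {k p : ℕ} (g : (Fin k → ℂ) → M) (η : Form m M p) (z : Fin k → ℂ) : Alt k p :=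
  (η (g z)).compLinearMap
    (realLinear (mfderiv 𝓘(ℂ, Fin k → ℂ) 𝓘(ℂ, Fin m → ℂ) g z))

/-- Smooth forms of bidegree `(q,q)`. A `2q`-form is of bidegree `(q,q)` exactly when it is
invariant under multiplication of tangent vectors by unit complex numbers `ζ`, since `ζ` acts by
`ζ ^ (a - b)` on forms of bidegree `(a,b)`. -/
structure IsTestForm {q : ℕ} (φ : Form m M (2 * q)) : Prop where
  smooth : ∀ (x : M) (v : Fin (2 * q) → (Fin m → ℂ)),
    ContDiffOn ℝ ∞ (fun z => pullback (chartAt (Fin m → ℂ) x).symm φ z v)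
      (chartAt (Fin m → ℂ) x).target
  bidegree : ∀ (x : M) (ζ : ℂ) (v : Fin (2 * q) → (Fin m → ℂ)), ‖ζ‖ = 1 →
    φ x (fun j => ζ • v j) = φ x v

/-- A decomposition of a `k`-dimensional complex submanifold `S` of `M` into countably many
disjoint measurable pieces `g i '' A i`, where `g i` is a holomorphic immersion into `S` of an
open set `U i ⊆ ℂᵏ` containing `A i` and is injective on `A i`. -/
structure Parametrization (m : ℕ) {M : Type*} [TopologicalSpace M] [ChartedSpace (Fin m → ℂ) M]
    (k : ℕ) (S : Set M) where
  U : ℕ → Set (Fin k → ℂ)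
  A : ℕ → Set (Fin k → ℂ)
  g : ℕ → (Fin k → ℂ) → M
  isOpen : ∀ i, IsOpen (U i)
  measurable : ∀ i, MeasurableSet (A i)
  subset : ∀ i, A i ⊆ U i
  holomorphic : ∀ i, MDifferentiableOn 𝓘(ℂ, Fin k → ℂ) 𝓘(ℂ, Fin m → ℂ) (g i) (U i)
  immersion : ∀ i, ∀ z ∈ U i,
    Function.Injective (mfderiv 𝓘(ℂ, Fin k → ℂ) 𝓘(ℂ, Fin m → ℂ) (g i) z)
  mapsTo : ∀ i, Set.MapsTo (g i) (U i) S
  injOn : ∀ i, Set.InjOn (g i) (A i)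
  disjoint : Pairwise fun i j => Disjoint (g i '' A i) (g j '' A j)
  covers : ⋃ i, g i '' A i = S

/-- The integral `∫_S η` of a `2k`-form over a `k`-dimensional complex submanifold `S ⊆ M` with its
complex orientation, computed in a decomposition of `S` into parametrized pieces (by the change of
variables formula it does not matter which one). -/
def formIntegral {k : ℕ} (S : Set M) (η : Form m M (2 * k)) : ℂ :=
  open Classical in
  if h : Nonempty (Parametrization m k S) then
    ∑' i, ∫ z in h.some.A i, pullback (h.some.g i) η z (realBasis k)
  else 0

/-- The integral `∫_S η` converges absolutely. -/
def FormIntegrable {k : ℕ} (S : Set M) (η : Form m M (2 * k)) : Prop :=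
  ∃ h : Nonempty (Parametrization m k S),
    (∀ i, IntegrableOn (fun z => pullback (h.some.g i) η z (realBasis k)) (h.some.A i)) ∧
      Summable fun i => ∫ z in h.some.A i, ‖pullback (h.some.g i) η z (realBasis k)‖

end Forms

/-- The regular part of an analytic hypersurface `Z`: the points of `Z` near which `Z` is a complex
submanifold of codimension one, i.e. the zero set of a coordinate function. -/
def regularPart (n : ℕ) {M : Type*} [TopologicalSpace M] [ChartedSpace (Fin (n + 1) → ℂ) M]
    (Z : Set M) : Set M :=
  {p | p ∈ Z ∧ ∃ χ ∈ IsManifold.maximalAtlas 𝓘(ℂ, Fin (n + 1) → ℂ) ω M,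
    p ∈ χ.source ∧ ∀ y ∈ χ.source, y ∈ Z ↔ χ y 0 = 0}

/-! ### Line bundles, their powers, and Hermitian metrics -/

section Bundle

variable {m : ℕ} {M : Type*} [TopologicalSpace M] [ChartedSpace (Fin m → ℂ) M]
  (L : M → Type*) [∀ x, AddCommGroup (L x)] [∀ x, Module ℂ (L x)]
  [∀ x, TopologicalSpace (L x)] [TopologicalSpace (Bundle.TotalSpace ℂ L)]
  [FiberBundle ℂ L] [VectorBundle ℂ ℂ L]

/-- The local frame of `L` given by the trivialization around `x₀`, at the point `y`. -/
def frame (x₀ y : M) : L y := (trivializationAt ℂ L x₀).symm y 1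

/-- For `y` in the domain of the trivialization around `x₀`, with frame `e`, the map
`c • e(y)^{⊗N} ↦ c` from the fibre of `L^N` at `y` to `ℂ`. -/
def coeff (N : ℕ) (x₀ y : M) : (⨂[ℂ]^N (L y)) →ₗ[ℂ] ℂ :=
  (PiTensorProduct.constantBaseRingEquiv (Fin N) ℂ).toLinearMap ∘ₗ
    PiTensorProduct.map (fun _ : Fin N => (trivializationAt ℂ L x₀).linearMapAt ℂ y)

theorem coeff_injective (N : ℕ) (x : M) : Function.Injective (coeff L N x x) := by
  have hx : x ∈ (trivializationAt ℂ L x).baseSet := FiberBundle.mem_baseSet_trivializationAt' x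
  have h : coeff L N x x = ((PiTensorProduct.congr
      (fun _ : Fin N => (trivializationAt ℂ L x).linearEquivAt ℂ x hx)).trans
      (PiTensorProduct.constantBaseRingEquiv (Fin N) ℂ).toLinearEquiv).toLinearMap := by
    apply PiTensorProduct.ext
    ext v
    simp [coeff, (trivializationAt ℂ L x).linearMapAt_apply, hx]
  rw [h]
  exact LinearEquiv.injective _

/-- The space `H⁰(M, L^N)` of holomorphic sections of the `N`-th tensor power of `L`. -/
def H0 (m : ℕ) {M : Type*} [TopologicalSpace M] [ChartedSpace (Fin m → ℂ) M] (L : M → Type*)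
    [∀ x, AddCommGroup (L x)] [∀ x, Module ℂ (L x)] [∀ x, TopologicalSpace (L x)]
    [TopologicalSpace (Bundle.TotalSpace ℂ L)] [FiberBundle ℂ L] [VectorBundle ℂ ℂ L] (N : ℕ) :
    Submodule ℂ (∀ x, ⨂[ℂ]^N (L x)) where
  carrier := {s | ∀ x₀ : M, MDifferentiableOn 𝓘(ℂ, Fin m → ℂ) 𝓘(ℂ, ℂ)
    (fun y => coeff L N x₀ y (s y)) (trivializationAt ℂ L x₀).baseSet}
  add_mem' hs ht x₀ := by
    simp only [Pi.add_apply, map_add]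
    exact (hs x₀).add (ht x₀)
  zero_mem' x₀ := by
    simpa only [Pi.zero_apply, map_zero] using mdifferentiableOn_const
  smul_mem' c s hs x₀ := by
    simp only [Pi.smul_apply, map_smul]
    exact (hs x₀).const_smul c

/-- Smooth Hermitian metrics `h` on `L`, linear in the first argument. -/
structure HermitianMetric (m : ℕ) {M : Type*} [TopologicalSpace M]
    [ChartedSpace (Fin m → ℂ) M] (L : M → Type*) [∀ x, AddCommGroup (L x)] [∀ x, Module ℂ (L x)]
    [∀ x, TopologicalSpace (L x)] [TopologicalSpace (Bundle.TotalSpace ℂ L)]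
    [FiberBundle ℂ L] where
  toFun : ∀ x, L x → L x → ℂ
  add_left : ∀ x (u v w : L x), toFun x (u + v) w = toFun x u w + toFun x v w
  smul_left : ∀ x (c : ℂ) (v w : L x), toFun x (c • v) w = c * toFun x v w
  conj_symm : ∀ x (v w : L x), toFun x w v = (starRingEnd ℂ) (toFun x v w)
  pos : ∀ x (v : L x), v ≠ 0 → 0 < (toFun x v v).re
  smooth : ∀ x₀ : M, ContMDiffOn 𝓘(ℝ, Fin m → ℂ) 𝓘(ℝ, ℂ) ∞
    (fun y => toFun y (frame L x₀ y) (frame L x₀ y)) (trivializationAt ℂ L x₀).baseSet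

variable {L}

/-- The norm `‖v‖_h`. -/
def HermitianMetric.norm (h : HermitianMetric m L) (x : M) (v : L x) : ℝ :=
  Real.sqrt (h.toFun x v v).re

/-- The curvature form `c₁(h) = -(i/π) ∂∂̄ log ‖e‖_h`, for a local holomorphic frame `e`. -/
def HermitianMetric.c1 (h : HermitianMetric m L) : Form m M 2 := fun x =>
  (-(Complex.I / (Real.pi : ℂ))) • ddbar
    (fun z => ((Real.log (h.norm ((chartAt (Fin m → ℂ) x).symm z)
      (frame L x ((chartAt (Fin m → ℂ) x).symm z))) : ℝ) : ℂ)) (chartAt (Fin m → ℂ) x x)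

/-- Strict positivity of the curvature form. -/
def HermitianMetric.IsPositive (h : HermitianMetric m L) : Prop :=
  ∀ (x : M) (v : Fin m → ℂ), v ≠ 0 →
    (h.c1 x ![v, Complex.I • v]).im = 0 ∧ 0 < (h.c1 x ![v, Complex.I • v]).re

/-- The Hermitian metric induced on the fibres of `L^N`:
`h_N(a e^{⊗N}, b e^{⊗N}) = a b̄ h(e, e)^N`. -/
def HermitianMetric.power (h : HermitianMetric m L) (N : ℕ) (x : M) (s t : ⨂[ℂ]^N (L x)) : ℂ :=
  coeff L N x x s * (starRingEnd ℂ) (coeff L N x x t) *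
    h.toFun x (frame L x x) (frame L x x) ^ N

/-- The inner product `⟨s, t⟩ = ∫_M h_N(s, t) dV` of sections of `L^N`, where
`dV = ω^m / ∫_M ω^m` and `ω = c₁(h)`. -/
def HermitianMetric.l2Inner (h : HermitianMetric m L) (N : ℕ) (s t : ∀ x, ⨂[ℂ]^N (L x)) : ℂ :=
  formIntegral (k := m) Set.univ
    (fun x => (h.power N x (s x) (t x) /
      formIntegral (k := m) Set.univ (fun y => wedgePow (h.c1 y) m)) • wedgePow (h.c1 x) m)

/-! ### The map to projective space and the Fubini–Study form -/

/-- The map `Φ_N : M → ℂℙ^{d-1}`, `z ↦ [S₁(z) : … : S_d(z)]`, of sections without common zeros. -/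
def kodairaMap {N d : ℕ} (S : Fin d → ∀ x, ⨂[ℂ]^N (L x)) (hS : ∀ x, ∃ j, S j x ≠ 0) (x : M) :
    ℙ ℂ (Fin d → ℂ) :=
  Projectivization.mk ℂ (fun j => coeff L N x x (S j x)) (by
    obtain ⟨j, hj⟩ := hS x
    intro h0
    apply hj
    apply coeff_injective L N x
    simpa using congrFun h0 j)

end Bundle

/-- The form `(i/2π) ∂∂̄ log |w|²` on `ℂᵈ ∖ {0}`, the Fubini–Study form `ω_FS` of `ℂℙ^{d-1}`
in homogeneous coordinates. -/
def fubiniStudy (d : ℕ) (w : Fin d → ℂ) : Alt d 2 :=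
  (Complex.I / (2 * (Real.pi : ℂ))) •
    ddbar (fun w : Fin d → ℂ => ((Real.log (∑ j, ‖w j‖ ^ 2) : ℝ) : ℂ)) w

/-- The affine coordinates `w ↦ w / w_j` on the part of projective space where `w_j ≠ 0`. -/
def affineLift {d : ℕ} (j : Fin d) (p : ℙ ℂ (Fin d → ℂ)) : Fin d → ℂ := (p.rep j)⁻¹ • p.rep

theorem exists_rep_ne_zero {d : ℕ} (p : ℙ ℂ (Fin d → ℂ)) : ∃ j, p.rep j ≠ 0 :=
  Function.ne_iff.mp p.rep_nonzero

/-- The pullback `Φ^* ω_FS` of the Fubini–Study form by a holomorphic map `Φ` to projective space,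
computed at `x` in affine coordinates around `Φ x`. -/
def pullbackFS {m d : ℕ} {M : Type*} [TopologicalSpace M] [ChartedSpace (Fin m → ℂ) M]
    (Φ : M → ℙ ℂ (Fin d → ℂ)) : Form m M 2 := fun x =>
  (fubiniStudy d (affineLift (exists_rep_ne_zero (Φ x)).choose (Φ x))).compLinearMap
    (realLinear (mfderiv 𝓘(ℂ, Fin m → ℂ) 𝓘(ℂ, Fin d → ℂ)
      (fun y => affineLift (exists_rep_ne_zero (Φ x)).choose (Φ y)) x))

/-! ### Zero currents of random sections -/

section Zeros

variable {n : ℕ} {M : Type*} [TopologicalSpace M] [ChartedSpace (Fin (n + 1) → ℂ) M]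
  {L : M → Type*} [∀ x, AddCommGroup (L x)] [∀ x, Module ℂ (L x)]
  [∀ x, TopologicalSpace (L x)] [TopologicalSpace (Bundle.TotalSpace ℂ L)]
  [FiberBundle ℂ L] [VectorBundle ℂ ℂ L]

/-- The zero set of a section of `L^N`. -/
def zeroSet {N : ℕ} (s : ∀ x, ⨂[ℂ]^N (L x)) : Set M := {x | s x = 0}

/-- The vanishing order at `x` of a holomorphic section of `L^N`. At a regular point of the zero
set it is the multiplicity in the zero divisor of the component through that point. -/
def zeroMultiplicity {N : ℕ} (s : ∀ x, ⨂[ℂ]^N (L x)) (x : M) : ℕ :=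
  vanishingOrder (fun z => coeff L N x ((chartAt (Fin (n + 1) → ℂ) x).symm z)
    (s ((chartAt (Fin (n + 1) → ℂ) x).symm z))) (chartAt (Fin (n + 1) → ℂ) x x)

/-- The current of integration `Z_s` over the zero divisor of `s`: a form is integrated, with
multiplicity, over the regular part of the zero set. -/
def zeroCurrent {N : ℕ} (s : ∀ x, ⨂[ℂ]^N (L x)) (φ : Form (n + 1) M (2 * n)) : ℂ :=
  formIntegral (k := n) (regularPart n (zeroSet s))
    (fun x => (zeroMultiplicity (n := n) s x : ℂ) • φ x)

/-- Absolute convergence of the integral defining `(Z_s, φ)`. -/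
def ZeroCurrentConverges {N : ℕ} (s : ∀ x, ⨂[ℂ]^N (L x)) (φ : Form (n + 1) M (2 * n)) : Prop :=
  FormIntegrable (k := n) (regularPart n (zeroSet s))
    (fun x => (zeroMultiplicity (n := n) s x : ℂ) • φ x)

/-- The normalized zero current `(1/N) Z_s` of a section of `L^N`. -/
def normalizedZeroCurrent {N : ℕ} (s : ∀ x, ⨂[ℂ]^N (L x)) (φ : Form (n + 1) M (2 * n)) : ℂ :=
  (1 / (N : ℂ)) * zeroCurrent s φ

/-- The rotation invariant probability measure on the unit sphere of `ℂᵈ`. -/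
def sphereMeasure (d : ℕ) : Measure (Metric.sphere (0 : EuclideanSpace ℂ (Fin d)) 1) :=
  ((volume : Measure (EuclideanSpace ℂ (Fin d))).toSphere Set.univ)⁻¹ •
    (volume : Measure (EuclideanSpace ℂ (Fin d))).toSphere

/-- The section `∑ a_j S_j`. -/
def sectionOf {N d : ℕ} (S : Fin d → ∀ x, ⨂[ℂ]^N (L x)) (a : EuclideanSpace ℂ (Fin d)) :
    ∀ x, ⨂[ℂ]^N (L x) := ∑ j, a j • S j

/-- The expected normalized zero current of `∑ a_j S_j`, with `a` uniform on the unit sphere. -/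
def expectedZeroCurrent {N d : ℕ} (S : Fin d → ∀ x, ⨂[ℂ]^N (L x))
    (φ : Form (n + 1) M (2 * n)) : ℂ :=
  ∫ a : Metric.sphere (0 : EuclideanSpace ℂ (Fin d)) 1,
    normalizedZeroCurrent (sectionOf S a) φ ∂(sphereMeasure d)

/-- The current `φ ↦ ∫_M η ∧ φ` defined by a 2-form `η`. -/
def currentOf (η : Form (n + 1) M 2) (φ : Form (n + 1) M (2 * n)) : ℂ :=
  formIntegral (k := n + 1) Set.univ (fun x => wedge (by ring) (η x) (φ x))

end Zeros

end RandomZeros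

end

/-! The sphere average is first replaced by an average over `a` in ℂᵈ with weight exp(-|a|²). The
zero divisor of s = ∑ a_k S_k does not change when `a` is multiplied by a positive number, so in
polar coordinates the radial integral splits off (`integral_polar`, `integral_sphereMeasure`). The
Gaussian average is then computed by integrating in two ways over the incidence variety of pairs (z,
a) with ∑ a_k S_k(z) = 0. The argument is direct and does not pass through the Poincaré–Lelong
formula.

Where S_j ≠ 0, put g_k = S_k / S_j. The incidence variety is the graph a_j = -∑_{k≠j} a_k g_k(z)
over (z, a'), where a' collects the other coefficients. Let λ = -∑_{k≠j} a_k dg_k be the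
z-derivative of this graph function. Where λ(e_l) ≠ 0, the coordinate z_l can be exchanged for a_j,
which gives coordinates (w, a). With `a` fixed, w parametrizes the zero set of s. The exchange has
real Jacobian |λ(e_l)|², and this is also the ratio between (i/2) λ ∧ λ̄ ∧ φ and the restriction of
φ to ker λ in the coordinates w (`wedge_hermForm_apply`, `GraphChart.pull_eq`). Hence the weighted
integral over `a` of ∫_{Z_s} φ equals the integral over (z, a') of exp(-|a'|² - |a_j|²) (i/2) λ ∧ λ̄
∧ φ.

Expanding λ leaves Gaussian second moments on the hyperplane ∑ a_k g_k(z) = 0. These come from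
inverting a rank-one perturbation of the identity (`integral_gauss_graph`), and they are the
coefficients of the Fubini–Study form up to a power of π (`fsCoeff_eq`). This is the asserted
identity on one patch.

Three points remain. For almost every `a` all zeros are simple, because a holomorphic function has
countably many critical values (`countable_critical_values`); then the whole zero set is regular,
with multiplicity one. The integral over a submanifold, defined by an arbitrary decomposition, can
be computed in any holomorphic coordinates (`RefSystem.formIntegral_eq`). Absolute convergence on
compact patches justifies Fubini and also yields the convergence and integrability claims
(`integral_tsum_slices`). `RatioSystem.gaussian_average` puts these together. -/

noncomputable section

namespace RandomZeros

/-! ### Holomorphic functions of several variables: Cauchy estimates and analyticity. -/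

section Holomorphic

universe u

variable {E F : Type u} [NormedAddCommGroup E] [NormedSpace ℂ E] [NormedAddCommGroup F]
  [NormedSpace ℂ F]

theorem differentiableOn_line {f : E → F} {z₀ : E} {R : ℝ}
    (hf : DifferentiableOn ℂ f (Metric.ball z₀ R)) {z v : E} {r : ℝ} (hr : r * ‖v‖ + dist z z₀ < R) :
    DifferentiableOn ℂ (fun t : ℂ => f (z + t • v)) (Metric.closedBall 0 r) := by
  refine hf.comp (by fun_prop) ?_
  intro t ht
  rw [mem_closedBall_zero_iff] at ht
  rw [Metric.mem_ball]
  have h1 : dist (z + t • v) z ≤ r * ‖v‖ := by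
    rw [dist_eq_norm, add_sub_cancel_left, norm_smul]
    gcongr
  linarith [dist_triangle (z + t • v) z z₀]

theorem deriv_line {f : E → F} {z v : E} (hf : DifferentiableAt ℂ f z) :
    deriv (fun t : ℂ => f (z + t • v)) 0 = fderiv ℂ f z v := by
  have h1 : HasDerivAt (fun t : ℂ => z + t • v) v 0 := by
    simpa using ((hasDerivAt_id (0 : ℂ)).smul_const v).const_add z
  have h2 : HasFDerivAt f (fderiv ℂ f z) (z + (0 : ℂ) • v) := by simpa using hf.hasFDerivAt
  exact (h2.comp_hasDerivAt (0 : ℂ) h1).deriv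

/-- The one-variable Cauchy estimate on the complex line through `z` in direction `v`, on a disc of
radius `δ / ‖v‖`, whose image has radius `δ`. -/
theorem norm_fderiv_le_of_bound {f : E → F} {z₀ : E} {R δ C : ℝ}
    (hf : DifferentiableOn ℂ f (Metric.ball z₀ R)) (hC : ∀ z ∈ Metric.ball z₀ R, ‖f z‖ ≤ C)
    (hδ : 0 < δ) {z : E} (hz : z ∈ Metric.ball z₀ (R - δ)) : ‖fderiv ℂ f z‖ ≤ C / δ := by
  have hz' : dist z z₀ < R - δ := hz
  have hzR : z ∈ Metric.ball z₀ R := by rw [Metric.mem_ball]; linarith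
  have hC0 : 0 ≤ C := (norm_nonneg _).trans (hC z hzR)
  refine ContinuousLinearMap.opNorm_le_bound _ (by positivity) fun v => ?_
  rcases eq_or_ne v 0 with rfl | hv
  · simp
  have hv' : 0 < ‖v‖ := norm_pos_iff.mpr hv
  have hr : δ / ‖v‖ * ‖v‖ = δ := by field_simp
  have hd := differentiableOn_line hf (z := z) (v := v) (r := δ / ‖v‖) (by rw [hr]; linarith)
  rw [← deriv_line (hf.differentiableAt (Metric.isOpen_ball.mem_nhds hzR))]
  have := Complex.norm_deriv_le_of_forall_mem_sphere_norm_le (c := 0) (R := δ / ‖v‖) (C := C)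
    (f := fun t : ℂ => f (z + t • v)) (by positivity)
    (hd.diffContOnCl_ball subset_rfl) ?_
  · refine this.trans (le_of_eq ?_)
    field_simp
  · intro t ht
    refine hC _ ?_
    rw [mem_sphere_zero_iff_norm] at ht
    rw [Metric.mem_ball]
    have h1 : dist (z + t • v) z = δ := by
      rw [dist_eq_norm, add_sub_cancel_left, norm_smul, ht, hr]
    linarith [dist_triangle (z + t • v) z z₀]

/-- The Cauchy estimate is applied to the difference of `f` and a translate of `f`, which is
uniformly small on a ball by uniform continuity. -/
theorem continuousOn_fderiv_of_differentiableOn [FiniteDimensional ℂ E] {f : E → F} {U : Set E}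
    (hU : IsOpen U) (hf : DifferentiableOn ℂ f U) : ContinuousOn (fderiv ℂ f) U := by
  have : ProperSpace E := FiniteDimensional.proper ℂ E
  intro z₁ hz₁
  refine ContinuousAt.continuousWithinAt ?_
  obtain ⟨R, hR, hRU⟩ := Metric.nhds_basis_closedBall.mem_iff.mp (hU.mem_nhds hz₁)
  have huc := (isCompact_closedBall z₁ R).uniformContinuousOn_of_continuous
    (hf.continuousOn.mono hRU)
  rw [Metric.continuousAt_iff]
  intro ε hε
  obtain ⟨δ, hδ, hδ'⟩ := Metric.uniformContinuousOn_iff.mp huc (ε * (R / 4) / 2) (by positivity)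
  refine ⟨min δ (R / 2), by positivity, fun {z} hz => ?_⟩
  have hzδ : dist z z₁ < δ := hz.trans_le (min_le_left _ _)
  have hzR : dist z z₁ < R / 2 := hz.trans_le (min_le_right _ _)
  have hmem : ∀ y ∈ Metric.ball z₁ (R / 2), y ∈ Metric.closedBall z₁ R ∧
      y + (z - z₁) ∈ Metric.closedBall z₁ R := by
    intro y hy
    rw [Metric.mem_ball] at hy
    refine ⟨by rw [Metric.mem_closedBall]; linarith, ?_⟩
    rw [Metric.mem_closedBall]
    have : dist (y + (z - z₁)) y = dist z z₁ := by simp [dist_eq_norm]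
    linarith [dist_triangle (y + (z - z₁)) y z₁]
  have hd1 : ∀ y ∈ Metric.ball z₁ (R / 2), DifferentiableAt ℂ f (y + (z - z₁)) := fun y hy =>
    hf.differentiableAt (hU.mem_nhds (hRU (hmem y hy).2))
  have hd2 : ∀ y ∈ Metric.ball z₁ (R / 2), DifferentiableAt ℂ f y := fun y hy =>
    hf.differentiableAt (hU.mem_nhds (hRU (hmem y hy).1))
  have hd3 : ∀ y ∈ Metric.ball z₁ (R / 2),
      DifferentiableAt ℂ (fun y => f (y + (z - z₁))) y := fun y hy =>
    (hd1 y hy).comp y (f := fun y => y + (z - z₁)) (by fun_prop)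
  have hb := norm_fderiv_le_of_bound (f := fun y => f (y + (z - z₁)) - f y) (z₀ := z₁)
    (R := R / 2) (δ := R / 4) (C := ε * (R / 4) / 2)
    (fun y hy => ((hd3 y hy).sub (hd2 y hy)).differentiableWithinAt) (by
      intro y hy
      rw [← dist_eq_norm]
      refine (hδ' _ (hmem y hy).2 _ (hmem y hy).1 ?_).le
      simpa [dist_eq_norm] using hzδ) (by positivity) (z := z₁)
    (Metric.mem_ball_self (by linarith))
  have hz1 : z₁ ∈ Metric.ball z₁ (R / 2) := Metric.mem_ball_self (by linarith)
  rw [fderiv_fun_sub (hd3 _ hz1) (hd2 _ hz1), fderiv_comp_add_right] at hb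
  rw [dist_eq_norm]
  have e : z₁ + (z - z₁) = z := by abel
  rw [e] at hb
  refine hb.trans_lt ?_
  rw [div_div, mul_comm (2 : ℝ), ← div_div, mul_div_cancel_right₀ _ (by positivity)]
  linarith

/-- The directional derivative is a Cauchy integral of `f` over a circle in direction `v`, and it
may be differentiated under the integral sign because the derivative of `f` is continuous, hence
bounded on a closed ball. -/
theorem differentiableOn_fderiv_apply [FiniteDimensional ℂ E] [CompleteSpace F] {f : E → F}
    {U : Set E} (hU : IsOpen U) (hf : DifferentiableOn ℂ f U) (v : E) :
    DifferentiableOn ℂ (fun z => fderiv ℂ f z v) U := by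
  have : ProperSpace E := FiniteDimensional.proper ℂ E
  intro z₁ hz₁
  refine DifferentiableAt.differentiableWithinAt ?_
  obtain ⟨R, hR, hRU⟩ := Metric.nhds_basis_closedBall.mem_iff.mp (hU.mem_nhds hz₁)
  have hcont := continuousOn_fderiv_of_differentiableOn hU hf
  obtain ⟨C, hC⟩ := (isCompact_closedBall z₁ R).exists_bound_of_continuousOn (hcont.mono hRU)
  -- Circles of radius `r` in direction `v` around points of the ball of radius `R / 2` stay in the
  -- ball of radius `R`; the `+ 1` covers `v = 0`.
  set r : ℝ := R / 2 / (‖v‖ + 1) with hr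
  have hr0 : 0 < r := by positivity
  have hrv : r * ‖v‖ < R / 2 := by
    rw [hr, div_mul_eq_mul_div, div_lt_iff₀ (by positivity)]
    nlinarith [norm_nonneg v]
  have hmem : ∀ z ∈ Metric.ball z₁ (R / 2), ∀ t : ℂ, ‖t‖ ≤ r →
      z + t • v ∈ Metric.closedBall z₁ R := by
    intro z hz t ht
    rw [Metric.mem_ball] at hz
    rw [Metric.mem_closedBall]
    have h1 : dist (z + t • v) z ≤ r * ‖v‖ := by
      rw [dist_eq_norm, add_sub_cancel_left, norm_smul]
      gcongr
    linarith [dist_triangle (z + t • v) z z₁]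
  have hcm : ∀ θ, ‖circleMap 0 r θ‖ ≤ r := fun θ => by simp [abs_of_pos hr0]
  have hcm0 : ∀ θ, circleMap 0 r θ ≠ 0 := fun θ => by
    simpa using circleMap_ne_center (c := 0) (θ := θ) hr0.ne'
  have hda : ∀ z ∈ Metric.ball z₁ (R / 2), ∀ t : ℂ, ‖t‖ ≤ r → DifferentiableAt ℂ f (z + t • v) :=
    fun z hz t ht => hf.differentiableAt (hU.mem_nhds (hRU (hmem z hz t ht)))
  set c : ℝ → ℂ := fun θ => deriv (circleMap 0 r) θ * ((circleMap 0 r θ) ^ 2)⁻¹ with hc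
  have hcc : Continuous c := by
    have h1 : Continuous (circleMap 0 r) := continuous_circleMap 0 r
    simp only [hc, deriv_circleMap]
    exact (h1.mul continuous_const).mul ((h1.pow 2).inv₀ fun θ => pow_ne_zero 2 (hcm0 θ))
  have hrep : ∀ z ∈ Metric.ball z₁ (R / 2), fderiv ℂ f z v =
      (2 * Real.pi * Complex.I : ℂ)⁻¹ • ∫ θ in (0 : ℝ)..2 * Real.pi,
        c θ • f (z + circleMap 0 r θ • v) := by
    intro z hz
    have hz0 : DifferentiableAt ℂ f z := by simpa using hda z hz 0 (by simpa using hr0.le)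
    rw [← deriv_line hz0]
    have hz' : dist z z₁ < R / 2 := hz
    obtain ⟨r', hr'1, hr'2⟩ : ∃ r', r < r' ∧ r' * ‖v‖ + dist z z₁ < R := by
      have : Filter.Tendsto (fun r' => r' * ‖v‖ + dist z z₁) (𝓝[>] r) (𝓝 (r * ‖v‖ + dist z z₁)) :=
        ((by fun_prop : Continuous fun r' => r' * ‖v‖ + dist z z₁).tendsto r).mono_left
          nhdsWithin_le_nhds
      obtain ⟨r', h1, h2⟩ := ((this.eventually_lt_const (u := R) (by linarith)).and
        self_mem_nhdsWithin).exists
      exact ⟨r', h2, h1⟩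
    have hd := (differentiableOn_line (hf.mono (Metric.ball_subset_closedBall.trans hRU)) hr'2).mono
      Metric.ball_subset_closedBall
    rw [← Complex.two_pi_I_inv_smul_circleIntegral_sub_sq_inv_smul_of_differentiable
      Metric.isOpen_ball (c := 0) (R := r) (Metric.closedBall_subset_ball hr'1) hd
      (Metric.mem_ball_self hr0)]
    simp only [circleIntegral, sub_zero, smul_smul, hc]
  have hmt : ∀ z ∈ Metric.ball z₁ (R / 2),
      Set.MapsTo (fun θ => z + circleMap 0 r θ • v) Set.univ U :=
    fun z hz θ _ => hRU (hmem z hz _ (hcm θ))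
  have hline : ∀ z, Continuous fun θ => z + circleMap 0 r θ • v := fun z => by
    have := continuous_circleMap 0 r
    fun_prop
  have hz1 : z₁ ∈ Metric.ball z₁ (R / 2) := Metric.mem_ball_self (by positivity)
  have hcf : ∀ z ∈ Metric.ball z₁ (R / 2),
      Continuous fun θ => c θ • f (z + circleMap 0 r θ • v) := fun z hz => hcc.smul
    (continuousOn_univ.mp (hf.continuousOn.comp (hline z).continuousOn (hmt z hz)))
  have hint := intervalIntegral.hasFDerivAt_integral_of_dominated_of_fderiv_le (𝕜 := ℂ)
    (μ := volume) (a := 0) (b := 2 * Real.pi) (s := Metric.ball z₁ (R / 2))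
    (F := fun z θ => c θ • f (z + circleMap 0 r θ • v))
    (F' := fun z θ => c θ • fderiv ℂ f (z + circleMap 0 r θ • v)) (x₀ := z₁)
    (bound := fun θ => ‖c θ‖ * C) (Metric.ball_mem_nhds _ (by positivity)) ?_ ?_ ?_ ?_ ?_ ?_
  · refine (hint.differentiableAt.const_smul ((2 * Real.pi * Complex.I : ℂ)⁻¹)).congr_of_eventuallyEq ?_
    filter_upwards [Metric.ball_mem_nhds z₁ (half_pos hR)] with z hz
    exact hrep z hz
  · filter_upwards [Metric.ball_mem_nhds z₁ (half_pos hR)] with z hz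
    exact (hcf z hz).aestronglyMeasurable
  · exact (hcf z₁ hz1).intervalIntegrable _ _
  · exact (hcc.smul (continuousOn_univ.mp
      (hcont.comp (hline z₁).continuousOn (hmt z₁ hz1)))).aestronglyMeasurable
  · refine Filter.Eventually.of_forall fun θ _ z hz => ?_
    rw [norm_smul]
    gcongr
    exact hC _ (hmem z hz _ (hcm θ))
  · exact (hcc.norm.mul continuous_const).intervalIntegrable _ _
  · refine Filter.Eventually.of_forall fun θ _ z hz => ?_
    have h1 := (hda z hz _ (hcm θ)).hasFDerivAt
    have h2 : HasFDerivAt (fun z => z + circleMap 0 r θ • v) (ContinuousLinearMap.id ℂ E) z :=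
      (hasFDerivAt_id z).add_const _
    exact (h1.comp z h2).const_smul (c θ)

theorem differentiableOn_fderiv_of_differentiableOn [FiniteDimensional ℂ E] [CompleteSpace F]
    {f : E → F} {U : Set E} (hU : IsOpen U) (hf : DifferentiableOn ℂ f U) :
    DifferentiableOn ℂ (fderiv ℂ f) U := by
  let b := Module.finBasis ℂ E
  have key : fderiv ℂ f = fun z => ∑ i, ContinuousLinearMap.smulRightL ℂ E F
      (LinearMap.toContinuousLinearMap (b.coord i)) (fderiv ℂ f z (b i)) := by
    funext z
    ext v
    conv_lhs => rw [← b.sum_repr v, map_sum]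
    simp
  rw [key]
  refine DifferentiableOn.fun_sum fun i _ => ?_
  exact (ContinuousLinearMap.differentiable _).comp_differentiableOn
    (differentiableOn_fderiv_apply hU hf (b i))

/-- Each derivative costs a factor `1 / δ` and shrinks the ball by `δ`. The induction replaces `F`
by `E →L[ℂ] F`, which is why `E` and `F` share a universe. -/
theorem norm_iteratedFDeriv_le_of_bound [FiniteDimensional ℂ E] [CompleteSpace F] {z₀ : E}
    {δ : ℝ} (hδ : 0 < δ) (j : ℕ) : ∀ {f : E → F} {R C : ℝ},
    DifferentiableOn ℂ f (Metric.ball z₀ R) → (∀ z ∈ Metric.ball z₀ R, ‖f z‖ ≤ C) →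
    ∀ z ∈ Metric.ball z₀ (R - j * δ), ‖iteratedFDeriv ℂ j f z‖ ≤ C / δ ^ j := by
  induction j generalizing F with
  | zero =>
    intro f R C _ hC z hz
    simpa using hC z (by simpa using hz)
  | succ j ih =>
    intro f R C hf hC z hz
    rw [← norm_iteratedFDeriv_fderiv]
    have hsub : Metric.ball z₀ (R - δ) ⊆ Metric.ball z₀ R := Metric.ball_subset_ball (by linarith)
    have := ih ((differentiableOn_fderiv_of_differentiableOn Metric.isOpen_ball hf).mono hsub)
      (fun z hz => norm_fderiv_le_of_bound hf hC hδ hz) z (by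
        convert hz using 2
        push_cast
        ring)
    refine this.trans (le_of_eq ?_)
    rw [div_div, pow_succ']

theorem contDiffOn_of_differentiableOn [FiniteDimensional ℂ E] [CompleteSpace F] {f : E → F}
    {U : Set E} (hU : IsOpen U) (hf : DifferentiableOn ℂ f U) : ContDiffOn ℂ ∞ f U := by
  rw [contDiffOn_infty]
  intro j
  induction j generalizing F with
  | zero => exact contDiffOn_zero.mpr hf.continuousOn
  | succ j ih =>
    rw [Nat.cast_succ]
    refine (contDiffOn_succ_iff_fderiv_of_isOpen hU).mpr
      ⟨hf, fun h => absurd h (by exact_mod_cast WithTop.coe_ne_top), ?_⟩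
    exact ih (differentiableOn_fderiv_of_differentiableOn hU hf)

theorem iteratedDeriv_line [FiniteDimensional ℂ E] [CompleteSpace F] {f : E → F} {z₀ : E} {R : ℝ}
    (hf : DifferentiableOn ℂ f (Metric.ball z₀ R)) (y : E) (j : ℕ) :
    ∀ t : ℂ, z₀ + t • y ∈ Metric.ball z₀ R →
    iteratedDeriv j (fun t : ℂ => f (z₀ + t • y)) t =
      iteratedFDeriv ℂ j f (z₀ + t • y) (fun _ => y) := by
  induction j with
  | zero => intro t _; simp
  | succ j ih =>
    intro t ht
    rw [iteratedDeriv_succ, iteratedFDeriv_succ_apply_left]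
    have hl : Continuous fun t : ℂ => z₀ + t • y := by fun_prop
    have hev : iteratedDeriv j (fun t : ℂ => f (z₀ + t • y)) =ᶠ[𝓝 t]
        fun t => iteratedFDeriv ℂ j f (z₀ + t • y) (fun _ => y) := by
      filter_upwards [(Metric.isOpen_ball.preimage hl).mem_nhds ht] with s hs using ih s hs
    rw [hev.deriv_eq]
    have hcd : ContDiffAt ℂ ∞ f (z₀ + t • y) :=
      (contDiffOn_of_differentiableOn Metric.isOpen_ball hf).contDiffAt
        (Metric.isOpen_ball.mem_nhds ht)
    have h1 : HasFDerivAt (iteratedFDeriv ℂ j f) (fderiv ℂ (iteratedFDeriv ℂ j f) (z₀ + t • y))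
        (z₀ + t • y) :=
      (hcd.differentiableAt_iteratedFDeriv (by exact_mod_cast WithTop.coe_lt_top j)).hasFDerivAt
    have h2 : HasDerivAt (fun t : ℂ => z₀ + t • y) y t := by
      simpa using ((hasDerivAt_id t).smul_const y).const_add z₀
    have h3 := h1.comp_hasDerivAt t h2
    have h4 := ((ContinuousMultilinearMap.apply ℂ (fun _ : Fin j => E) F
      (fun _ => y)).hasFDerivAt).comp_hasDerivAt t h3
    exact h4.deriv

/-- Holomorphic functions of several variables are analytic. -/
theorem analyticAt_of_differentiableOn [FiniteDimensional ℂ E] [CompleteSpace F] {f : E → F}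
    {U : Set E} (hU : IsOpen U) (hf : DifferentiableOn ℂ f U) {z₀ : E} (hz₀ : z₀ ∈ U) :
    AnalyticAt ℂ f z₀ := by
  have : ProperSpace E := FiniteDimensional.proper ℂ E
  obtain ⟨R, hR, hRU⟩ := Metric.nhds_basis_closedBall.mem_iff.mp (hU.mem_nhds hz₀)
  obtain ⟨C, hC⟩ := (isCompact_closedBall z₀ R).exists_bound_of_continuousOn
    (hf.continuousOn.mono hRU)
  have hfR : DifferentiableOn ℂ f (Metric.ball z₀ R) :=
    hf.mono (Metric.ball_subset_closedBall.trans hRU)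
  have hC0 : 0 ≤ C := (norm_nonneg _).trans (hC z₀ (Metric.mem_closedBall_self hR.le))
  set p : FormalMultilinearSeries ℂ E F :=
    fun j => ((j.factorial : ℂ)⁻¹) • iteratedFDeriv ℂ j f z₀ with hp
  -- With `δ = R / (2j)` the Cauchy estimate at the centre is `C (2j / R) ^ j`. Since `j ^ j / j! ≤
  -- e ^ j`, the `j`-th Taylor coefficient is at most `C (2e / R) ^ j = C / r ^ j`.
  set r : ℝ := R / (2 * Real.exp 1) with hr
  have hr0 : 0 < r := by positivity
  have hrR : r < R := by
    rw [hr, div_lt_iff₀ (by positivity)]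
    have : (1 : ℝ) ≤ Real.exp 1 := Real.one_le_exp (by norm_num)
    nlinarith
  have hbound : ∀ j, ‖p j‖ * r ^ j ≤ C := by
    intro j
    rcases Nat.eq_zero_or_pos j with rfl | hj
    · have := hC z₀ (Metric.mem_closedBall_self hR.le)
      simpa [hp] using this
    have hj' : (0 : ℝ) < j := by exact_mod_cast hj
    have h1 := norm_iteratedFDeriv_le_of_bound (δ := R / (2 * j)) (by positivity) j hfR
      (fun z hz => hC z (Metric.ball_subset_closedBall hz)) z₀ (Metric.mem_ball_self (by
        field_simp; linarith))
    have h2 : (j : ℝ) ^ j / j.factorial ≤ Real.exp 1 ^ j := by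
      rw [← Real.exp_nat_mul, mul_one]
      exact Real.pow_div_factorial_le_exp _ hj'.le _
    have hfac : (0 : ℝ) < j.factorial := by exact_mod_cast j.factorial_pos
    have e1 : C / (R / (2 * j)) ^ j * r ^ j =
        C * ((j : ℝ) ^ j / Real.exp 1 ^ j) := by
      rw [hr, div_pow, div_pow, mul_pow, mul_pow]
      field_simp
    calc ‖p j‖ * r ^ j = (j.factorial : ℝ)⁻¹ * (‖iteratedFDeriv ℂ j f z₀‖ * r ^ j) := by
          simp only [hp, norm_smul, norm_inv, Complex.norm_natCast]; ring
      _ ≤ (j.factorial : ℝ)⁻¹ * (C / (R / (2 * j)) ^ j * r ^ j) := by gcongr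
      _ = C * ((j : ℝ) ^ j / j.factorial / Real.exp 1 ^ j) := by rw [e1]; ring
      _ ≤ C * 1 := by
          gcongr
          rw [div_le_one (by positivity)]
          exact h2
      _ = C := mul_one C
  refine ⟨p, ENNReal.ofReal r, ?_, by simpa using hr0, ?_⟩
  · exact p.le_radius_of_bound C (r := r.toNNReal) (by simpa [hr0.le] using hbound)
  · intro y hy
    have hy' : ‖y‖ < r := by
      rw [Metric.mem_eball, edist_zero_right, ← ofReal_norm] at hy
      exact (ENNReal.ofReal_lt_ofReal_iff hr0).mp hy
    -- The disc of radius `s > 1` in the line through `z₀` in direction `y` contains the parameter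
    -- 1, so the one-variable Taylor series there sums to `f (z₀ + y)`.
    obtain ⟨s, hs1, hs2⟩ : ∃ s : ℝ, 1 < s ∧ s * ‖y‖ < R := by
      refine ⟨R / r, (one_lt_div hr0).mpr hrR, ?_⟩
      rw [div_mul_eq_mul_div, div_lt_iff₀ hr0]
      gcongr
    have hd := (differentiableOn_line hfR (z := z₀) (v := y) (r := s) (by simpa using hs2)).mono
      Metric.ball_subset_closedBall
    have hsum := Complex.hasSum_taylorSeries_on_ball hd (z := 1) (by simpa using hs1)
    simp only [one_smul, sub_zero, one_pow] at hsum
    convert hsum using 2 with j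
    rw [iteratedDeriv_line hfR y j 0 (by simpa using hR)]
    simp [hp]

end Holomorphic
end RandomZeros

end

noncomputable section

namespace RandomZeros

/-! ### Replacing one coordinate by a holomorphic function. -/

section Update

variable {ι : Type} [DecidableEq ι]

/-- The linear map replacing the `p`-th coordinate by a linear functional. -/
def updateL (p : ι) (l : (ι → ℂ) →L[ℂ] ℂ) : (ι → ℂ) →L[ℂ] (ι → ℂ) :=
  ContinuousLinearMap.pi fun q => if q = p then l else ContinuousLinearMap.proj q

theorem updateL_apply (p : ι) (l : (ι → ℂ) →L[ℂ] ℂ) (v : ι → ℂ) :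
    updateL p l v = Function.update v p (l v) := by
  ext q
  by_cases h : q = p
  · subst h; simp [updateL]
  · simp [updateL, h]

variable [Fintype ι]

theorem det_updateL (p : ι) (l : (ι → ℂ) →L[ℂ] ℂ) :
    LinearMap.det (updateL p l : (ι → ℂ) →ₗ[ℂ] (ι → ℂ)) = l (Pi.single p 1) := by
  rw [← LinearMap.det_toMatrix']
  have : LinearMap.toMatrix' (updateL p l : (ι → ℂ) →ₗ[ℂ] (ι → ℂ)) =
      (1 : Matrix ι ι ℂ).updateRow p (fun q => l (Pi.single q 1)) := by
    ext i q
    rw [LinearMap.toMatrix'_apply]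
    by_cases h : i = p
    · subst h; simp [updateL_apply]
    · simp [updateL_apply, h, Matrix.one_apply, Pi.single_apply]
  rw [this, ← Matrix.cramer_transpose_apply, Matrix.transpose_one, Matrix.cramer_one]
  rfl

/-- `updateL` as an equivalence. -/
def updateEquiv (p : ι) (l : (ι → ℂ) →L[ℂ] ℂ) (h : l (Pi.single p 1) ≠ 0) :
    (ι → ℂ) ≃L[ℂ] (ι → ℂ) :=
  (LinearMap.equivOfDetNeZero (updateL p l : (ι → ℂ) →ₗ[ℂ] (ι → ℂ))
    (by rwa [det_updateL])).toContinuousLinearEquiv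

theorem coe_updateEquiv (p : ι) (l : (ι → ℂ) →L[ℂ] ℂ) (h : l (Pi.single p 1) ≠ 0) :
    (updateEquiv p l h : (ι → ℂ) →L[ℂ] (ι → ℂ)) = updateL p l := by
  ext v
  rfl

theorem hasFDerivAt_update {G : (ι → ℂ) → ℂ} {p : ι} {x : ι → ℂ} {l : (ι → ℂ) →L[ℂ] ℂ}
    (h : HasFDerivAt G l x) :
    HasFDerivAt (fun x => Function.update x p (G x)) (updateL p l) x := by
  rw [hasFDerivAt_pi']
  intro q
  by_cases hq : q = p
  · subst hq
    simpa [updateL] using h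
  · simp only [updateL, ne_eq, hq, not_false_eq_true, Function.update_of_ne]
    rw [ContinuousLinearMap.proj_pi, if_neg hq]
    exact hasFDerivAt_apply q x

theorem analyticAt_update {G : (ι → ℂ) → ℂ} (p : ι) {x : ι → ℂ} (h : AnalyticAt ℂ G x) :
    AnalyticAt ℂ (fun x => Function.update x p (G x)) x := by
  rw [analyticAt_pi_iff]
  intro q
  by_cases hq : q = p
  · subst hq
    simpa using h
  · simp only [ne_eq, hq, not_false_eq_true, Function.update_of_ne]
    exact (ContinuousLinearMap.proj (R := ℂ) (φ := fun _ : ι => ℂ) q).analyticAt x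

/-- Replacing a coordinate `p` by a holomorphic function `G` with `∂G/∂x_p ≠ 0` is locally
biholomorphic. -/
theorem exists_updateHomeomorph {G : (ι → ℂ) → ℂ} {T : Set (ι → ℂ)} (hT : IsOpen T)
    (hG : DifferentiableOn ℂ G T) {p : ι} {x₀ : ι → ℂ} (hx₀ : x₀ ∈ T)
    (hp : fderiv ℂ G x₀ (Pi.single p 1) ≠ 0) :
    ∃ e : OpenPartialHomeomorph (ι → ℂ) (ι → ℂ), x₀ ∈ e.source ∧ e.source ⊆ T ∧
      (∀ x, e x = Function.update x p (G x)) ∧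
      (∀ x ∈ e.source, fderiv ℂ G x (Pi.single p 1) ≠ 0) ∧
      ContDiffOn ℂ ω e e.source ∧ ContDiffOn ℂ ω e.symm e.target := by
  have han : ∀ x ∈ T, AnalyticAt ℂ G x := fun x hx => analyticAt_of_differentiableOn hT hG hx
  have hcd : ∀ x ∈ T, ContDiffAt ℂ ω (fun x => Function.update x p (G x)) x := fun x hx =>
    (analyticAt_update p (han x hx)).contDiffAt
  have hfd : ∀ x ∈ T, HasFDerivAt (fun x => Function.update x p (G x))
      (updateL p (fderiv ℂ G x)) x := fun x hx =>
    hasFDerivAt_update (hG.differentiableAt (hT.mem_nhds hx)).hasFDerivAt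
  have hf0 := hfd x₀ hx₀
  rw [← coe_updateEquiv p _ hp] at hf0
  let e₀ := (hcd x₀ hx₀).toOpenPartialHomeomorph _ hf0 (by simp)
  have he₀ : ∀ x, e₀ x = Function.update x p (G x) := fun x => rfl
  have hcont : ContinuousOn (fun x => fderiv ℂ G x (Pi.single p 1)) T :=
    (differentiableOn_fderiv_apply hT hG _).continuousOn
  have hopen : IsOpen (T ∩ (fun x => fderiv ℂ G x (Pi.single p 1)) ⁻¹' {0}ᶜ) :=
    hcont.isOpen_inter_preimage hT isOpen_compl_singleton
  -- The inverse function theorem gives smoothness of the inverse only where the derivative is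
  -- invertible. Restricting to the open set where `∂G/∂x_p ≠ 0` secures this at every point of the
  -- target.
  let e := e₀.restrOpen _ hopen
  have hes : e.source = e₀.source ∩ (T ∩ (fun x => fderiv ℂ G x (Pi.single p 1)) ⁻¹' {0}ᶜ) := rfl
  have he : ∀ x, e x = Function.update x p (G x) := fun x => rfl
  have heT : e.source ⊆ T := fun x hx => hx.2.1
  refine ⟨e, ⟨?_, hx₀, hp⟩, heT, he, fun x hx => hx.2.2, ?_, ?_⟩
  · exact (hcd x₀ hx₀).mem_toOpenPartialHomeomorph_source hf0 (by simp)
  · exact fun x hx => (hcd x (heT hx)).contDiffWithinAt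
  · intro y hy
    refine ContDiffAt.contDiffWithinAt ?_
    have hs : e.symm y ∈ e.source := e.map_target hy
    have hs' : fderiv ℂ G (e.symm y) (Pi.single p 1) ≠ 0 := hs.2.2
    refine e.contDiffAt_symm hy (f₀' := updateEquiv p (fderiv ℂ G (e.symm y)) hs') ?_
      (hcd _ (heT hs))
    rw [coe_updateEquiv p _ hs']
    exact hfd _ (heT hs)

end Update

/-! ### Countability of the critical values of a holomorphic function. -/

section Sard

theorem exists_single_ne_zero {ι : Type} [Fintype ι] [DecidableEq ι] {l : (ι → ℂ) →L[ℂ] ℂ}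
    (h : l ≠ 0) : ∃ p, l (Pi.single p 1) ≠ 0 := by
  by_contra! hc
  apply h
  refine ContinuousLinearMap.coe_injective (LinearMap.pi_ext' fun p => ?_)
  ext
  simpa using hc p

/-- The critical values of a holomorphic function form a countable set. -/
theorem countable_critical_values (m : ℕ) : ∀ {f : (Fin m → ℂ) → ℂ} {U : Set (Fin m → ℂ)},
    IsOpen U → DifferentiableOn ℂ f U → (f '' {z ∈ U | fderiv ℂ f z = 0}).Countable := by
  induction m with
  | zero =>
    intro f U _ _
    exact (Set.subsingleton_of_subsingleton.image f).countable
  | succ m ih =>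
    intro f U hU hf
    have han : ∀ z ∈ U, AnalyticAt ℂ f z := fun z hz => analyticAt_of_differentiableOn hU hf hz
    have hcd : ContDiffOn ℂ ∞ f U := contDiffOn_of_differentiableOn hU hf
    -- The critical set is stratified by the order to which `f` is constant: either all derivatives
    -- vanish, or the first nonvanishing one has order `k + 2` for some `k`.
    let C : ℕ → Set (Fin (m + 1) → ℂ) := fun k =>
      {z ∈ U | ∀ j, 1 ≤ j → j ≤ k → iteratedFDeriv ℂ j f z = 0}
    have hcover : {z ∈ U | fderiv ℂ f z = 0} ⊆
        (⋂ k, C k) ∪ ⋃ k, (C (k + 1) \ C (k + 2)) := by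
      rintro z ⟨hzU, hz⟩
      by_cases hall : ∀ j, 1 ≤ j → iteratedFDeriv ℂ j f z = 0
      · exact Or.inl (Set.mem_iInter.mpr fun k => ⟨hzU, fun j hj _ => hall j hj⟩)
      · right
        push Not at hall
        classical
        have h1 : ¬ iteratedFDeriv ℂ 1 f z ≠ 0 := by
          rw [not_not]
          ext v
          simp [hz]
        set j := Nat.find hall with hj
        obtain ⟨hj1, hj2⟩ := Nat.find_spec hall
        have hj3 : j ≠ 1 := fun h => by
          rw [← hj, h] at hj2
          exact h1 hj2
        have hj4 : 2 ≤ j := by omega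
        refine Set.mem_iUnion.mpr ⟨j - 2, ⟨hzU, fun i hi1 hi2 => ?_⟩, fun hC => ?_⟩
        · have := Nat.find_min hall (m := i) (by omega)
          push Not at this
          exact this hi1
        · exact hj2 (hC.2 j hj1 (by omega))
    refine ((Set.Countable.union (s := f '' ⋂ k, C k)
      (t := ⋃ k, f '' (C (k + 1) \ C (k + 2))) ?_
      (Set.countable_iUnion fun k => ?_))).mono ?_
    · -- near such points `f` is constant
      have hloc : ∀ z ∈ ⋂ k, C k, ∃ V ∈ 𝓝[⋂ k, C k] z, (f '' V).Countable := by
        intro z hz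
        have hzU : z ∈ U := (Set.mem_iInter.mp hz 0).1
        obtain ⟨p, r, hp⟩ := han z hzU
        refine ⟨Metric.eball z r, mem_nhdsWithin_of_mem_nhds (Metric.eball_mem_nhds z hp.r_pos), ?_⟩
        refine (Set.countable_singleton (f z)).mono ?_
        rintro _ ⟨y, hy, rfl⟩
        have hs := hp.hasSum_iteratedFDeriv (y := y - z) (by
          simpa [Metric.mem_eball, edist_eq_enorm_sub] using hy)
        rw [add_sub_cancel] at hs
        refine hs.unique ?_
        convert hasSum_single 0 ?_ using 1
        · simp
        · intro j hj
          rw [(Set.mem_iInter.mp hz j).2 j (by omega) le_rfl]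
          simp
      choose! V hV hVc using hloc
      obtain ⟨t, ht1, ht2, ht3⟩ := TopologicalSpace.countable_cover_nhdsWithin hV
      refine ((ht2.biUnion fun x hx => hVc x (ht1 hx))).mono ?_
      rw [← Set.image_iUnion₂]
      exact Set.image_mono ht3
    · have hloc : ∀ z ∈ C (k + 1) \ C (k + 2), ∃ V ∈ 𝓝[C (k + 1) \ C (k + 2)] z,
          (f '' (V ∩ C (k + 1))).Countable := by
        rintro z ⟨⟨hzU, hz1⟩, hz2⟩
        have hz3 : iteratedFDeriv ℂ (k + 2) f z ≠ 0 := by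
          intro h0
          refine hz2 ⟨hzU, fun j hj1 hj2 => ?_⟩
          rcases Nat.lt_or_ge j (k + 2) with h | h
          · exact hz1 j hj1 (by omega)
          · rw [show j = k + 2 by omega]; exact h0
        obtain ⟨v, hv⟩ : ∃ v, iteratedFDeriv ℂ (k + 2) f z v ≠ 0 := by
          by_contra! hc
          exact hz3 (ContinuousMultilinearMap.ext hc)
        rw [iteratedFDeriv_succ_apply_left] at hv
        set g : (Fin (m + 1) → ℂ) → ℂ := fun y => iteratedFDeriv ℂ (k + 1) f y (Fin.tail v) with hg
        have hda : ∀ y ∈ U, HasFDerivAt g ((ContinuousMultilinearMap.apply ℂ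
            (fun _ : Fin (k + 1) => Fin (m + 1) → ℂ) ℂ (Fin.tail v)).comp
              (fderiv ℂ (iteratedFDeriv ℂ (k + 1) f) y)) y := by
          intro y hy
          have h1 := ((hcd.contDiffAt (hU.mem_nhds hy)).differentiableAt_iteratedFDeriv
            (m := k + 1) (by exact_mod_cast WithTop.coe_lt_top (k + 1))).hasFDerivAt
          exact (ContinuousMultilinearMap.apply ℂ
            (fun _ : Fin (k + 1) => Fin (m + 1) → ℂ) ℂ (Fin.tail v)).hasFDerivAt.comp y h1
        have hgd : DifferentiableOn ℂ g U := fun y hy =>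
          (hda y hy).differentiableAt.differentiableWithinAt
        have hgz : fderiv ℂ g z ≠ 0 := by
          intro h0
          apply hv
          have := congrArg (fun l => l (v 0)) ((hda z hzU).fderiv.symm.trans h0)
          simpa using this
        obtain ⟨p, hp⟩ := exists_single_ne_zero hgz
        obtain ⟨e, hze, heU, he, -, -, hes⟩ := exists_updateHomeomorph hU hgd hzU hp
        refine ⟨e.source, mem_nhdsWithin_of_mem_nhds (e.open_source.mem_nhds hze), ?_⟩
        have hins : Continuous fun w : Fin m → ℂ => (p.insertNth (0 : ℂ) w : Fin (m + 1) → ℂ) := by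
          fun_prop
        have hinsd : Differentiable ℂ
            fun w : Fin m → ℂ => (p.insertNth (0 : ℂ) w : Fin (m + 1) → ℂ) := by
          rw [differentiable_pi]
          intro i
          rcases Fin.eq_self_or_eq_succAbove p i with rfl | ⟨q, rfl⟩
          · simp
          · simpa using differentiable_apply q
        have hO : IsOpen ((fun w : Fin m → ℂ => (p.insertNth (0 : ℂ) w : Fin (m + 1) → ℂ)) ⁻¹'
          e.target) := e.open_target.preimage hins
        have hσ : DifferentiableOn ℂ (fun w : Fin m → ℂ => e.symm (p.insertNth (0 : ℂ) w))
            ((fun w : Fin m → ℂ => (p.insertNth (0 : ℂ) w : Fin (m + 1) → ℂ)) ⁻¹' e.target) :=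
          (hes.differentiableOn (by simp)).comp hinsd.differentiableOn (Set.mapsTo_preimage _ _)
        have hfσ := hf.comp hσ (fun w hw => heU (e.map_target hw))
        refine (ih hO hfσ).mono ?_
        rintro _ ⟨y, ⟨hye, hyC⟩, rfl⟩
        have hgy : g y = 0 := by simp [hg, hyC.2 (k + 1) (by omega) le_rfl]
        have hey : e y = p.insertNth (0 : ℂ) (p.removeNth y) := by
          rw [he, hgy, Fin.insertNth_removeNth]
        have hσy : e.symm (p.insertNth (0 : ℂ) (p.removeNth y)) = y := by
          rw [← hey, e.left_inv hye]
        have hyO : p.removeNth y ∈ ((fun w : Fin m → ℂ =>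
            (p.insertNth (0 : ℂ) w : Fin (m + 1) → ℂ)) ⁻¹' e.target) := by
          rw [Set.mem_preimage, ← hey]
          exact e.map_source hye
        refine ⟨p.removeNth y, ⟨hyO, ?_⟩, congrArg f hσy⟩
        have hfy : fderiv ℂ f y = 0 := by
          have h1 := hyC.2 1 le_rfl (by omega)
          ext u
          have := congrArg (fun l => l (fun _ => u)) h1
          simpa using this
        rw [fderiv_comp _ (by
            simp only [hσy]
            exact hf.differentiableAt (hU.mem_nhds (heU hye)))
          (hσ.differentiableAt (hO.mem_nhds hyO))]
        simp only [hσy, hfy, ContinuousLinearMap.zero_comp]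
      choose! V hV hVc using hloc
      obtain ⟨t, ht1, ht2, ht3⟩ := TopologicalSpace.countable_cover_nhdsWithin hV
      refine ((ht2.biUnion fun x hx => hVc x (ht1 hx))).mono ?_
      rw [← Set.image_iUnion₂]
      refine Set.image_mono fun y hy => ?_
      obtain ⟨x, hx, hxy⟩ := Set.mem_iUnion₂.mp (ht3 hy)
      exact Set.mem_iUnion₂.mpr ⟨x, hx, hxy, hy.1⟩
    · refine (Set.image_mono hcover).trans ?_
      rw [Set.image_union, Set.image_iUnion]

end Sard

end RandomZeros

end

noncomputable section

namespace RandomZeros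

/-! ### Algebra of the wedge product. -/

section Wedge

variable {k p q r : ℕ}

/-- The index bijection in the definition of `wedge`. -/
abbrev wedgeIndex (h : p + q = r) : Fin p ⊕ Fin q ≃ Fin r := finSumFinEquiv.trans (finCongr h)

theorem alt_add_apply (a b : Alt k p) (v : Fin p → Fin k → ℂ) : (a + b) v = a v + b v := rfl

theorem alt_smul_apply (c : ℂ) (a : Alt k p) (v : Fin p → Fin k → ℂ) : (c • a) v = c * a v := rfl

theorem alt_sum_apply {ι : Type*} (s : Finset ι) (a : ι → Alt k p) (v : Fin p → Fin k → ℂ) :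
    (∑ i ∈ s, a i) v = ∑ i ∈ s, a i v :=
  map_sum (⟨⟨fun a => a v, rfl⟩, fun _ _ => rfl⟩ : Alt k p →+ ℂ) a s

theorem wedge_eq_sum_summand (h : p + q = r) (a : Alt k p) (b : Alt k q) (v : Fin r → Fin k → ℂ) :
    wedge h a b v = ∑ σ : Equiv.Perm.ModSumCongr (Fin p) (Fin q),
      LinearMap.mul' ℝ ℂ (AlternatingMap.domCoprod.summand a b σ (v ∘ wedgeIndex h)) := by
  rw [← map_sum]
  simp only [wedge, AlternatingMap.domDomCongr_apply, LinearMap.compAlternatingMap_apply,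
    AlternatingMap.domCoprod_apply, sum_apply]

theorem mul'_summand_mk (h : p + q = r) (a : Alt k p) (b : Alt k q) (v : Fin r → Fin k → ℂ)
    (σ : Equiv.Perm (Fin p ⊕ Fin q)) :
    LinearMap.mul' ℝ ℂ (AlternatingMap.domCoprod.summand a b (Quotient.mk'' σ)
      (v ∘ wedgeIndex h)) = ((Equiv.Perm.sign σ : ℤ) : ℂ) *
      (a (fun i => v (wedgeIndex h (σ (Sum.inl i)))) *
        b (fun i => v (wedgeIndex h (σ (Sum.inr i))))) := by
  rw [AlternatingMap.domCoprod.summand_mk'']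
  change LinearMap.mul' ℝ ℂ (((Equiv.Perm.sign σ : ℤˣ) : ℤ) •
    ((a fun i => v (wedgeIndex h (σ (Sum.inl i)))) ⊗ₜ[ℝ]
      (b fun i => v (wedgeIndex h (σ (Sum.inr i)))))) = _
  rw [map_zsmul, LinearMap.mul'_apply, zsmul_eq_mul]

/-- Choosing coset representatives turns the shuffle sum into an explicit scalar sum, from which
linearity, continuity and compatibility with pullback can be read off termwise. -/
theorem wedge_apply (h : p + q = r) (a : Alt k p) (b : Alt k q) (v : Fin r → Fin k → ℂ) :
    wedge h a b v = ∑ σ : Equiv.Perm.ModSumCongr (Fin p) (Fin q),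
      ((Equiv.Perm.sign σ.out : ℤ) : ℂ) *
      (a (fun i => v (wedgeIndex h (σ.out (Sum.inl i)))) *
        b (fun i => v (wedgeIndex h (σ.out (Sum.inr i))))) := by
  rw [wedge_eq_sum_summand]
  refine Finset.sum_congr rfl fun σ _ => ?_
  rw [← mul'_summand_mk]
  congr 2
  rw [Quotient.mk''_eq_mk, Quotient.out_eq]

theorem wedge_add_left (h : p + q = r) (a a' : Alt k p) (b : Alt k q) :
    wedge h (a + a') b = wedge h a b + wedge h a' b := by
  ext v
  simp only [wedge_apply, alt_add_apply, add_mul, mul_add, Finset.sum_add_distrib]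

theorem wedge_smul_left (h : p + q = r) (c : ℂ) (a : Alt k p) (b : Alt k q) :
    wedge h (c • a) b = c • wedge h a b := by
  ext v
  simp only [wedge_apply, alt_smul_apply, Finset.mul_sum]
  exact Finset.sum_congr rfl fun σ _ => by ring

theorem wedge_zero_left (h : p + q = r) (b : Alt k q) : wedge h (0 : Alt k p) b = 0 := by
  simpa using wedge_smul_left h (0 : ℂ) (0 : Alt k p) b

theorem wedge_sum_left (h : p + q = r) {ι : Type*} (s : Finset ι) (a : ι → Alt k p)
    (b : Alt k q) : wedge h (∑ i ∈ s, a i) b = ∑ i ∈ s, wedge h (a i) b := by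
  classical
  induction s using Finset.induction_on with
  | empty => simpa using wedge_zero_left h b
  | insert i s hi ih => rw [Finset.sum_insert hi, Finset.sum_insert hi, wedge_add_left, ih]

theorem wedge_compLinearMap {l : ℕ} (h : p + q = r) (a : Alt k p) (b : Alt k q)
    (T : (Fin l → ℂ) →ₗ[ℝ] (Fin k → ℂ)) :
    (wedge h a b).compLinearMap T = wedge h (a.compLinearMap T) (b.compLinearMap T) := by
  ext v
  simp only [AlternatingMap.compLinearMap_apply, wedge_apply]

/-- If `a` vanishes as soon as one argument is among the last `q` vectors, only one shuffle
contributes to the wedge product. -/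
theorem wedge_apply_of_vanish (h : p + q = r) (a : Alt k p) (b : Alt k q)
    (v : Fin r → Fin k → ℂ)
    (ha : ∀ w : Fin p → Fin k → ℂ, (∃ i j, w i = v (wedgeIndex h (Sum.inr j))) → a w = 0) :
    wedge h a b v = a (fun i => v (wedgeIndex h (Sum.inl i))) *
      b (fun i => v (wedgeIndex h (Sum.inr i))) := by
  rw [wedge_eq_sum_summand]
  refine (Finset.sum_eq_single (Quotient.mk'' 1) ?_ ?_).trans ?_
  rotate_left 2
  · rw [mul'_summand_mk]
    simp
  · intro σ _ hσ
    induction σ using Quotient.inductionOn' with | _ σ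
    rw [mul'_summand_mk]
    -- A permutation preserving the first block lies in the subgroup of block permutations, so its
    -- coset would be the trivial one.
    have : ∃ i j, σ (Sum.inl i) = Sum.inr j := by
      by_contra! hc
      apply hσ
      refine Quotient.sound' ?_
      rw [QuotientGroup.leftRel_apply, mul_one]
      refine inv_mem (Equiv.Perm.mem_sumCongrHom_range_of_perm_mapsTo_inl ?_)
      rintro _ ⟨i, rfl⟩
      rcases hi : σ (Sum.inl i) with j | j
      · exact ⟨j, rfl⟩
      · exact absurd hi (hc i j)
    obtain ⟨i, j, hij⟩ := this
    rw [ha _ ⟨i, j, by rw [hij]⟩]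
    simp
  · simp

end Wedge

/-! ### Forms of top degree and complex determinants. -/

section TopForm

theorem span_realBasis (k : ℕ) : ⊤ ≤ Submodule.span ℝ (Set.range (realBasis k)) := by
  intro z _
  have hz : z = ∑ j : Fin k, ((z j).re • realBasis k ⟨2 * j.1, by omega⟩ +
      (z j).im • realBasis k ⟨2 * j.1 + 1, by omega⟩) := by
    ext i
    rw [Finset.sum_apply, Finset.sum_eq_single i]
    · have h1 : (2 * i.1 + 1) / 2 = i.1 := by omega
      have h2 : (2 * i.1 + 1) % 2 = 1 := by omega
      simp [realBasis, h1, h2, Complex.re_add_im]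
    · intro j _ hj
      have h1 : (2 * j.1 + 1) / 2 = j.1 := by omega
      simp [realBasis, h1, Pi.single_eq_of_ne (Ne.symm hj)]
    · simp
  rw [hz]
  exact Submodule.sum_mem _ fun j _ => Submodule.add_mem _
    (Submodule.smul_mem _ _ (Submodule.subset_span ⟨_, rfl⟩))
    (Submodule.smul_mem _ _ (Submodule.subset_span ⟨_, rfl⟩))

/-- `realBasis` as a basis. -/
def realBasisB (k : ℕ) : Module.Basis (Fin (2 * k)) ℝ (Fin k → ℂ) :=
  basisOfTopLeSpanOfCardEqFinrank (realBasis k) (span_realBasis k) (by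
    simp [Module.finrank_pi_fintype, mul_comm])

theorem coe_realBasisB (k : ℕ) : ⇑(realBasisB k) = realBasis k := by
  simp [realBasisB]

theorem det_restrictScalars_complex {V : Type*} [AddCommGroup V] [Module ℂ V]
    (T : V →ₗ[ℂ] V) :
    LinearMap.det (T.restrictScalars ℝ) = ‖LinearMap.det T‖ ^ 2 := by
  rw [LinearMap.det_restrictScalars, Algebra.norm_complex_apply, Complex.normSq_eq_norm_sq]

/-- A top form is a multiple of the real determinant, and a complex linear map has real determinant
`|det|²`. In particular no orientation sign ever appears. -/
theorem top_form_comp {k : ℕ} (Ω : Alt k (2 * k)) (T : (Fin k → ℂ) →ₗ[ℂ] (Fin k → ℂ)) :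
    Ω (fun i => T (realBasis k i)) = ((‖LinearMap.det T‖ ^ 2 : ℝ) : ℂ) * Ω (realBasis k) := by
  have key : Ω = ((LinearMap.toSpanSingleton ℝ ℂ (Ω (realBasis k))).compAlternatingMap
      (realBasisB k).det : Alt k (2 * k)) := by
    refine Module.Basis.ext_alternating (realBasisB k) fun σ hσ => ?_
    obtain ⟨τ, rfl⟩ : ∃ τ : Equiv.Perm (Fin (2 * k)), ⇑τ = σ :=
      ⟨Equiv.ofBijective σ (Finite.injective_iff_bijective.mp hσ), rfl⟩
    have h1 := Ω.map_perm (realBasisB k) τ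
    have h2 := (realBasisB k).det.map_perm (realBasisB k) τ
    simp only [Function.comp_def] at h1 h2
    rw [h1, LinearMap.compAlternatingMap_apply, h2, Module.Basis.det_self,
      LinearMap.toSpanSingleton_apply, coe_realBasisB]
    simp [Units.smul_def]
  conv_lhs => rw [key]
  rw [LinearMap.compAlternatingMap_apply, LinearMap.toSpanSingleton_apply]
  have h3 := Module.Basis.det_comp (realBasisB k) (T.restrictScalars ℝ) (realBasisB k)
  rw [Module.Basis.det_self, mul_one, det_restrictScalars_complex, coe_realBasisB] at h3
  have h4 : (⇑(T.restrictScalars ℝ) ∘ realBasis k) = fun i => T (realBasis k i) := rfl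
  rw [h4] at h3
  rw [h3, Complex.real_smul]

end TopForm

/-! ### The forms `λ ∧ μ̄` and restriction to the kernel of `λ`. -/

section HermForm

variable {k : ℕ}

/-- The 2-form `λ ∧ μ̄`. -/
def hermForm (l m : (Fin k → ℂ) →L[ℂ] ℂ) : Alt k 2 where
  toFun v := l (v 0) * (starRingEnd ℂ) (m (v 1)) - l (v 1) * (starRingEnd ℂ) (m (v 0))
  map_update_add' v i x y := by
    fin_cases i <;> simp [Function.update] <;> ring
  map_update_smul' v i c x := by
    fin_cases i <;> simp [Function.update] <;> ring
  map_eq_zero_of_eq' v i j hv hij := by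
    have : v 0 = v 1 := by
      fin_cases i <;> fin_cases j <;> simp_all
    simp [this]

theorem hermForm_apply (l m : (Fin k → ℂ) →L[ℂ] ℂ) (v : Fin 2 → Fin k → ℂ) :
    hermForm l m v = l (v 0) * (starRingEnd ℂ) (m (v 1)) -
      l (v 1) * (starRingEnd ℂ) (m (v 0)) := rfl

theorem realBasis_inl {n : ℕ} (h : 2 + 2 * n = 2 * (n + 1)) (i : Fin 2) :
    realBasis (n + 1) (wedgeIndex h (Sum.inl i)) =
      Fin.cons (if i = 0 then 1 else Complex.I) 0 := by
  have hz : (Fin.cons (if i = 0 then 1 else Complex.I) 0 : Fin (n + 1) → ℂ) =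
      Pi.single 0 (if i = 0 then 1 else Complex.I) := by
    ext j
    refine Fin.cases ?_ (fun j => ?_) j <;> simp
  rw [hz]
  fin_cases i <;> simp [realBasis]

theorem realBasis_inr {n : ℕ} (h : 2 + 2 * n = 2 * (n + 1)) (j : Fin (2 * n)) :
    realBasis (n + 1) (wedgeIndex h (Sum.inr j)) = Fin.cons 0 (realBasis n j) := by
  ext i
  have h1 : (2 + j.1) / 2 = j.1 / 2 + 1 := by omega
  have h2 : (2 + j.1) % 2 = j.1 % 2 := by omega
  refine Fin.cases ?_ (fun i => ?_) i
  · simp only [realBasis, Equiv.trans_apply, finSumFinEquiv_apply_right, finCongr_apply,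
      Fin.val_cast, Fin.val_natAdd, Fin.cons_zero]
    rw [Pi.single_eq_of_ne]
    intro hc
    have := congrArg Fin.val hc
    simp only [Fin.val_zero] at this
    omega
  · simp only [realBasis, Equiv.trans_apply, finSumFinEquiv_apply_right, finCongr_apply,
      Fin.val_cast, Fin.val_natAdd, Fin.cons_succ, h2, Pi.single_apply]
    congr 1
    simp only [Fin.ext_iff, Fin.val_succ, eq_iff_iff]
    omega

/-- The wedge of `(i/2) λ ∧ λ̄` with a form `ϕ` measures `ϕ` on `ker λ`, parametrized by the
coordinates other than `x_j`. -/
theorem wedge_hermForm_apply {n : ℕ} (h : 2 + 2 * n = 2 * (n + 1))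
    (l : (Fin (n + 1) → ℂ) →L[ℂ] ℂ) (ϕ : Alt (n + 1) (2 * n)) (j : Fin (n + 1))
    (hj : l (Pi.single j 1) ≠ 0) (D : (Fin n → ℂ) →ₗ[ℂ] (Fin (n + 1) → ℂ))
    (hD : ∀ w, l (D w) = 0) (hDj : ∀ w, j.removeNth (D w) = w) :
    wedge h ((Complex.I / 2) • hermForm l l) ϕ (realBasis (n + 1)) =
      ((‖l (Pi.single j 1)‖ ^ 2 : ℝ) : ℂ) * ϕ (fun i => D (realBasis n i)) := by
  set c := l (Pi.single j 1) with hc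
  set v₀ : Fin (n + 1) → ℂ := c⁻¹ • Pi.single j 1 with hv₀
  -- A basis adapted to `l`: first the vector `v₀` with `l v₀ = 1`, then the images under `D`, which
  -- lie in `ker l`. On it only one shuffle of the wedge product survives, and `(i/2) λ ∧ λ̄` takes
  -- the value 1 on `v₀, i v₀`.
  let B : (Fin (n + 1) → ℂ) →ₗ[ℂ] (Fin (n + 1) → ℂ) :=
    { toFun := fun x => x 0 • v₀ + D (Fin.tail x)
      map_add' := fun x y => by
        have : Fin.tail (x + y) = Fin.tail x + Fin.tail y := rfl
        rw [this, map_add, Pi.add_apply, add_smul]; abel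
      map_smul' := fun a x => by
        have : Fin.tail (a • x) = a • Fin.tail x := rfl
        rw [this, map_smul, Pi.smul_apply, smul_eq_mul, mul_smul, RingHom.id_apply, smul_add] }
  have hB : ∀ x, B x = x 0 • v₀ + D (Fin.tail x) := fun x => rfl
  have hdet : ‖LinearMap.det B‖ ^ 2 = (‖c‖ ^ 2)⁻¹ := by
    -- The first column is `c⁻¹ e_j`, and deleting row `j` leaves the identity matrix because the
    -- other coordinates of `D w` are `w`. The determinant is `± c⁻¹`; the norm removes the sign.
    rw [← LinearMap.det_toMatrix', Matrix.det_succ_column_zero, Finset.sum_eq_single j]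
    · have h1 : ((LinearMap.toMatrix' B).submatrix j.succAbove Fin.succ) = 1 := by
        ext a b
        rw [Matrix.submatrix_apply, LinearMap.toMatrix'_apply, hB]
        have h2 : Fin.tail (Pi.single b.succ (1 : ℂ) : Fin (n + 1) → ℂ) = Pi.single b 1 := by
          ext i
          simp [Fin.tail, Pi.single_apply]
        have h3 := congrFun (hDj (Pi.single b 1)) a
        rw [Fin.removeNth_apply] at h3
        rw [h2]
        simp [h3, Matrix.one_apply, Pi.single_apply]
      have h4 : Fin.tail (Pi.single 0 (1 : ℂ) : Fin (n + 1) → ℂ) = 0 := by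
        ext i
        simp [Fin.tail]
      rw [h1, LinearMap.toMatrix'_apply, hB, h4]
      simp [hv₀]
    · intro i _ hij
      have h4 : Fin.tail (Pi.single 0 (1 : ℂ) : Fin (n + 1) → ℂ) = 0 := by
        ext i
        simp [Fin.tail]
      rw [LinearMap.toMatrix'_apply, hB, h4]
      simp [hv₀, hij]
    · simp
  have hlv : l v₀ = 1 := by simp [hv₀, ← hc, hj]
  have htop := top_form_comp (wedge h ((Complex.I / 2) • hermForm l l) ϕ) B
  have hr : ∀ j, B (realBasis (n + 1) (wedgeIndex h (Sum.inr j))) = D (realBasis n j) := by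
    intro j
    rw [realBasis_inr, hB]
    simp
  have hl : ∀ i, B (realBasis (n + 1) (wedgeIndex h (Sum.inl i))) =
      (if i = 0 then (1 : ℂ) else Complex.I) • v₀ := by
    intro i
    rw [realBasis_inl, hB]
    simp
  rw [wedge_apply_of_vanish h _ ϕ (fun i => B (realBasis (n + 1) i)) ?_] at htop
  · simp only [hr, hl] at htop
    rw [hdet, alt_smul_apply, hermForm_apply] at htop
    simp only [if_true, one_smul, one_ne_zero, if_false, map_smul, hlv, smul_eq_mul, mul_one,
      Complex.conj_I, map_one, one_mul] at htop
    have e : Complex.I / 2 * (-Complex.I - Complex.I) = 1 := by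
      ring_nf
      simp
    rw [e, one_mul] at htop
    rw [htop, Complex.ofReal_inv, mul_inv_cancel_left₀]
    simpa using hj
  · rintro w ⟨i, j, hij⟩
    rw [hr] at hij
    have h0 : l (w i) = 0 := by rw [hij, hD]
    rw [alt_smul_apply, hermForm_apply]
    fin_cases i
    · simp at h0
      simp [h0]
    · simp at h0
      simp [h0]

end HermForm

end RandomZeros

end

noncomputable section

namespace RandomZeros

/-! ### Explicit form of the Fubini–Study form. -/

section FubiniStudy

variable {d : ℕ}

/-- The Hermitian product `∑ x_j ȳ_j`. -/
def hdot (x y : Fin d → ℂ) : ℂ := ∑ j, x j * (starRingEnd ℂ) (y j)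

theorem hdot_add_left (x y z : Fin d → ℂ) : hdot (x + y) z = hdot x z + hdot y z := by
  simp [hdot, add_mul, Finset.sum_add_distrib]

theorem hdot_smul_left (c : ℂ) (x z : Fin d → ℂ) : hdot (c • x) z = c * hdot x z := by
  simp [hdot, mul_assoc, Finset.mul_sum]

theorem hdot_conj (x y : Fin d → ℂ) : (starRingEnd ℂ) (hdot x y) = hdot y x := by
  simp [hdot, mul_comm]

theorem hdot_add_right (x y z : Fin d → ℂ) : hdot z (x + y) = hdot z x + hdot z y := by
  rw [← hdot_conj, hdot_add_left, map_add, hdot_conj, hdot_conj]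

theorem hdot_smul_right (c : ℂ) (x z : Fin d → ℂ) :
    hdot z (c • x) = (starRingEnd ℂ) c * hdot z x := by
  rw [← hdot_conj, hdot_smul_left, map_mul, hdot_conj]

theorem hdot_self (x : Fin d → ℂ) : hdot x x = ((∑ j, ‖x j‖ ^ 2 : ℝ) : ℂ) := by
  simp [hdot, Complex.mul_conj, Complex.normSq_eq_norm_sq]

theorem sum_norm_sq_pos {x : Fin d → ℂ} (hx : x ≠ 0) : 0 < ∑ j, ‖x j‖ ^ 2 := by
  obtain ⟨j, hj⟩ := Function.ne_iff.mp hx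
  refine Finset.sum_pos' (fun i _ => by positivity) ⟨j, Finset.mem_univ j, ?_⟩
  have : 0 < ‖x j‖ := norm_pos_iff.mpr hj
  positivity

theorem hdot_self_ne_zero {x : Fin d → ℂ} (hx : x ≠ 0) : hdot x x ≠ 0 := by
  rw [hdot_self]
  exact_mod_cast (sum_norm_sq_pos hx).ne'

theorem hasFDerivAt_coord (y : Fin d → ℂ) (j : Fin d) :
    HasFDerivAt (fun y : Fin d → ℂ => y j)
      (ContinuousLinearMap.proj (R := ℝ) (φ := fun _ : Fin d => ℂ) j) y :=
  hasFDerivAt_apply j y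

theorem hasFDerivAt_log_sum (y : Fin d → ℂ) (hy : y ≠ 0) :
    ∃ D : (Fin d → ℂ) →L[ℝ] ℂ,
      HasFDerivAt (fun w : Fin d → ℂ => ((Real.log (∑ j, ‖w j‖ ^ 2) : ℝ) : ℂ)) D y ∧
      ∀ v, D v = (hdot v y + hdot y v) / hdot y y := by
  have h1 := HasFDerivAt.fun_sum (u := Finset.univ) fun j _ => (hasFDerivAt_coord y j).norm_sq
  have h2 := h1.log (sum_norm_sq_pos hy).ne'
  refine ⟨_, Complex.ofRealCLM.hasFDerivAt.comp y h2, fun v => ?_⟩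
  have e : hdot v y + hdot y v = ((2 * ∑ j, (y j).re * (v j).re + 2 * ∑ j, (y j).im * (v j).im : ℝ) : ℂ) := by
    rw [← hdot_conj y v, add_comm, Complex.add_conj, hdot, Complex.re_sum]
    push_cast
    rw [← mul_add, ← Finset.sum_add_distrib]
    congr 1
    refine Finset.sum_congr rfl fun j _ => ?_
    simp
  rw [e, hdot_self]
  rw [ContinuousLinearMap.comp_apply, Complex.ofRealCLM_apply, smul_apply]
  rw [← Complex.ofReal_div]
  congr 1
  rw [div_eq_inv_mul, smul_eq_mul, ← mul_add, ← Finset.sum_add_distrib, Finset.mul_sum]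
  congr 1
  rw [sum_apply]
  refine Finset.sum_congr rfl fun j _ => ?_
  simp [Complex.inner]
  ring

/-- `∂̄ log |y|²` in coordinates. -/
def dbarLog (y : Fin d → ℂ) : (Fin d → ℂ) →L[ℝ] ℂ :=
  (hdot y y)⁻¹ • ∑ j, y j • ((Complex.conjCLE : ℂ →L[ℝ] ℂ).comp
    (ContinuousLinearMap.proj (R := ℝ) (φ := fun _ : Fin d => ℂ) j))

theorem dbarLog_apply (y v : Fin d → ℂ) : dbarLog y v = hdot y v / hdot y y := by
  simp [dbarLog, hdot, div_eq_inv_mul]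

theorem dbar_log_sum (y : Fin d → ℂ) (hy : y ≠ 0) :
    dbar (fun w : Fin d → ℂ => ((Real.log (∑ j, ‖w j‖ ^ 2) : ℝ) : ℂ)) y = dbarLog y := by
  obtain ⟨D, hD, hDv⟩ := hasFDerivAt_log_sum y hy
  ext v
  have h2 : dbar (fun w : Fin d → ℂ => ((Real.log (∑ j, ‖w j‖ ^ 2) : ℝ) : ℂ)) y v =
      (1 / 2 : ℂ) * (D v + Complex.I * D (Complex.I • v)) := by
    simp [dbar, hD.fderiv, mul_add]
  rw [h2, hDv, hDv, dbarLog_apply, hdot_smul_left, hdot_smul_right, Complex.conj_I]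
  linear_combination (1 / 2 : ℂ) * (hdot v y - hdot y v) / hdot y y * Complex.I_sq

theorem hasFDerivAt_hdot_self (y : Fin d → ℂ) : ∃ D : (Fin d → ℂ) →L[ℝ] ℂ,
    HasFDerivAt (fun y : Fin d → ℂ => hdot y y) D y ∧ ∀ v, D v = hdot v y + hdot y v := by
  have h1 := HasFDerivAt.fun_sum (u := Finset.univ) fun j _ =>
    (hasFDerivAt_coord y j).mul ((Complex.conjCLE : ℂ →L[ℝ] ℂ).hasFDerivAt.comp y
      (hasFDerivAt_coord y j))
  refine ⟨_, h1, fun v => ?_⟩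
  rw [sum_apply, hdot, hdot, ← Finset.sum_add_distrib]
  refine Finset.sum_congr rfl fun j _ => ?_
  simp
  ring

theorem differentiableAt_dbarLog (y : Fin d → ℂ) (hy : y ≠ 0) :
    DifferentiableAt ℝ (dbarLog (d := d)) y := by
  obtain ⟨D, hD, -⟩ := hasFDerivAt_hdot_self y
  refine (hD.differentiableAt.inv (hdot_self_ne_zero hy)).smul ?_
  refine DifferentiableAt.fun_sum fun j _ => ?_
  exact (hasFDerivAt_coord y j).differentiableAt.smul_const _

theorem fderiv_dbarLog_apply (w u v : Fin d → ℂ) (hw : w ≠ 0) :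
    fderiv ℝ (fun y => dbarLog y v) w u =
      hdot u v / hdot w w - hdot w v * (hdot u w + hdot w u) / hdot w w ^ 2 := by
  obtain ⟨D, hD, hDv⟩ := hasFDerivAt_hdot_self w
  have h1 := HasFDerivAt.fun_sum (u := Finset.univ) fun j (_ : j ∈ Finset.univ) =>
    (hasFDerivAt_coord w j).mul_const ((starRingEnd ℂ) (v j))
  have h2 := h1.mul (((hasDerivAt_inv (hdot_self_ne_zero hw)).hasFDerivAt.restrictScalars
    ℝ).comp (f := fun y : Fin d → ℂ => hdot y y) w hD)
  have h3 : (fun y => dbarLog y v) = fun y => (∑ j, y j * (starRingEnd ℂ) (v j)) * (hdot y y)⁻¹ := by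
    funext y
    rw [dbarLog_apply, hdot, div_eq_mul_inv]
  have h4 : (∑ i, (starRingEnd ℂ) (v i) •
      ContinuousLinearMap.proj (R := ℝ) (φ := fun _ : Fin d => ℂ) i) u = hdot u v := by
    rw [sum_apply, hdot]
    exact Finset.sum_congr rfl fun j _ => by simp [mul_comm]
  have hQ := hdot_self_ne_zero hw
  rw [h3]
  refine (congrArg (fun l => l u) h2.fderiv).trans ?_
  simp only [add_apply, smul_apply, h4, ContinuousLinearMap.comp_apply, hDv,
    ContinuousLinearMap.coe_restrictScalars', ContinuousLinearMap.toSpanSingleton_apply,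
    smul_eq_mul, Function.comp_apply]
  rw [← hdot]
  field_simp
  ring

/-- The form `∂̄ log |y|²` sends `v` to `⟨y, v⟩ / ⟨y, y⟩`; its exterior derivative is the derivative
in one argument antisymmetrized in the two. -/
theorem fubiniStudy_apply (w : Fin d → ℂ) (hw : w ≠ 0) (v : Fin 2 → Fin d → ℂ) :
    fubiniStudy d w v = Complex.I / (2 * (Real.pi : ℂ)) *
      ((hdot (v 0) (v 1) - hdot (v 1) (v 0)) / hdot w w -
        (hdot (v 0) w * hdot w (v 1) - hdot (v 1) w * hdot w (v 0)) / hdot w w ^ 2) := by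
  rw [fubiniStudy, alt_smul_apply]
  congr 1
  have hev : (fun y => ContinuousAlternatingMap.ofSubsingleton ℝ (Fin d → ℂ) ℂ (0 : Fin 1)
      (dbar (fun w : Fin d → ℂ => ((Real.log (∑ j, ‖w j‖ ^ 2) : ℝ) : ℂ)) y)) =ᶠ[𝓝 w]
      fun y => ContinuousAlternatingMap.ofSubsingleton ℝ (Fin d → ℂ) ℂ (0 : Fin 1)
        (dbarLog y) := by
    filter_upwards [isOpen_compl_singleton.mem_nhds hw] with y hy
    rw [dbar_log_sum y hy]
  have hdiff : DifferentiableAt ℝ (fun y => ContinuousAlternatingMap.ofSubsingleton ℝ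
      (Fin d → ℂ) ℂ (0 : Fin 1) (dbarLog y)) w :=
    (ContinuousAlternatingMap.ofSubsingletonLIE (𝕜 := ℝ) (E := Fin d → ℂ) (F := ℂ)
      (0 : Fin 1)).toContinuousLinearEquiv.differentiableAt.comp w (differentiableAt_dbarLog w hw)
  change (extDeriv _ w) v = _
  rw [hev.extDeriv_eq, extDeriv_apply hdiff, Fin.sum_univ_two]
  have e0 : ∀ y, (ContinuousAlternatingMap.ofSubsingleton ℝ (Fin d → ℂ) ℂ (0 : Fin 1)
      (dbarLog y)) ((0 : Fin 2).removeNth v) = dbarLog y (v 1) := fun y => rfl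
  have e1 : ∀ y, (ContinuousAlternatingMap.ofSubsingleton ℝ (Fin d → ℂ) ℂ (0 : Fin 1)
      (dbarLog y)) ((1 : Fin 2).removeNth v) = dbarLog y (v 0) := fun y => rfl
  simp only [e0, e1, fderiv_dbarLog_apply _ _ _ hw]
  simp only [Fin.val_zero, pow_zero, one_smul, Fin.val_one, pow_one, neg_smul]
  ring

/-- The Fubini–Study form is invariant under rescaling of homogeneous coordinates. -/
theorem fubiniStudy_smul (w : Fin d → ℂ) (hw : w ≠ 0) (c : ℂ) (hc : c ≠ 0)
    (v : Fin 2 → Fin d → ℂ) (t : Fin 2 → ℂ) :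
    fubiniStudy d (c • w) (fun i => c • v i + t i • w) = fubiniStudy d w v := by
  have hcc : (starRingEnd ℂ) c ≠ 0 := by simpa using hc
  have hQ := hdot_self_ne_zero hw
  rw [fubiniStudy_apply _ (smul_ne_zero hc hw), fubiniStudy_apply _ hw]
  congr 1
  simp only [hdot_add_left, hdot_add_right, hdot_smul_left, hdot_smul_right]
  field_simp
  ring

/-- The coefficients of this expansion are the quantities to be matched with Gaussian second
moments. -/
theorem fubiniStudy_comp {m : ℕ} (w : Fin d → ℂ) (hw : w ≠ 0)
    (T : (Fin m → ℂ) →L[ℂ] (Fin d → ℂ)) :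
    (fubiniStudy d w).compLinearMap (realLinear T) =
      ∑ k, ∑ l, (Complex.I / (2 * (Real.pi : ℂ)) * ((if k = l then 1 else 0) / hdot w w -
        (starRingEnd ℂ) (w k) * w l / hdot w w ^ 2)) •
        hermForm ((ContinuousLinearMap.proj k).comp T) ((ContinuousLinearMap.proj l).comp T) := by
  ext v
  rw [AlternatingMap.compLinearMap_apply, fubiniStudy_apply _ hw]
  have hT : ∀ i, realLinear T (v i) = T (v i) := fun i => rfl
  have hs : ∀ (a : Fin d → Fin d → Alt m 2), (∑ k, ∑ l, a k l) v = ∑ k, ∑ l, a k l v := by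
    intro a
    simp only [alt_sum_apply]
  rw [hs]
  simp only [Function.comp_def, hT, alt_smul_apply, hermForm_apply,
    ContinuousLinearMap.comp_apply, ContinuousLinearMap.proj_apply]
  have e : ∀ x y : Fin d → ℂ, hdot x y = ∑ k, ∑ l, (if k = l then (1 : ℂ) else 0) *
      (x k * (starRingEnd ℂ) (y l)) := by
    intro x y
    simp [hdot]
  have e' : ∀ x y : Fin d → ℂ, hdot x w * hdot w y = ∑ k, ∑ l,
      (starRingEnd ℂ) (w k) * w l * (x k * (starRingEnd ℂ) (y l)) := by
    intro x y
    simp only [hdot, Finset.sum_mul_sum]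
    exact Finset.sum_congr rfl fun k _ => Finset.sum_congr rfl fun l _ => by ring
  rw [e (T (v 0)), e (T (v 1)), e', e', ← Finset.sum_sub_distrib, ← Finset.sum_sub_distrib,
    Finset.sum_div, Finset.sum_div, ← Finset.sum_sub_distrib, Finset.mul_sum]
  refine Finset.sum_congr rfl fun k _ => ?_
  rw [← Finset.sum_sub_distrib, ← Finset.sum_sub_distrib, Finset.sum_div, Finset.sum_div,
    ← Finset.sum_sub_distrib, Finset.mul_sum]
  refine Finset.sum_congr rfl fun l _ => ?_
  ring

end FubiniStudy

end RandomZeros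

end

noncomputable section

namespace RandomZeros

/-! ### Gaussian second moments on a complex hyperplane. -/

section Gaussian

theorem integral_gauss_one : ∫ x : ℂ, ((Real.exp (-‖x‖ ^ 2) : ℝ) : ℂ) = (Real.pi : ℂ) := by
  have h := Complex.integral_exp_neg_rpow (p := 2) (by norm_num)
  simp only [Real.rpow_two] at h
  rw [integral_complex_ofReal, h]
  norm_num [Real.Gamma_two]

theorem integrable_gauss_one : Integrable fun x : ℂ => ((Real.exp (-‖x‖ ^ 2) : ℝ) : ℂ) := by
  -- A nonintegrable function has Bochner integral 0 by convention, while this integral is `π`.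
  by_contra hc
  have := integral_undef hc
  rw [integral_gauss_one] at this
  exact Real.pi_ne_zero (by exact_mod_cast this)

theorem integral_gauss_sq :
    ∫ x : ℂ, ((Real.exp (-‖x‖ ^ 2) : ℝ) : ℂ) * (x * (starRingEnd ℂ) x) = (Real.pi : ℂ) := by
  have h := Complex.integral_rpow_mul_exp_neg_rpow (p := 2) (q := 2) (by norm_num) (by norm_num)
  simp only [Real.rpow_two] at h
  have e : ∀ x : ℂ, ((Real.exp (-‖x‖ ^ 2) : ℝ) : ℂ) * (x * (starRingEnd ℂ) x) =
      ((‖x‖ ^ 2 * Real.exp (-‖x‖ ^ 2) : ℝ) : ℂ) := by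
    intro x
    rw [Complex.mul_conj, Complex.normSq_eq_norm_sq]
    push_cast
    ring
  simp only [e]
  rw [integral_complex_ofReal, h]
  norm_num [Real.Gamma_two]

theorem integrable_gauss_sq :
    Integrable fun x : ℂ => ((Real.exp (-‖x‖ ^ 2) : ℝ) : ℂ) * (x * (starRingEnd ℂ) x) := by
  by_contra hc
  have := integral_undef hc
  rw [integral_gauss_sq] at this
  exact Real.pi_ne_zero (by exact_mod_cast this)

theorem integrable_gauss_lin :
    Integrable fun x : ℂ => ((Real.exp (-‖x‖ ^ 2) : ℝ) : ℂ) * x := by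
  refine (integrable_gauss_one.add integrable_gauss_sq).mono
    (by fun_prop) (Filter.Eventually.of_forall fun x => ?_)
  have e : ((Real.exp (-‖x‖ ^ 2) : ℝ) : ℂ) + ((Real.exp (-‖x‖ ^ 2) : ℝ) : ℂ) *
      (x * (starRingEnd ℂ) x) = ((Real.exp (-‖x‖ ^ 2) * (1 + ‖x‖ ^ 2) : ℝ) : ℂ) := by
    rw [Complex.mul_conj, Complex.normSq_eq_norm_sq]
    push_cast
    ring
  rw [Pi.add_apply, e, norm_mul, Complex.norm_real, Complex.norm_real, norm_mul]
  gcongr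
  rw [Real.norm_of_nonneg (by positivity)]
  nlinarith [sq_nonneg (‖x‖ - 1), norm_nonneg x]

theorem integrable_gauss_conj :
    Integrable fun x : ℂ => ((Real.exp (-‖x‖ ^ 2) : ℝ) : ℂ) * (starRingEnd ℂ) x := by
  refine integrable_gauss_lin.mono (by fun_prop) (Filter.Eventually.of_forall fun x => ?_)
  simp

theorem integral_odd_eq_zero {f : ℂ → ℂ} (hf : ∀ x, f (-x) = -f x) : ∫ x, f x = 0 := by
  have h := integral_neg_eq_self f (volume : Measure ℂ)
  simp only [hf, integral_neg] at h
  linear_combination (-1 / 2 : ℂ) * h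

variable {e : ℕ}

/-- The Gaussian weight `exp (-|a|²)` on `ℂᵉ`. -/
def gauss (a : Fin e → ℂ) : ℂ := ((Real.exp (-∑ k, ‖a k‖ ^ 2) : ℝ) : ℂ)

theorem gauss_eq_prod (a : Fin e → ℂ) : gauss a = ∏ k, ((Real.exp (-‖a k‖ ^ 2) : ℝ) : ℂ) := by
  rw [gauss, ← Finset.sum_neg_distrib, Real.exp_sum]
  push_cast
  rfl

theorem integrable_gauss : Integrable (gauss (e := e)) := by
  simp only [funext gauss_eq_prod]
  exact Integrable.fintype_prod fun _ => integrable_gauss_one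

theorem integral_gauss : ∫ a : Fin e → ℂ, gauss a = (Real.pi : ℂ) ^ e := by
  simp only [gauss_eq_prod]
  rw [integral_fintype_prod_volume_eq_prod (f := fun _ (x : ℂ) => ((Real.exp (-‖x‖ ^ 2) : ℝ) : ℂ))]
  simp only [integral_gauss_one, Finset.prod_const, Finset.card_univ, Fintype.card_fin]

/-- The one-variable factors of `exp (-|a|²) a_i ā_j`. -/
def gaussFactor (i j k : Fin e) (x : ℂ) : ℂ :=
  ((Real.exp (-‖x‖ ^ 2) : ℝ) : ℂ) *
    ((if k = i then x else 1) * (if k = j then (starRingEnd ℂ) x else 1))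

theorem gauss_mul_eq_prod (i j : Fin e) (a : Fin e → ℂ) :
    gauss a * (a i * (starRingEnd ℂ) (a j)) = ∏ k, gaussFactor i j k (a k) := by
  simp only [gaussFactor, Finset.prod_mul_distrib, gauss_eq_prod]
  simp

theorem integrable_gaussFactor (i j k : Fin e) : Integrable (gaussFactor i j k) := by
  unfold gaussFactor
  by_cases hi : k = i <;> by_cases hj : k = j
  · simpa only [if_pos hi, if_pos hj] using integrable_gauss_sq
  · simpa only [if_pos hi, if_neg hj, mul_one] using integrable_gauss_lin
  · simpa only [if_neg hi, if_pos hj, one_mul] using integrable_gauss_conj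
  · simpa only [if_neg hi, if_neg hj, mul_one] using integrable_gauss_one

theorem integrable_gauss_mul (i j : Fin e) :
    Integrable fun a : Fin e → ℂ => gauss a * (a i * (starRingEnd ℂ) (a j)) := by
  simp only [gauss_mul_eq_prod]
  exact Integrable.fintype_prod fun k => integrable_gaussFactor i j k

theorem integral_gauss_mul (i j : Fin e) :
    ∫ a : Fin e → ℂ, gauss a * (a i * (starRingEnd ℂ) (a j)) =
      if i = j then (Real.pi : ℂ) ^ e else 0 := by
  simp only [gauss_mul_eq_prod]
  rw [integral_fintype_prod_volume_eq_prod (f := gaussFactor i j)]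
  split_ifs with h
  · subst h
    have : ∀ k, ∫ x, gaussFactor i i k x = (Real.pi : ℂ) := by
      intro k
      unfold gaussFactor
      by_cases hk : k = i <;> simp only [hk, if_true, if_false, mul_one]
      · exact integral_gauss_sq
      · exact integral_gauss_one
    simp [this]
  · refine Finset.prod_eq_zero (Finset.mem_univ i) (integral_odd_eq_zero fun x => ?_)
    simp [gaussFactor, h]

variable (γ : Fin e → ℂ)

/-- The functional `a ↦ ∑ a_k γ̄_k`. -/
def hdotL : (Fin e → ℂ) →ₗ[ℂ] ℂ where
  toFun a := hdot a γ
  map_add' a b := hdot_add_left a b γ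
  map_smul' c a := hdot_smul_left c a γ

/-- A square root of `I + γ γ*`. -/
def sqrtMap : (Fin e → ℂ) →ₗ[ℂ] (Fin e → ℂ) :=
  LinearMap.transvection (hdotL γ)
    ((((1 + Real.sqrt (1 + ∑ k, ‖γ k‖ ^ 2))⁻¹ : ℝ) : ℂ) • γ)

/-- The inverse of `sqrtMap`. -/
def sqrtMapInv : (Fin e → ℂ) →ₗ[ℂ] (Fin e → ℂ) :=
  LinearMap.transvection (hdotL γ)
    ((-((1 + Real.sqrt (1 + ∑ k, ‖γ k‖ ^ 2))⁻¹ / Real.sqrt (1 + ∑ k, ‖γ k‖ ^ 2) : ℝ) : ℂ) • γ)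

theorem sqrtMap_apply (a : Fin e → ℂ) : sqrtMap γ a = a +
    ((((1 + Real.sqrt (1 + ∑ k, ‖γ k‖ ^ 2))⁻¹ : ℝ) : ℂ) * hdot a γ) • γ := by
  rw [sqrtMap, LinearMap.transvection.apply, smul_smul, mul_comm]
  rfl

theorem sqrtMapInv_apply (a : Fin e → ℂ) : sqrtMapInv γ a = a +
    ((-((1 + Real.sqrt (1 + ∑ k, ‖γ k‖ ^ 2))⁻¹ / Real.sqrt (1 + ∑ k, ‖γ k‖ ^ 2) : ℝ) : ℂ) *
      hdot a γ) • γ := by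
  rw [sqrtMapInv, LinearMap.transvection.apply, smul_smul, mul_comm]
  rfl

theorem sqrt_aux {t r : ℝ} (ht : 0 ≤ t) (hr : r = Real.sqrt (1 + t)) : 0 < r ∧ t = r ^ 2 - 1 := by
  subst hr
  exact ⟨Real.sqrt_pos.mpr (by linarith), by rw [Real.sq_sqrt (by linarith)]; ring⟩

theorem sqrtMapInv_sqrtMap (a : Fin e → ℂ) : sqrtMapInv γ (sqrtMap γ a) = a := by
  set t := ∑ k, ‖γ k‖ ^ 2 with ht
  obtain ⟨hr, hrt⟩ := sqrt_aux (t := t) (by positivity) rfl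
  rw [sqrtMapInv_apply, sqrtMap_apply, hdot_add_left, hdot_smul_left, hdot_self, ← ht]
  rw [add_assoc, ← add_smul]
  convert add_zero a
  rw [smul_eq_zero]
  left
  set r := Real.sqrt (1 + t) with hr'
  rw [hrt]
  have h1 : (r : ℂ) ≠ 0 := by exact_mod_cast hr.ne'
  have h2 : (1 + r : ℂ) ≠ 0 := by exact_mod_cast (by positivity : (1 + r) ≠ 0)
  push_cast
  field_simp
  ring

theorem sqrtMap_sqrtMapInv (a : Fin e → ℂ) : sqrtMap γ (sqrtMapInv γ a) = a := by
  have hinj : Function.Injective (sqrtMap γ) :=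
    Function.LeftInverse.injective (sqrtMapInv_sqrtMap γ)
  obtain ⟨b, rfl⟩ := (LinearMap.injective_iff_surjective.mp hinj) a
  rw [sqrtMapInv_sqrtMap]

/-- With `r = √(1 + |γ|²)`, the self-adjoint map `I + γγ* / (1 + r)` has square `I + γγ*`, so the
squared norm of its value at `a` is `|a|² + |⟨a, γ⟩|²`. The coefficient `1 / (1 + r)` equals `(r -
1) / |γ|²` but also makes sense for `γ = 0`. -/
theorem gauss_sqrtMap (a : Fin e → ℂ) : gauss (sqrtMap γ a) =
    ((Real.exp (-∑ k, ‖a k‖ ^ 2 - ‖hdot a γ‖ ^ 2) : ℝ) : ℂ) := by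
  rw [gauss]
  congr 3
  have h : hdot (sqrtMap γ a) (sqrtMap γ a) = hdot a a + hdot a γ * (starRingEnd ℂ) (hdot a γ) := by
    set t := ∑ k, ‖γ k‖ ^ 2 with ht
    obtain ⟨hr, hrt⟩ := sqrt_aux (t := t) (by positivity) rfl
    rw [sqrtMap_apply]
    simp only [hdot_add_left, hdot_smul_left, hdot_add_right, hdot_smul_right, map_mul,
      Complex.conj_ofReal, hdot_self γ, ← ht, hdot_conj]
    set r := Real.sqrt (1 + t) with hr'
    rw [hrt]
    have h2 : (1 + r : ℂ) ≠ 0 := by exact_mod_cast (by positivity : (1 + r) ≠ 0)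
    push_cast
    field_simp
    ring
  rw [hdot_self, hdot_self, Complex.mul_conj, Complex.normSq_eq_norm_sq] at h
  have h' : ∑ k, ‖sqrtMap γ a k‖ ^ 2 = ∑ k, ‖a k‖ ^ 2 + ‖hdot a γ‖ ^ 2 := by exact_mod_cast h
  rw [h']
  ring

/-- A transvection by `v` along a functional `f` has determinant `1 + f v`, here equal to `√(1 +
|γ|²)`; the real determinant is its square. -/
theorem abs_det_sqrtMap : |((sqrtMap γ).restrictScalars ℝ).det| = 1 + ∑ k, ‖γ k‖ ^ 2 := by
  set t := ∑ k, ‖γ k‖ ^ 2 with ht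
  obtain ⟨hr, hrt⟩ := sqrt_aux (t := t) (by positivity) rfl
  rw [det_restrictScalars_complex, abs_of_nonneg (by positivity), sqrtMap,
    LinearMap.transvection.det, map_smul, ← ht]
  change ‖1 + _ • hdot γ γ‖ ^ 2 = _
  rw [hdot_self, ← ht]
  set r := Real.sqrt (1 + t) with hr'
  have : (1 + (((1 + r)⁻¹ : ℝ) : ℂ) • (t : ℂ)) = (r : ℂ) := by
    have h2 : (1 + r) ≠ 0 := by positivity
    rw [hrt, smul_eq_mul]
    norm_cast
    field_simp
    ring
  rw [this, Complex.norm_real, Real.norm_of_nonneg hr.le, hrt]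
  ring

/-- Second moments of the Gaussian measure restricted to the graph `a₀ = -∑ a_k γ̄_k`. -/
theorem integral_gauss_graph (k l : Fin e) :
    ∫ a : Fin e → ℂ, ((Real.exp (-∑ k, ‖a k‖ ^ 2 - ‖hdot a γ‖ ^ 2) : ℝ) : ℂ) *
        (a k * (starRingEnd ℂ) (a l)) =
      (Real.pi : ℂ) ^ e * ((if k = l then 1 else 0) / ((1 + ∑ k, ‖γ k‖ ^ 2 : ℝ) : ℂ) -
        γ k * (starRingEnd ℂ) (γ l) / ((1 + ∑ k, ‖γ k‖ ^ 2 : ℝ) : ℂ) ^ 2) := by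
  set t := ∑ k, ‖γ k‖ ^ 2 with ht
  obtain ⟨hr, hrt⟩ := sqrt_aux (t := t) (by positivity) rfl
  set r := Real.sqrt (1 + t) with hr'
  have ht0 : 0 < 1 + t := by rw [hrt]; ring_nf; positivity
  let R : (Fin e → ℂ) →L[ℝ] (Fin e → ℂ) :=
    LinearMap.toContinuousLinearMap ((sqrtMap γ).restrictScalars ℝ)
  have hR : ∀ a, R a = sqrtMap γ a := fun a => rfl
  have hRdet : |R.det| = 1 + t := by
    rw [← abs_det_sqrtMap γ]
    rfl
  -- The substitution `b = sqrtMap γ a` turns the weight into the standard Gaussian and contributes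
  -- the factor `1 / (1 + |γ|²)`.
  have hcv := integral_image_eq_integral_abs_det_fderiv_smul (volume : Measure (Fin e → ℂ))
    (s := Set.univ) (f := R) (f' := fun _ => R) MeasurableSet.univ
    (fun x _ => R.hasFDerivWithinAt)
    (Function.LeftInverse.injective (g := sqrtMapInv γ) (sqrtMapInv_sqrtMap γ)).injOn
    (fun b => gauss b * (sqrtMapInv γ b k * (starRingEnd ℂ) (sqrtMapInv γ b l)))
  have himg : R '' Set.univ = Set.univ := by
    rw [Set.image_univ]
    exact Set.range_eq_univ.mpr fun b => ⟨sqrtMapInv γ b, sqrtMap_sqrtMapInv γ b⟩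
  rw [himg, setIntegral_univ, setIntegral_univ] at hcv
  simp only [hRdet, hR, sqrtMapInv_sqrtMap, gauss_sqrtMap, integral_smul] at hcv
  rw [Complex.real_smul] at hcv
  have hne : ((1 + t : ℝ) : ℂ) ≠ 0 := by exact_mod_cast ht0.ne'
  have hmain : ∫ b : Fin e → ℂ, gauss b *
      (sqrtMapInv γ b k * (starRingEnd ℂ) (sqrtMapInv γ b l)) =
      (Real.pi : ℂ) ^ e * ((if k = l then 1 else 0) - γ k * (starRingEnd ℂ) (γ l) /
        ((1 + t : ℝ) : ℂ)) := by
    set β : ℂ := ((-((1 + r)⁻¹ / r : ℝ) : ℂ)) with hβ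
    have hcoef : ∀ b i, sqrtMapInv γ b i = ∑ p, ((if i = p then 1 else 0) +
        β * γ i * (starRingEnd ℂ) (γ p)) * b p := by
      intro b i
      rw [sqrtMapInv_apply, ← ht, ← hr', ← hβ]
      simp only [Pi.add_apply, Pi.smul_apply, smul_eq_mul, hdot, add_mul, Finset.sum_add_distrib,
        ite_mul, one_mul, zero_mul, Finset.sum_ite_eq, Finset.mem_univ, if_true]
      congr 1
      rw [Finset.mul_sum, Finset.sum_mul]
      exact Finset.sum_congr rfl fun p _ => by ring
    have hexp : ∀ b : Fin e → ℂ, gauss b *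
        (sqrtMapInv γ b k * (starRingEnd ℂ) (sqrtMapInv γ b l)) =
        ∑ p, ∑ q, (((if k = p then 1 else 0) + β * γ k * (starRingEnd ℂ) (γ p)) *
          (starRingEnd ℂ) ((if l = q then 1 else 0) + β * γ l * (starRingEnd ℂ) (γ q))) *
          (gauss b * (b p * (starRingEnd ℂ) (b q))) := by
      intro b
      rw [hcoef, hcoef, map_sum, Finset.sum_mul_sum, Finset.mul_sum]
      refine Finset.sum_congr rfl fun p _ => ?_
      rw [Finset.mul_sum]
      refine Finset.sum_congr rfl fun q _ => ?_
      rw [map_mul]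
      ring
    simp only [hexp]
    rw [integral_finsetSum _ fun p _ => integrable_finsetSum _ fun q _ =>
      (integrable_gauss_mul p q).const_mul _]
    have : ∀ p, ∫ b : Fin e → ℂ, ∑ q, (((if k = p then 1 else 0) + β * γ k *
        (starRingEnd ℂ) (γ p)) * (starRingEnd ℂ) ((if l = q then 1 else 0) +
          β * γ l * (starRingEnd ℂ) (γ q))) * (gauss b * (b p * (starRingEnd ℂ) (b q))) =
        (((if k = p then 1 else 0) + β * γ k * (starRingEnd ℂ) (γ p)) *
          (starRingEnd ℂ) ((if l = p then 1 else 0) + β * γ l * (starRingEnd ℂ) (γ p))) *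
          (Real.pi : ℂ) ^ e := by
      intro p
      rw [integral_finsetSum _ fun q _ => (integrable_gauss_mul p q).const_mul _]
      simp only [integral_const_mul, integral_gauss_mul]
      simp
    simp only [this]
    rw [← Finset.sum_mul, mul_comm]
    congr 1
    have hβc : (starRingEnd ℂ) β = β := by simp [hβ]
    have hsum : ∑ p, (starRingEnd ℂ) (γ p) * γ p = (t : ℂ) := by
      have := hdot_self γ
      rw [← ht] at this
      rw [← this, hdot]
      exact Finset.sum_congr rfl fun p _ => mul_comm _ _
    have hexp2 : ∀ p, ((if k = p then 1 else 0) + β * γ k * (starRingEnd ℂ) (γ p)) *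
          (starRingEnd ℂ) ((if l = p then 1 else 0) + β * γ l * (starRingEnd ℂ) (γ p)) =
        (if k = p then (if l = p then 1 else 0) else 0) +
        (if k = p then β * (starRingEnd ℂ) (γ l) * γ p else 0) +
        (if l = p then β * γ k * (starRingEnd ℂ) (γ p) else 0) +
        β ^ 2 * γ k * (starRingEnd ℂ) (γ l) * ((starRingEnd ℂ) (γ p) * γ p) := by
      intro p
      simp only [map_add, map_mul, hβc, Complex.conj_conj]
      split_ifs <;> simp <;> ring
    simp only [hexp2, Finset.sum_add_distrib, Finset.sum_ite_eq, Finset.mem_univ, if_true,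
      ← Finset.mul_sum, hsum]
    -- The square of the inverse `I + β γγ*` is `I + (2β + β² t) γγ*`, which must be the inverse of
    -- `I + γγ*`, that is `I - γγ* / (1 + t)`.
    have hβ2 : 2 * β + β ^ 2 * (t : ℂ) = -1 / ((1 + t : ℝ) : ℂ) := by
      have h1 : (r : ℂ) ≠ 0 := by exact_mod_cast hr.ne'
      have h2 : (1 + r : ℂ) ≠ 0 := by exact_mod_cast (by positivity : (1 + r) ≠ 0)
      rw [hβ, hrt]
      push_cast
      have h3 : (1 + ((r : ℂ) ^ 2 - 1)) = r ^ 2 := by ring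
      rw [h3]
      field_simp
      ring
    have hkl : (if l = k then (1 : ℂ) else 0) = if k = l then 1 else 0 := by
      simp [eq_comm]
    rw [hkl]
    linear_combination γ k * (starRingEnd ℂ) (γ l) * hβ2
  rw [hmain] at hcv
  rw [← mul_right_inj' hne, ← hcv]
  field_simp

end Gaussian

end RandomZeros

end

noncomputable section

namespace RandomZeros

/-! ### Pullback of forms under holomorphic maps. -/

section Pullback

variable {m : ℕ} {M : Type*} [TopologicalSpace M] [ChartedSpace (Fin m → ℂ) M]

theorem pullback_comp {k l p : ℕ} {g' : (Fin l → ℂ) → M} {τ : (Fin k → ℂ) → (Fin l → ℂ)}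
    {g : (Fin k → ℂ) → M} {z : Fin k → ℂ} (hg : g =ᶠ[𝓝 z] g' ∘ τ)
    (hg' : MDifferentiableAt 𝓘(ℂ, Fin l → ℂ) 𝓘(ℂ, Fin m → ℂ) g' (τ z))
    (hτ : DifferentiableAt ℂ τ z) (η : Form m M p) :
    pullback g η z = (pullback g' η (τ z)).compLinearMap (realLinear (fderiv ℂ τ z)) := by
  have h1 : mfderiv 𝓘(ℂ, Fin k → ℂ) 𝓘(ℂ, Fin m → ℂ) g z =
      (mfderiv 𝓘(ℂ, Fin l → ℂ) 𝓘(ℂ, Fin m → ℂ) g' (τ z)).comp (fderiv ℂ τ z) := by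
    rw [hg.mfderiv_eq, mfderiv_comp z hg' hτ.mdifferentiableAt, mfderiv_eq_fderiv]
    rfl
  have h2 : g z = g' (τ z) := hg.eq_of_nhds
  ext v
  simp only [pullback, AlternatingMap.compLinearMap_apply, h1, h2]
  rfl

theorem pullback_wedge {k p q r : ℕ} (h : p + q = r) (g : (Fin k → ℂ) → M) (η : Form m M p)
    (φ : Form m M q) (z : Fin k → ℂ) :
    pullback g (fun x => wedge h (η x) (φ x)) z = wedge h (pullback g η z) (pullback g φ z) := by
  simp only [pullback, wedge_compLinearMap]

/-- A holomorphic change of parameters preserves orientation, so a top form transforms with the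
absolute real Jacobian, exactly as Lebesgue measure requires. -/
theorem pullback_top_comp {k : ℕ} {g' g : (Fin k → ℂ) → M} {τ : (Fin k → ℂ) → (Fin k → ℂ)}
    {z : Fin k → ℂ} (hg : g =ᶠ[𝓝 z] g' ∘ τ)
    (hg' : MDifferentiableAt 𝓘(ℂ, Fin k → ℂ) 𝓘(ℂ, Fin m → ℂ) g' (τ z))
    (hτ : DifferentiableAt ℂ τ z) (η : Form m M (2 * k)) :
    pullback g η z (realBasis k) = |((fderiv ℂ τ z).restrictScalars ℝ).det| •
      pullback g' η (τ z) (realBasis k) := by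
  rw [pullback_comp hg hg' hτ, AlternatingMap.compLinearMap_apply]
  have h1 := top_form_comp (pullback g' η (τ z)) (fderiv ℂ τ z : (Fin k → ℂ) →ₗ[ℂ] (Fin k → ℂ))
  have h2 : ((fderiv ℂ τ z).restrictScalars ℝ).det =
      ‖LinearMap.det (fderiv ℂ τ z : (Fin k → ℂ) →ₗ[ℂ] (Fin k → ℂ))‖ ^ 2 :=
    det_restrictScalars_complex _
  rw [h2, abs_of_nonneg (by positivity), Complex.real_smul, ← h1]
  rfl

end Pullback

/-! ### Independence of the integral over a submanifold from its decomposition. -/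

section RefSystem

variable {m : ℕ} {M : Type*} [TopologicalSpace M] [ChartedSpace (Fin m → ℂ) M]

/-- A decomposition of a complex submanifold `S` into countably many pieces `S ∩ E q`, each
contained in the domain `V q` of holomorphic coordinates `r q` on `S`, with inverse `g q`. -/
structure RefSystem (m : ℕ) {M : Type*} [TopologicalSpace M] [ChartedSpace (Fin m → ℂ) M]
    [MeasurableSpace M] (k : ℕ) (S : Set M) (ι : Type*) where
  V : ι → Set M
  E : ι → Set M
  r : ι → M → (Fin k → ℂ)
  U : ι → Set (Fin k → ℂ)
  g : ι → (Fin k → ℂ) → M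
  isOpen_V : ∀ q, IsOpen (V q)
  measurable_E : ∀ q, MeasurableSet (E q)
  E_subset : ∀ q, E q ⊆ V q
  isOpen_U : ∀ q, IsOpen (U q)
  mdiff_r : ∀ q, MDifferentiableOn 𝓘(ℂ, Fin m → ℂ) 𝓘(ℂ, Fin k → ℂ) (r q) (V q)
  mdiff_g : ∀ q, MDifferentiableOn 𝓘(ℂ, Fin k → ℂ) 𝓘(ℂ, Fin m → ℂ) (g q) (U q)
  r_mem : ∀ q, ∀ y ∈ V q, y ∈ S → r q y ∈ U q
  g_r : ∀ q, ∀ y ∈ V q, y ∈ S → g q (r q y) = y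
  g_mem : ∀ q, ∀ z ∈ U q, g q z ∈ S
  g_mem_V : ∀ q, ∀ z ∈ U q, g q z ∈ V q
  r_g : ∀ q, ∀ z ∈ U q, r q (g q z) = z
  disjoint : Pairwise fun q q' => Disjoint (E q) (E q')
  covers : S ⊆ ⋃ q, E q

theorem measurableSet_inter_preimage {X Y : Type*} [TopologicalSpace X] [MeasurableSpace X]
    [BorelSpace X] [TopologicalSpace Y] [MeasurableSpace Y] [BorelSpace Y] {f : X → Y} {U : Set X}
    {E : Set Y} (hU : IsOpen U) (hf : ContinuousOn f U) (hE : MeasurableSet E) :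
    MeasurableSet (U ∩ f ⁻¹' E) := by
  have h : U ∩ f ⁻¹' E = Subtype.val '' ((fun z : U => f z) ⁻¹' E) := by
    ext z
    simp only [Set.mem_inter_iff, Set.mem_preimage, Set.mem_image, Subtype.exists,
      exists_and_right, exists_eq_right]
    exact ⟨fun ⟨h1, h2⟩ => ⟨h1, h2⟩, fun ⟨h1, h2⟩ => ⟨h1, h2⟩⟩
  rw [h]
  exact hU.measurableSet.subtype_image
    ((continuousOn_iff_continuous_domRestrict.mp hf).measurable hE)

namespace RefSystem

variable [MeasurableSpace M] {k : ℕ} {S : Set M} {ι : Type*}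
  (R : RefSystem m k S ι)

/-- The parameter domain of a piece. -/
def A (q : ι) : Set (Fin k → ℂ) := {z ∈ R.U q | R.g q z ∈ R.E q}

theorem measurableSet_A [BorelSpace M] (q : ι) : MeasurableSet (R.A q) :=
  measurableSet_inter_preimage (R.isOpen_U q) (R.mdiff_g q).continuousOn (R.measurable_E q)

theorem image_A (q : ι) : R.g q '' R.A q = S ∩ R.E q := by
  ext y
  constructor
  · rintro ⟨z, ⟨hz, hzE⟩, rfl⟩
    exact ⟨R.g_mem q z hz, hzE⟩
  · rintro ⟨hy, hyE⟩
    have hV := R.E_subset q hyE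
    refine ⟨R.r q y, ⟨R.r_mem q y hV hy, ?_⟩, R.g_r q y hV hy⟩
    rw [R.g_r q y hV hy]
    exact hyE

/-- The value of `formIntegral` is 0 by default when no parametrization exists; this excludes that
case. -/
theorem nonempty_parametrization (R : RefSystem m k S ι) [BorelSpace M] [Countable ι] [Nonempty M] :
    Nonempty (Parametrization m k S) := by
  classical
  obtain ⟨f, hf⟩ := Countable.exists_injective_nat ι
  -- The countable index set is spread over `ℕ`, with empty pieces at the unused indices.
  let e : ℕ → Option ι := Function.partialInv f
  have he : ∀ p q, e p = some q ↔ f q = p := fun p q =>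
    hf.isPartialInv q p
  let x₀ : M := Classical.arbitrary M
  refine ⟨{
    U := fun p => (e p).elim ∅ R.U
    A := fun p => (e p).elim ∅ R.A
    g := fun p => (e p).elim (fun _ => x₀) R.g
    isOpen := fun p => by
      rcases e p with _ | q
      · exact isOpen_empty
      · exact R.isOpen_U q
    measurable := fun p => by
      rcases e p with _ | q
      · exact MeasurableSet.empty
      · exact R.measurableSet_A q
    subset := fun p => by
      rcases e p with _ | q
      · exact subset_rfl
      · exact fun z hz => hz.1
    holomorphic := fun p => by
      rcases e p with _ | q
      · exact fun z hz => hz.elim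
      · exact R.mdiff_g q
    immersion := fun p => by
      rcases e p with _ | q
      · exact fun z hz => hz.elim
      · intro z hz
        have h1 := (R.mdiff_g q).mdifferentiableAt ((R.isOpen_U q).mem_nhds hz)
        have h2 := (R.mdiff_r q).mdifferentiableAt
          ((R.isOpen_V q).mem_nhds (R.g_mem_V q z hz))
        -- The coordinates are a holomorphic left inverse of the parametrization, so its
        -- differential is injective.
        have h3 : R.r q ∘ R.g q =ᶠ[𝓝 z] id := by
          filter_upwards [(R.isOpen_U q).mem_nhds hz] with y hy using R.r_g q y hy
        have h4 := mfderiv_comp z h2 h1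
        rw [h3.mfderiv_eq, mfderiv_id] at h4
        intro u v huv
        have h5 : ∀ u, u = mfderiv 𝓘(ℂ, Fin m → ℂ) 𝓘(ℂ, Fin k → ℂ) (R.r q) (R.g q z)
            (mfderiv 𝓘(ℂ, Fin k → ℂ) 𝓘(ℂ, Fin m → ℂ) (R.g q) z u) := fun u =>
          congrArg (fun l => l u) h4
        rw [h5 u, h5 v]
        exact congrArg _ huv
    mapsTo := fun p => by
      rcases e p with _ | q
      · exact fun z hz => hz.elim
      · exact fun z hz => R.g_mem q z hz
    injOn := fun p => by
      rcases e p with _ | q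
      · exact fun z hz => hz.elim
      · intro z hz z' hz' h
        rw [← R.r_g q z hz.1, ← R.r_g q z' hz'.1]
        exact congrArg _ h
    disjoint := fun p p' hp => by
      rcases h1 : e p with _ | q <;> rcases h2 : e p' with _ | q'
      · simp [h1, h2]
      · simp [h1, h2]
      · simp [h1, h2]
      · have hq : q ≠ q' := fun h => hp (by
          rw [← (he p q).mp h1, ← (he p' q').mp h2, h])
        simp only [h1, h2, Option.elim_some, R.image_A]
        exact (R.disjoint hq).mono Set.inter_subset_right Set.inter_subset_right
    covers := by
      ext y
      simp only [Set.mem_iUnion]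
      constructor
      · rintro ⟨p, hp⟩
        rcases h1 : e p with _ | q
        · simp [h1] at hp
        · simp only [h1, Option.elim_some, R.image_A] at hp
          exact hp.1
      · intro hy
        obtain ⟨q, hq⟩ := Set.mem_iUnion.mp (R.covers hy)
        refine ⟨f q, ?_⟩
        rw [(he (f q) q).mpr rfl, Option.elim_some, Option.elim_some, R.image_A]
        exact ⟨hy, hq⟩ }⟩

variable (P : Parametrization m k S)

/-- The part of a piece of `P` lying in the piece `q` of the reference system. -/
def D (i : ℕ) (q : ι) : Set (Fin k → ℂ) := {z ∈ P.A i | P.g i z ∈ R.E q}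

/-- The transition map from a piece of `P` to the coordinates `r q`. -/
def trans (i : ℕ) (q : ι) (z : Fin k → ℂ) : Fin k → ℂ := R.r q (P.g i z)

theorem measurableSet_D [BorelSpace M] (i : ℕ) (q : ι) : MeasurableSet (R.D P i q) := by
  have h : R.D P i q = P.A i ∩ (P.U i ∩ P.g i ⁻¹' R.E q) := by
    ext z
    exact ⟨fun h => ⟨h.1, P.subset i h.1, h.2⟩, fun h => ⟨h.1, h.2.2⟩⟩
  rw [h]
  exact (P.measurable i).inter (measurableSet_inter_preimage (P.isOpen i)
    (P.holomorphic i).continuousOn (R.measurable_E q))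

theorem iUnion_D (i : ℕ) : ⋃ q, R.D P i q = P.A i := by
  ext z
  simp only [Set.mem_iUnion]
  constructor
  · rintro ⟨q, hz, -⟩
    exact hz
  · intro hz
    obtain ⟨q, hq⟩ := Set.mem_iUnion.mp (R.covers (P.mapsTo i (P.subset i hz)))
    exact ⟨q, hz, hq⟩

theorem pairwise_disjoint_D (i : ℕ) : Pairwise fun q q' => Disjoint (R.D P i q) (R.D P i q') := by
  intro q q' hq
  rw [Set.disjoint_left]
  intro z hz hz'
  exact Set.disjoint_left.mp (R.disjoint hq) hz.2 hz'.2

theorem g_trans {i : ℕ} {q : ι} {z : Fin k → ℂ} (hz : z ∈ R.D P i q) :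
    R.g q (R.trans P i q z) = P.g i z :=
  R.g_r q _ (R.E_subset q hz.2) (P.mapsTo i (P.subset i hz.1))

theorem injOn_trans (i : ℕ) (q : ι) : Set.InjOn (R.trans P i q) (R.D P i q) := by
  intro z hz z' hz' h
  apply P.injOn i hz.1 hz'.1
  rw [← R.g_trans P hz, ← R.g_trans P hz', h]

/-- The sets `D i q` form a common refinement of the two decompositions: for fixed `i` they
partition `P.A i`, and for fixed `q` their transition images partition `R.A q`. -/
theorem iUnion_image_D (q : ι) : ⋃ i, R.trans P i q '' R.D P i q = R.A q := by
  ext w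
  simp only [Set.mem_iUnion]
  constructor
  · rintro ⟨i, z, hz, rfl⟩
    refine ⟨R.r_mem q _ (R.E_subset q hz.2) (P.mapsTo i (P.subset i hz.1)), ?_⟩
    rw [R.g_trans P hz]
    exact hz.2
  · rintro ⟨hw, hwE⟩
    have hS : R.g q w ∈ ⋃ i, P.g i '' P.A i := P.covers.symm ▸ R.g_mem q w hw
    obtain ⟨i, z, hz, hzw⟩ := Set.mem_iUnion.mp hS
    refine ⟨i, z, ⟨hz, by rw [hzw]; exact hwE⟩, ?_⟩
    rw [trans, hzw, R.r_g q w hw]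

theorem pairwise_disjoint_image_D (q : ι) :
    Pairwise fun i i' => Disjoint (R.trans P i q '' R.D P i q) (R.trans P i' q '' R.D P i' q) := by
  intro i i' hi
  rw [Set.disjoint_left]
  rintro _ ⟨z, hz, rfl⟩ ⟨z', hz', h⟩
  refine Set.disjoint_left.mp (P.disjoint hi) ⟨z, hz.1, rfl⟩ ⟨z', hz'.1, ?_⟩
  rw [← R.g_trans P hz, ← R.g_trans P hz', h]

theorem eventually_mem {i : ℕ} {q : ι} {z : Fin k → ℂ} (hz : z ∈ R.D P i q) :
    ∀ᶠ y in 𝓝 z, y ∈ P.U i ∧ P.g i y ∈ R.V q := by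
  have hU := (P.isOpen i).mem_nhds (P.subset i hz.1)
  have hc : ContinuousAt (P.g i) z := ((P.holomorphic i).mdifferentiableAt hU).continuousAt
  filter_upwards [hU, hc ((R.isOpen_V q).mem_nhds (R.E_subset q hz.2))] with y h1 h2
  exact ⟨h1, h2⟩

theorem differentiableAt_trans {i : ℕ} {q : ι} {z : Fin k → ℂ} (hz : z ∈ R.D P i q) :
    DifferentiableAt ℂ (R.trans P i q) z := by
  have h1 := (P.holomorphic i).mdifferentiableAt ((P.isOpen i).mem_nhds (P.subset i hz.1))
  have h2 := (R.mdiff_r q).mdifferentiableAt ((R.isOpen_V q).mem_nhds (R.E_subset q hz.2))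
  exact (h2.comp z h1).differentiableAt

theorem pullback_eq {i : ℕ} {q : ι} {z : Fin k → ℂ} (hz : z ∈ R.D P i q)
    (η : Form m M (2 * k)) :
    pullback (P.g i) η z (realBasis k) =
      |((fderiv ℂ (R.trans P i q) z).restrictScalars ℝ).det| •
        pullback (R.g q) η (R.trans P i q z) (realBasis k) := by
  refine pullback_top_comp ?_ ?_ (R.differentiableAt_trans P hz) η
  · filter_upwards [R.eventually_mem P hz] with y hy
    exact (R.g_r q _ hy.2 (P.mapsTo i hy.1)).symm
  · exact (R.mdiff_g q).mdifferentiableAt ((R.isOpen_U q).mem_nhds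
      (R.r_mem q _ (R.E_subset q hz.2) (P.mapsTo i (P.subset i hz.1))))

theorem hasFDerivWithinAt_trans {i : ℕ} {q : ι} {z : Fin k → ℂ} (hz : z ∈ R.D P i q) :
    HasFDerivWithinAt (R.trans P i q) ((fderiv ℂ (R.trans P i q) z).restrictScalars ℝ)
      (R.D P i q) z :=
  ((R.differentiableAt_trans P hz).hasFDerivAt.restrictScalars ℝ).hasFDerivWithinAt

theorem measurableSet_image_D [BorelSpace M] (i : ℕ) (q : ι) : MeasurableSet (R.trans P i q '' R.D P i q) :=
  measurable_image_of_fderivWithin (R.measurableSet_D P i q)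
    (fun _ hz => R.hasFDerivWithinAt_trans P hz) (R.injOn_trans P i q)

theorem integral_D [BorelSpace M] (i : ℕ) (q : ι) (η : Form m M (2 * k)) :
    ∫ z in R.D P i q, pullback (P.g i) η z (realBasis k) =
      ∫ w in R.trans P i q '' R.D P i q, pullback (R.g q) η w (realBasis k) := by
  rw [integral_image_eq_integral_abs_det_fderiv_smul volume (R.measurableSet_D P i q)
    (fun _ hz => R.hasFDerivWithinAt_trans P hz) (R.injOn_trans P i q)]
  exact setIntegral_congr_fun (R.measurableSet_D P i q) fun z hz => R.pullback_eq P hz η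

theorem integrableOn_D [BorelSpace M] (i : ℕ) (q : ι) (η : Form m M (2 * k)) :
    IntegrableOn (fun w => pullback (R.g q) η w (realBasis k)) (R.trans P i q '' R.D P i q) ↔
      IntegrableOn (fun z => pullback (P.g i) η z (realBasis k)) (R.D P i q) := by
  rw [integrableOn_image_iff_integrableOn_abs_det_fderiv_smul volume (R.measurableSet_D P i q)
    (fun _ hz => R.hasFDerivWithinAt_trans P hz) (R.injOn_trans P i q)]
  exact (integrableOn_congr_fun (fun z hz => R.pullback_eq P hz η) (R.measurableSet_D P i q)).symm

theorem lintegral_D [BorelSpace M] (i : ℕ) (q : ι) (η : Form m M (2 * k)) :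
    ∫⁻ z in R.D P i q, ‖pullback (P.g i) η z (realBasis k)‖ₑ =
      ∫⁻ w in R.trans P i q '' R.D P i q, ‖pullback (R.g q) η w (realBasis k)‖ₑ := by
  rw [lintegral_image_eq_lintegral_abs_det_fderiv_mul volume (R.measurableSet_D P i q)
    (fun _ hz => R.hasFDerivWithinAt_trans P hz) (R.injOn_trans P i q)]
  refine setLIntegral_congr_fun (R.measurableSet_D P i q) fun z hz => ?_
  simp only [R.pullback_eq P hz η, enorm_smul]
  rw [Real.enorm_of_nonneg (abs_nonneg _)]

variable [Countable ι]

/-- The integral over a submanifold may be computed in any system of holomorphic coordinates. -/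
theorem formIntegral_eq [BorelSpace M] [Nonempty M] (η : Form m M (2 * k))
    (hint : ∀ q, IntegrableOn (fun w => pullback (R.g q) η w (realBasis k)) (R.A q))
    (hfin : ∑' q, ∫⁻ w in R.A q, ‖pullback (R.g q) η w (realBasis k)‖ₑ ≠ ⊤) :
    FormIntegrable S η ∧
      formIntegral S η = ∑' q, ∫ w in R.A q, pullback (R.g q) η w (realBasis k) := by
  -- The definition of `formIntegral` picks this unspecified parametrization `P`, which has to be
  -- compared with `R`.
  have hne := R.nonempty_parametrization
  set P := hne.some with hP
  have hintD : ∀ i q, IntegrableOn (fun z => pullback (P.g i) η z (realBasis k)) (R.D P i q) := by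
    intro i q
    rw [← R.integrableOn_D P]
    exact (hint q).mono_set (by rw [← R.iUnion_image_D P q]; exact Set.subset_iUnion (fun i => R.trans P i q '' R.D P i q) i)
  have hlA : ∀ i, ∫⁻ z in P.A i, ‖pullback (P.g i) η z (realBasis k)‖ₑ =
      ∑' q, ∫⁻ z in R.D P i q, ‖pullback (P.g i) η z (realBasis k)‖ₑ := by
    intro i
    rw [← R.iUnion_D P i, lintegral_iUnion (R.measurableSet_D P i) (R.pairwise_disjoint_D P i)]
  have hlq : ∀ q, ∫⁻ w in R.A q, ‖pullback (R.g q) η w (realBasis k)‖ₑ =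
      ∑' i, ∫⁻ z in R.D P i q, ‖pullback (P.g i) η z (realBasis k)‖ₑ := by
    intro q
    rw [← R.iUnion_image_D P q, lintegral_iUnion (fun i => R.measurableSet_image_D P i q)
      (R.pairwise_disjoint_image_D P q)]
    simp only [R.lintegral_D P]
  have hsum : ∑' i, ∫⁻ z in P.A i, ‖pullback (P.g i) η z (realBasis k)‖ₑ ≠ ⊤ := by
    simp only [hlA]
    rw [ENNReal.tsum_comm]
    simpa only [hlq] using hfin
  have hintA : ∀ i, IntegrableOn (fun z => pullback (P.g i) η z (realBasis k)) (P.A i) := by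
    intro i
    refine ⟨?_, ?_⟩
    · rw [← R.iUnion_D P i, aestronglyMeasurable_iUnion_iff]
      exact fun q => (hintD i q).1
    · exact lt_top_iff_ne_top.mpr (ENNReal.ne_top_of_tsum_ne_top hsum i)
  refine ⟨⟨hne, hintA, ?_⟩, ?_⟩
  · have := ENNReal.summable_toReal hsum
    refine this.congr fun i => ?_
    rw [integral_norm_eq_lintegral_enorm (hintA i).1]
  · have h1 : formIntegral S η = ∑' i, ∫ z in P.A i, pullback (P.g i) η z (realBasis k) := by
      rw [formIntegral, dif_pos hne]
    have h2 : ∀ i, ∫ z in P.A i, pullback (P.g i) η z (realBasis k) =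
        ∑' q, ∫ z in R.D P i q, pullback (P.g i) η z (realBasis k) := by
      intro i
      have := integral_iUnion (μ := volume) (f := fun z => pullback (P.g i) η z (realBasis k))
        (R.measurableSet_D P i) (R.pairwise_disjoint_D P i) (by rw [R.iUnion_D P i]; exact hintA i)
      rwa [R.iUnion_D P i] at this
    have h3 : ∀ q, ∫ w in R.A q, pullback (R.g q) η w (realBasis k) =
        ∑' i, ∫ z in R.D P i q, pullback (P.g i) η z (realBasis k) := by
      intro q
      have := integral_iUnion (μ := volume) (f := fun w => pullback (R.g q) η w (realBasis k))
        (fun i => R.measurableSet_image_D P i q) (R.pairwise_disjoint_image_D P q)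
        (by rw [R.iUnion_image_D P q]; exact hint q)
      rw [R.iUnion_image_D P q] at this
      rw [this]
      simp only [R.integral_D P]
    rw [h1]
    simp only [h2, h3]
    -- Both integrals are now the double sum over the common refinement, in the two orders;
    -- finiteness of the sum of the integrals of norms permits the exchange.
    refine Summable.tsum_comm ?_
    have hs : ∑' p : ι × ℕ, ∫⁻ z in R.D P p.2 p.1,
        ‖pullback (P.g p.2) η z (realBasis k)‖ₑ ≠ ⊤ := by
      rw [ENNReal.tsum_prod']
      simpa only [hlq] using hfin
    refine Summable.of_norm_bounded (ENNReal.summable_toReal hs) fun p => ?_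
    refine (norm_integral_le_integral_norm _).trans (le_of_eq ?_)
    rw [integral_norm_eq_lintegral_enorm (hintD p.2 p.1).1]

end RefSystem

end RefSystem

end RandomZeros

end

noncomputable section

namespace RandomZeros

/-! ### Disjoint refinements and Fubini for slices. -/

section Measure

theorem exists_disjoint_refinement {X ι : Type*} [MeasurableSpace X] [Countable ι] (V : ι → Set X)
    (hV : ∀ i, MeasurableSet (V i)) : ∃ E : ι → Set X, (∀ i, MeasurableSet (E i)) ∧
      (∀ i, E i ⊆ V i) ∧ (Pairwise fun i i' => Disjoint (E i) (E i')) ∧ ⋃ i, E i = ⋃ i, V i := by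
  classical
  obtain ⟨f, hf⟩ := Countable.exists_injective_nat ι
  refine ⟨fun i => V i \ ⋃ i', ⋃ (_ : f i' < f i), V i', fun i => ?_, fun i => Set.sdiff_subset,
    ?_, ?_⟩
  · exact (hV i).diff (MeasurableSet.iUnion fun i' => MeasurableSet.iUnion fun _ => hV i')
  · intro i i' hii'
    rw [Set.disjoint_left]
    intro x hx hx'
    rcases lt_or_gt_of_ne (hf.ne hii') with h | h
    · exact hx'.2 (Set.mem_iUnion₂.mpr ⟨i, h, hx.1⟩)
    · exact hx.2 (Set.mem_iUnion₂.mpr ⟨i', h, hx'.1⟩)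
  · refine subset_antisymm (Set.iUnion_mono fun i => Set.sdiff_subset) fun x hx => ?_
    obtain ⟨i₀, hi₀⟩ := Set.mem_iUnion.mp hx
    have hex : ∃ p, ∃ i, f i = p ∧ x ∈ V i := ⟨_, i₀, rfl, hi₀⟩
    obtain ⟨i, hi, hxi⟩ := Nat.find_spec hex
    refine Set.mem_iUnion.mpr ⟨i, hxi, fun hc => ?_⟩
    obtain ⟨i', hi', hxi'⟩ := Set.mem_iUnion₂.mp hc
    exact Nat.find_min hex (hi ▸ hi') ⟨i', rfl, hxi'⟩

/-- Fubini's theorem for a countable family of integrals over the slices of sets `B i`. -/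
theorem integral_tsum_slices {Y A ι : Type*} [MeasurableSpace Y] [MeasurableSpace A] [Countable ι]
    (μ : Measure Y) (ν : Measure A) [SFinite μ] [SFinite ν] (B : ι → Set (Y × A))
    (hB : ∀ i, MeasurableSet (B i)) (h : ι → Y × A → ℂ) (ρ : A → ℂ) (hρ : ∀ a, ρ a ≠ 0)
    (hint : ∀ i, IntegrableOn (fun p => ρ p.2 * h i p) (B i) (μ.prod ν))
    (hfin : ∑' i, ∫⁻ p in B i, ‖ρ p.2 * h i p‖ₑ ∂(μ.prod ν) ≠ ⊤) :
    (∀ᵐ a ∂ν, (∀ i, IntegrableOn (fun w => h i (w, a)) {w | (w, a) ∈ B i} μ) ∧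
      ∑' i, ∫⁻ w in {w | (w, a) ∈ B i}, ‖h i (w, a)‖ₑ ∂μ ≠ ⊤) ∧
    Integrable (fun a => ρ a * ∑' i, ∫ w in {w | (w, a) ∈ B i}, h i (w, a) ∂μ) ν ∧
    ∫ a, ρ a * ∑' i, ∫ w in {w | (w, a) ∈ B i}, h i (w, a) ∂μ ∂ν =
      ∑' i, ∫ p in B i, ρ p.2 * h i p ∂(μ.prod ν) := by
  classical
  -- Extension by zero reduces the statement to Fubini on the whole product. Integrability is known
  -- only with the weight `ρ`, which is nonzero and constant on each slice and can be divided out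
  -- there.
  let f : ι → Y × A → ℂ := fun i => (B i).indicator fun p => ρ p.2 * h i p
  have hf : ∀ i, Integrable (f i) (μ.prod ν) := fun i => (integrable_indicator_iff (hB i)).mpr (hint i)
  have hsl : ∀ i a, MeasurableSet {w | (w, a) ∈ B i} := fun i a =>
    measurable_prodMk_right (hB i)
  have hfsl : ∀ i a, (fun w => f i (w, a)) =
      ({w | (w, a) ∈ B i}).indicator fun w => ρ a * h i (w, a) := by
    intro i a
    ext w
    by_cases hw : (w, a) ∈ B i
    · simp [f, hw]
    · simp [f, hw]
  have hlint : ∀ i a, ∫⁻ w, ‖f i (w, a)‖ₑ ∂μ =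
      ‖ρ a‖ₑ * ∫⁻ w in {w | (w, a) ∈ B i}, ‖h i (w, a)‖ₑ ∂μ := by
    intro i a
    have e : ∀ w, ‖f i (w, a)‖ₑ =
        ({w | (w, a) ∈ B i}).indicator (fun w => ‖ρ a‖ₑ * ‖h i (w, a)‖ₑ) w := by
      intro w
      rw [congrFun (hfsl i a) w]
      by_cases hw : (w, a) ∈ B i
      · simp [hw, enorm_mul]
      · simp [hw]
    simp only [e]
    rw [lintegral_indicator (hsl i a), lintegral_const_mul' _ _ enorm_ne_top]
  have hI : ∀ i a, ∫ w, f i (w, a) ∂μ = ρ a * ∫ w in {w | (w, a) ∈ B i}, h i (w, a) ∂μ := by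
    intro i a
    rw [hfsl, integral_indicator (hsl i a), integral_const_mul]
  have hfin' : ∑' i, ∫⁻ a, ∫⁻ w, ‖f i (w, a)‖ₑ ∂μ ∂ν ≠ ⊤ := by
    convert hfin using 3 with i
    rw [← lintegral_indicator (hB i), ← lintegral_prod_symm _ (hf i).1.enorm]
    refine lintegral_congr fun p => ?_
    by_cases hp : p ∈ B i
    · simp [f, hp]
    · simp [f, hp]
  have hae1 : ∀ᵐ a ∂ν, ∀ i, Integrable (fun w => f i (w, a)) μ := by
    rw [ae_all_iff]
    exact fun i => (hf i).prod_left_ae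
  have haem : ∀ i, AEMeasurable (fun a => ∫⁻ w, ‖f i (w, a)‖ₑ ∂μ) ν := fun i =>
    (hf i).1.enorm.lintegral_prod_left'
  have hae2 : ∀ᵐ a ∂ν, ∑' i, ∫⁻ w, ‖f i (w, a)‖ₑ ∂μ < ⊤ := by
    refine ae_lt_top' (AEMeasurable.tsum haem) ?_
    rwa [lintegral_tsum haem]
  have hint' : ∀ i, Integrable (fun a => ∫ w, f i (w, a) ∂μ) ν := fun i => (hf i).integral_prod_right
  have hbd : ∑' i, ∫⁻ a, ‖∫ w, f i (w, a) ∂μ‖ₑ ∂ν ≠ ⊤ := by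
    refine ne_top_of_le_ne_top hfin' (ENNReal.tsum_le_tsum fun i => lintegral_mono fun a => ?_)
    exact enorm_integral_le_lintegral_enorm _
  have hF : (fun a => ρ a * ∑' i, ∫ w in {w | (w, a) ∈ B i}, h i (w, a) ∂μ) =
      fun a => ∑' i, ∫ w, f i (w, a) ∂μ := by
    funext a
    rw [← tsum_mul_left]
    simp only [hI]
  refine ⟨?_, ?_, ?_⟩
  · filter_upwards [hae1, hae2] with a h1 h2
    constructor
    · intro i
      have := h1 i
      rw [hfsl, integrable_indicator_iff (hsl i a)] at this
      refine (this.const_mul (ρ a)⁻¹).congr (Filter.Eventually.of_forall fun w => ?_)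
      simp [hρ a]
    · simp only [hlint, ENNReal.tsum_mul_left] at h2
      intro htop
      rw [htop, ENNReal.mul_top (by simpa using hρ a)] at h2
      exact lt_irrefl _ h2
  · rw [hF]
    refine ⟨?_, ?_⟩
    · have hsum : ∀ᵐ a ∂ν, Summable fun i => ∫ w, f i (w, a) ∂μ := by
        filter_upwards [hae2] with a ha
        refine .of_enorm (ne_top_of_le_ne_top ha.ne (ENNReal.tsum_le_tsum fun i => ?_))
        exact enorm_integral_le_lintegral_enorm _
      refine aestronglyMeasurable_of_tendsto_ae Filter.atTop
        (f := fun (s : Finset ι) a => ∑ i ∈ s, ∫ w, f i (w, a) ∂μ) (fun s => ?_) ?_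
      · exact Finset.aestronglyMeasurable_fun_sum _ fun i _ => (hint' i).1
      · filter_upwards [hsum] with a ha using ha.hasSum
    · refine lt_of_le_of_lt (lintegral_mono fun a => ?_) (lt_top_iff_ne_top.mpr
        (by rwa [lintegral_tsum fun i => (hint' i).1.enorm] : 
          ∫⁻ a, ∑' i, ‖∫ w, f i (w, a) ∂μ‖ₑ ∂ν ≠ ⊤))
      exact enorm_tsum_le_tsum_enorm
  · rw [hF, integral_tsum (fun i => (hint' i).1) hbd]
    refine tsum_congr fun i => ?_
    rw [← integral_prod_symm _ (hf i), integral_indicator (hB i)]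

end Measure

/-! ### Exchange of a coordinate of `z` for a coefficient of the section. -/

section Exchange

variable {n e : ℕ}

/-- The coordinates `(z, a')` as functions of `(w, a)`: the `l`-th coordinate of `z` is `a_j`. -/
def exchange (l : Fin (n + 1)) (j : Fin (e + 1)) (p : (Fin n → ℂ) × (Fin (e + 1) → ℂ)) :
    Fin (n + 1) ⊕ Fin e → ℂ :=
  Sum.elim (l.insertNth (p.2 j) p.1) (j.removeNth p.2)

/-- `exchange` as a measurable equivalence. -/
def exchangeEquiv (l : Fin (n + 1)) (j : Fin (e + 1)) :
    ((Fin n → ℂ) × (Fin (e + 1) → ℂ)) ≃ᵐ (Fin (n + 1) ⊕ Fin e → ℂ) :=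
  ((MeasurableEquiv.refl (Fin n → ℂ)).prodCongr
    (MeasurableEquiv.piFinSuccAbove (fun _ : Fin (e + 1) => ℂ) j)).trans
  (MeasurableEquiv.prodAssoc.symm.trans
  (((MeasurableEquiv.prodComm.trans
      (MeasurableEquiv.piFinSuccAbove (fun _ : Fin (n + 1) => ℂ) l).symm).prodCongr
    (MeasurableEquiv.refl (Fin e → ℂ))).trans
  (MeasurableEquiv.sumPiEquivProdPi (fun _ : Fin (n + 1) ⊕ Fin e => ℂ)).symm))

theorem coe_exchangeEquiv (l : Fin (n + 1)) (j : Fin (e + 1)) :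
    ⇑(exchangeEquiv (n := n) (e := e) l j) = exchange l j := by
  funext p
  ext (i | i) <;> rfl

theorem measurePreserving_exchange (l : Fin (n + 1)) (j : Fin (e + 1)) :
    MeasurePreserving (exchange (n := n) (e := e) l j) := by
  rw [← coe_exchangeEquiv]
  have h1 : MeasurePreserving (MeasurableEquiv.piFinSuccAbove (fun _ : Fin (e + 1) => ℂ) j) :=
    volume_preserving_piFinSuccAbove (fun _ : Fin (e + 1) => ℂ) j
  have h2 : MeasurePreserving (MeasurableEquiv.piFinSuccAbove (fun _ : Fin (n + 1) => ℂ) l) :=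
    volume_preserving_piFinSuccAbove (fun _ : Fin (n + 1) => ℂ) l
  have h3 : MeasurePreserving (MeasurableEquiv.sumPiEquivProdPi
      (fun _ : Fin (n + 1) ⊕ Fin e => ℂ)) :=
    volume_measurePreserving_sumPiEquivProdPi _
  have h4 : MeasurePreserving ((MeasurableEquiv.refl (Fin n → ℂ)).prodCongr
    (MeasurableEquiv.piFinSuccAbove (fun _ : Fin (e + 1) => ℂ) j)) :=
    (MeasurePreserving.id volume).prod h1
  have h5 : MeasurePreserving ((MeasurableEquiv.prodAssoc :
      ((Fin n → ℂ) × ℂ) × (Fin e → ℂ) ≃ᵐ (Fin n → ℂ) × ℂ × (Fin e → ℂ)).symm) :=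
    (measurePreserving_prodAssoc (volume : Measure (Fin n → ℂ)) (volume : Measure ℂ)
      (volume : Measure (Fin e → ℂ))).symm _
  have h6 : MeasurePreserving ((MeasurableEquiv.prodComm : (Fin n → ℂ) × ℂ ≃ᵐ ℂ × (Fin n → ℂ))) :=
    Measure.measurePreserving_swap
  have h7 : MeasurePreserving ((MeasurableEquiv.prodComm.trans
      (MeasurableEquiv.piFinSuccAbove (fun _ : Fin (n + 1) => ℂ) l).symm).prodCongr
    (MeasurableEquiv.refl (Fin e → ℂ))) :=
    ((h2.symm _).comp h6).prod (MeasurePreserving.id volume)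
  exact (h3.symm _).comp (h7.comp (h5.comp h4))

end Exchange

end RandomZeros

end

noncomputable section

namespace RandomZeros

/-! ### Local coordinates on the incidence variety. -/

section Graph

variable {n e : ℕ}

/-- The solution `a_j` of `∑ k, a_k g_k(z) = 0`, where `g_j = 1`, as a function of `z` and of the
other coordinates of `a`. -/
def graphFun (j : Fin (e + 1)) (g : (Fin (n + 1) → ℂ) → (Fin (e + 1) → ℂ))
    (x : Fin (n + 1) ⊕ Fin e → ℂ) : ℂ :=
  -∑ k, x (Sum.inr k) * g (fun i => x (Sum.inl i)) (j.succAbove k)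

/-- The derivative of `graphFun` in the `z`-directions. -/
def slope (j : Fin (e + 1)) (g : (Fin (n + 1) → ℂ) → (Fin (e + 1) → ℂ))
    (x : Fin (n + 1) ⊕ Fin e → ℂ) : (Fin (n + 1) → ℂ) →L[ℂ] ℂ :=
  -∑ k, x (Sum.inr k) • (ContinuousLinearMap.proj (j.succAbove k)).comp
    (fderiv ℂ g (fun i => x (Sum.inl i)))

/-- The inclusion of the `z`-directions. -/
def inlL : (Fin (n + 1) → ℂ) →L[ℂ] (Fin (n + 1) ⊕ Fin e → ℂ) :=
  ContinuousLinearMap.pi (Sum.elim (fun i => ContinuousLinearMap.proj i) fun _ => 0)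

theorem inlL_apply (v : Fin (n + 1) → ℂ) : inlL (e := e) v = Sum.elim v 0 := by
  ext (i | i) <;> simp [inlL]

theorem inlL_single (l : Fin (n + 1)) :
    inlL (e := e) (Pi.single l 1) = Pi.single (Sum.inl l) 1 := by
  rw [inlL_apply]
  ext (i | i)
  · by_cases h : i = l
    · subst h; simp
    · simp [h]
  · simp

variable {j : Fin (e + 1)} {g : (Fin (n + 1) → ℂ) → (Fin (e + 1) → ℂ)} {T : Set (Fin (n + 1) → ℂ)}

theorem isOpen_cylinder (hT : IsOpen T) :
    IsOpen {x : Fin (n + 1) ⊕ Fin e → ℂ | (fun i => x (Sum.inl i)) ∈ T} :=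
  hT.preimage (by fun_prop)

theorem differentiableOn_graphFun (hg : DifferentiableOn ℂ g T) :
    DifferentiableOn ℂ (graphFun j g)
      {x : Fin (n + 1) ⊕ Fin e → ℂ | (fun i => x (Sum.inl i)) ∈ T} := by
  have h : DifferentiableOn ℂ (fun x : Fin (n + 1) ⊕ Fin e → ℂ => g (fun i => x (Sum.inl i)))
      {x : Fin (n + 1) ⊕ Fin e → ℂ | (fun i => x (Sum.inl i)) ∈ T} :=
    hg.comp (f := fun (x : Fin (n + 1) ⊕ Fin e → ℂ) i => x (Sum.inl i)) (by fun_prop)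
      fun x hx => hx
  have h' := differentiableOn_pi.mp h
  unfold graphFun
  refine DifferentiableOn.fun_neg (DifferentiableOn.fun_sum fun k _ => ?_)
  exact DifferentiableOn.fun_mul (by fun_prop) (h' _)

theorem hasFDerivAt_linear_comb (hT : IsOpen T) (hg : DifferentiableOn ℂ g T)
    {x : Fin (n + 1) ⊕ Fin e → ℂ} (hx : (fun i => x (Sum.inl i)) ∈ T) :
    HasFDerivAt (fun z => -∑ k, x (Sum.inr k) * g z (j.succAbove k)) (slope j g x)
      (fun i => x (Sum.inl i)) := by
  unfold slope
  refine HasFDerivAt.fun_neg (HasFDerivAt.fun_sum fun k _ => ?_)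
  have := (hasFDerivAt_pi'.mp (hg.differentiableAt (hT.mem_nhds hx)).hasFDerivAt) (j.succAbove k)
  exact this.const_mul _

theorem fderiv_graphFun_inl (hT : IsOpen T) (hg : DifferentiableOn ℂ g T)
    {x : Fin (n + 1) ⊕ Fin e → ℂ} (hx : (fun i => x (Sum.inl i)) ∈ T) :
    (fderiv ℂ (graphFun j g) x).comp inlL = slope j g x := by
  have h1 := ((differentiableOn_graphFun (j := j) hg).differentiableAt
    ((isOpen_cylinder hT).mem_nhds hx)).hasFDerivAt
  have hx' : x = Sum.elim (fun i => x (Sum.inl i)) fun k => x (Sum.inr k) := by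
    ext (i | i) <;> rfl
  have h2 : HasFDerivAt (fun z : Fin (n + 1) → ℂ =>
      (Sum.elim z fun k => x (Sum.inr k) : Fin (n + 1) ⊕ Fin e → ℂ)) inlL
      (fun i => x (Sum.inl i)) := by
    rw [hasFDerivAt_pi']
    rintro (i | i)
    · exact hasFDerivAt_apply i _
    · simpa [inlL] using hasFDerivAt_const (𝕜 := ℂ) (x (Sum.inr i)) (fun i => x (Sum.inl i))
  have h3 : HasFDerivAt (graphFun j g ∘ fun z : Fin (n + 1) → ℂ =>
      (Sum.elim z fun k => x (Sum.inr k) : Fin (n + 1) ⊕ Fin e → ℂ))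
      ((fderiv ℂ (graphFun j g) x).comp inlL) (fun i => x (Sum.inl i)) := by
    refine HasFDerivAt.comp (g := graphFun j g) _ ?_ h2
    rw [← hx']
    exact h1
  exact h3.unique (hasFDerivAt_linear_comb hT hg hx)

theorem fderiv_graphFun_single (hT : IsOpen T) (hg : DifferentiableOn ℂ g T)
    {x : Fin (n + 1) ⊕ Fin e → ℂ} (hx : (fun i => x (Sum.inl i)) ∈ T) (l : Fin (n + 1)) :
    fderiv ℂ (graphFun j g) x (Pi.single (Sum.inl l) 1) = slope j g x (Pi.single l 1) := by
  rw [← inlL_single, ← fderiv_graphFun_inl hT hg hx]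
  rfl

/-- Local coordinates on the incidence variety `{(z, a) | ∑ k, a_k g_k(z) = 0}`, obtained by
replacing the `l`-th coordinate of `z` by `a_j`. -/
structure GraphChart (j : Fin (e + 1)) (g : (Fin (n + 1) → ℂ) → (Fin (e + 1) → ℂ))
    (T : Set (Fin (n + 1) → ℂ)) where
  l : Fin (n + 1)
  chart : OpenPartialHomeomorph (Fin (n + 1) ⊕ Fin e → ℂ) (Fin (n + 1) ⊕ Fin e → ℂ)
  source_subset : ∀ x ∈ chart.source, (fun i => x (Sum.inl i)) ∈ T
  chart_apply : ∀ x, chart x = Function.update x (Sum.inl l) (graphFun j g x)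
  ne_zero : ∀ x ∈ chart.source, slope j g x (Pi.single l 1) ≠ 0
  contDiffOn_symm : ContDiffOn ℂ ω chart.symm chart.target

/-- The points of a cylinder at which `graphFun` is not critical in the `z`-directions are covered
by countably many charts. -/
theorem exists_graphCharts (hT : IsOpen T) (hg : DifferentiableOn ℂ g T) :
    ∃ (ι : Type) (_ : Countable ι) (c : ι → GraphChart j g T),
      ⋃ i, (c i).chart.source =
        {x : Fin (n + 1) ⊕ Fin e → ℂ | (fun i => x (Sum.inl i)) ∈ T ∧ slope j g x ≠ 0} := by
  set X₀ := {x : Fin (n + 1) ⊕ Fin e → ℂ | (fun i => x (Sum.inl i)) ∈ T ∧ slope j g x ≠ 0}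
  have key : ∀ x : X₀, ∃ c : GraphChart j g T, x.1 ∈ c.chart.source := by
    rintro ⟨x, hx, hx0⟩
    obtain ⟨l, hl⟩ := exists_single_ne_zero hx0
    rw [← fderiv_graphFun_single hT hg hx] at hl
    obtain ⟨c, hc1, hc2, hc3, hc4, hc5, hc6⟩ := exists_updateHomeomorph
      (isOpen_cylinder hT) (differentiableOn_graphFun hg) hx hl
    exact ⟨⟨l, c, hc2, hc3, fun y hy => by
      rw [← fderiv_graphFun_single hT hg (hc2 hy)]; exact hc4 y hy, hc6⟩, hc1⟩
  choose c hc using key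
  have hsub : ∀ x : X₀, (c x).chart.source ⊆ X₀ := fun x y hy =>
    ⟨(c x).source_subset y hy, fun h0 => (c x).ne_zero y hy (by rw [h0]; rfl)⟩
  -- The Lindelöf property of `ℂᵏ` reduces the cover to a countable one.
  obtain ⟨t, ht, htU⟩ := TopologicalSpace.isOpen_iUnion_countable
    (fun x : X₀ => (c x).chart.source) fun x => (c x).chart.open_source
  refine ⟨t, ht.to_subtype, fun i => c i, ?_⟩
  refine (Set.biUnion_eq_iUnion t fun i _ => (c i).chart.source).symm.trans (htU.trans ?_)
  exact subset_antisymm (Set.iUnion_subset hsub) fun x hx => Set.mem_iUnion.mpr ⟨⟨x, hx⟩, hc _⟩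

namespace GraphChart

variable (c : GraphChart j g T)

/-- The point `z` with coordinates `(w, a)`. -/
def point (p : (Fin n → ℂ) × (Fin (e + 1) → ℂ)) : Fin (n + 1) → ℂ :=
  fun i => c.chart.symm (exchange c.l j p) (Sum.inl i)

/-- The chart alters only the `l`-th coordinate of `z`, so comparing coordinates recovers the point
of the incidence variety from `(w, a)`. -/
theorem symm_exchange {p : (Fin n → ℂ) × (Fin (e + 1) → ℂ)}
    (hp : exchange c.l j p ∈ c.chart.target) :
    c.chart.symm (exchange c.l j p) = Sum.elim (c.point p) (j.removeNth p.2) ∧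
      c.l.removeNth (c.point p) = p.1 ∧ graphFun j g (c.chart.symm (exchange c.l j p)) = p.2 j := by
  have h := c.chart.right_inv hp
  rw [c.chart_apply] at h
  refine ⟨?_, ?_, ?_⟩
  · ext (i | i)
    · rfl
    · simpa [exchange] using congrFun h (Sum.inr i)
  · ext i
    simpa [exchange, Fin.removeNth, point] using congrFun h (Sum.inl (c.l.succAbove i))
  · simpa [exchange] using congrFun h (Sum.inl c.l)

theorem exchange_eq {z : Fin (n + 1) → ℂ} {a : Fin (e + 1) → ℂ}
    (hG : graphFun j g (Sum.elim z (j.removeNth a)) = a j) :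
    c.chart (Sum.elim z (j.removeNth a)) = exchange c.l j (c.l.removeNth z, a) := by
  rw [c.chart_apply, hG]
  ext (i | i)
  · simp only [exchange, Sum.elim_inl]
    by_cases h : i = c.l
    · subst h; simp
    · obtain ⟨i, rfl⟩ := Fin.exists_succAbove_eq h
      simp [Fin.removeNth]
  · simp [exchange]

theorem differentiableOn_point (a : Fin (e + 1) → ℂ) :
    DifferentiableOn ℂ (fun w => c.point (w, a)) {w | exchange c.l j (w, a) ∈ c.chart.target} := by
  have h1 : Differentiable ℂ fun w : Fin n → ℂ => exchange (e := e) c.l j (w, a) := by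
    rw [differentiable_pi]
    rintro (i | i)
    · by_cases h : i = c.l
      · subst h; simp [exchange]
      · obtain ⟨i, rfl⟩ := Fin.exists_succAbove_eq h
        simp only [exchange, Sum.elim_inl, Fin.insertNth_apply_succAbove]
        fun_prop
    · simp [exchange]
  have h2 := (c.contDiffOn_symm.differentiableOn (by simp)).comp h1.differentiableOn
    (s := {w | exchange c.l j (w, a) ∈ c.chart.target}) fun w hw => hw
  exact differentiableOn_pi.mpr fun i => differentiableOn_pi.mp h2 (Sum.inl i)

theorem isOpen_slice (a : Fin (e + 1) → ℂ) :
    IsOpen {w | exchange c.l j (w, a) ∈ c.chart.target} := by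
  refine c.chart.open_target.preimage (continuous_pi ?_)
  rintro (i | i)
  · by_cases h : i = c.l
    · subst h; simp only [exchange, Sum.elim_inl, Fin.insertNth_apply_same]; fun_prop
    · obtain ⟨i, rfl⟩ := Fin.exists_succAbove_eq h
      simp only [exchange, Sum.elim_inl, Fin.insertNth_apply_succAbove]
      fun_prop
  · simp only [exchange, Sum.elim_inr]; fun_prop

/-- The pullback of a form on `ℂⁿ⁺¹` to the slice of the incidence variety, on the real basis. -/
def pull (ϕ : (Fin (n + 1) → ℂ) → Alt (n + 1) (2 * n)) (p : (Fin n → ℂ) × (Fin (e + 1) → ℂ)) : ℂ :=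
  ϕ (c.point p) fun i => fderiv ℂ (fun w => c.point (w, p.2)) p.1 (realBasis n i)

/-- For fixed `a` the graph function keeps the value `a_j` along the slice, so the tangent vectors
of the slice lie in the kernel of the slope; all coordinates of the point except the `l`-th are `w`.
These are the hypotheses of `wedge_hermForm_apply`. -/
theorem pull_eq (hT : IsOpen T) (hg : DifferentiableOn ℂ g T)
    (ϕ : (Fin (n + 1) → ℂ) → Alt (n + 1) (2 * n)) {p : (Fin n → ℂ) × (Fin (e + 1) → ℂ)}
    (hp : exchange c.l j p ∈ c.chart.target) {x : Fin (n + 1) ⊕ Fin e → ℂ}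
    (hx : c.chart.symm (exchange c.l j p) = x) :
    ((‖slope j g x (Pi.single c.l 1)‖ ^ 2 : ℝ) : ℂ) * c.pull ϕ p =
      wedge (by ring) ((Complex.I / 2) • hermForm (slope j g x) (slope j g x))
        (ϕ fun i => x (Sum.inl i)) (realBasis (n + 1)) := by
  subst hx
  obtain ⟨w, a⟩ := p
  have hd := (c.differentiableOn_point a).differentiableAt ((c.isOpen_slice a).mem_nhds hp)
  have hs := c.chart.map_target hp
  have hT' := c.source_subset _ hs
  set x := c.chart.symm (exchange c.l j (w, a)) with hxdef
  rw [wedge_hermForm_apply (by ring) (slope j g x) _ c.l (c.ne_zero _ hs)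
    (fderiv ℂ (fun w => c.point (w, a)) w : (Fin n → ℂ) →ₗ[ℂ] _)]
  · rfl
  · intro v
    have h1 := hasFDerivAt_linear_comb (j := j) hT hg hT'
    have h2 := HasFDerivAt.comp (f := fun w => c.point (w, a)) w h1 hd.hasFDerivAt
    have h3 : (fun z => -∑ k, x (Sum.inr k) * g z (j.succAbove k)) ∘ (fun w => c.point (w, a))
        =ᶠ[𝓝 w] fun _ => a j := by
      filter_upwards [(c.isOpen_slice a).mem_nhds hp] with w' hw'
      obtain ⟨e1, e2, e3⟩ := c.symm_exchange hw'
      obtain ⟨f1, f2, f3⟩ := c.symm_exchange hp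
      rw [e1] at e3
      have hx2 : ∀ k, x (Sum.inr k) = j.removeNth a k := fun k => by rw [hxdef, f1]; rfl
      simp only [Function.comp_apply, hx2]
      exact e3
    have h4 := (h2.congr_of_eventuallyEq h3.symm).unique (hasFDerivAt_const (a j) w)
    exact DFunLike.congr_fun h4 v
  · intro v
    ext i
    have h1 := hasFDerivAt_pi'.mp hd.hasFDerivAt (c.l.succAbove i)
    have h3 : (fun w => c.point (w, a) (c.l.succAbove i)) =ᶠ[𝓝 w] fun w => w i := by
      filter_upwards [(c.isOpen_slice a).mem_nhds hp] with w' hw'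
      obtain ⟨e1, e2, e3⟩ := c.symm_exchange hw'
      exact congrFun e2 i
    have h4 := (h1.congr_of_eventuallyEq h3.symm).unique (hasFDerivAt_apply i w)
    exact DFunLike.congr_fun h4 v

/-- The part of the coordinate domain over which the point of the incidence variety lies in `E`. -/
def domain (E : Set (Fin (n + 1) ⊕ Fin e → ℂ)) : Set ((Fin n → ℂ) × (Fin (e + 1) → ℂ)) :=
  {p | exchange c.l j p ∈ c.chart.target ∧ c.chart.symm (exchange c.l j p) ∈ E}

variable {E : Set (Fin (n + 1) ⊕ Fin e → ℂ)}

theorem domain_eq (hE : E ⊆ c.chart.source) :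
    c.domain E = exchangeEquiv c.l j ⁻¹' (c.chart '' E) := by
  ext p
  rw [coe_exchangeEquiv]
  constructor
  · rintro ⟨h1, h2⟩
    exact ⟨_, h2, c.chart.right_inv h1⟩
  · rintro ⟨x, hx, hxp⟩
    refine ⟨?_, ?_⟩
    · rw [← hxp]; exact c.chart.map_source (hE hx)
    · rw [← hxp, c.chart.left_inv (hE hx)]; exact hx

theorem measurableSet_image (hE : E ⊆ c.chart.source) (hEm : MeasurableSet E) :
    MeasurableSet (c.chart '' E) := by
  have : c.chart '' E = c.chart.target ∩ c.chart.symm ⁻¹' E := by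
    rw [c.chart.image_eq_target_inter_inv_preimage hE]
  rw [this]
  exact measurableSet_inter_preimage c.chart.open_target c.chart.continuousOn_symm hEm

theorem measurableSet_domain (hE : E ⊆ c.chart.source) (hEm : MeasurableSet E) :
    MeasurableSet (c.domain E) := by
  rw [c.domain_eq hE]
  exact (exchangeEquiv c.l j).measurable (c.measurableSet_image hE hEm)

theorem hasFDerivAt_chart (hT : IsOpen T) (hg : DifferentiableOn ℂ g T)
    {x : Fin (n + 1) ⊕ Fin e → ℂ} (hx : x ∈ c.chart.source) :
    HasFDerivAt c.chart ((updateL (Sum.inl c.l) (fderiv ℂ (graphFun j g) x)).restrictScalars ℝ)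
      x := by
  have h1 := ((differentiableOn_graphFun (j := j) hg).differentiableAt
    ((isOpen_cylinder hT).mem_nhds (c.source_subset x hx))).hasFDerivAt
  have h2 := hasFDerivAt_update (p := Sum.inl c.l) h1
  rw [← funext c.chart_apply] at h2
  exact h2.restrictScalars ℝ

/-- This Jacobian is the same factor as in `pull_eq`. The two cancel, which makes the density on the
incidence variety independent of the exchanged coordinate `l`. -/
theorem abs_det_chart (hT : IsOpen T) (hg : DifferentiableOn ℂ g T)
    {x : Fin (n + 1) ⊕ Fin e → ℂ} (hx : x ∈ c.chart.source) :
    |((updateL (Sum.inl c.l) (fderiv ℂ (graphFun j g) x)).restrictScalars ℝ).det| =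
      ‖slope j g x (Pi.single c.l 1)‖ ^ 2 := by
  have h := det_restrictScalars_complex
    (updateL (Sum.inl c.l) (fderiv ℂ (graphFun j g) x) :
      (Fin (n + 1) ⊕ Fin e → ℂ) →ₗ[ℂ] (Fin (n + 1) ⊕ Fin e → ℂ))
  rw [det_updateL, fderiv_graphFun_single hT hg (c.source_subset x hx)] at h
  rw [← abs_of_nonneg (sq_nonneg ‖slope j g x (Pi.single c.l 1)‖), ← h]
  rfl

/-- Change of variables between a part of the incidence variety with coordinates `(z, a')` and its
coordinates `(w, a)`. -/
theorem change_variables (hT : IsOpen T) (hg : DifferentiableOn ℂ g T) (hE : E ⊆ c.chart.source)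
    (hEm : MeasurableSet E) {F : (Fin n → ℂ) × (Fin (e + 1) → ℂ) → ℂ}
    {W : (Fin (n + 1) ⊕ Fin e → ℂ) → ℂ}
    (hFW : ∀ p x, exchange c.l j p ∈ c.chart.target → c.chart.symm (exchange c.l j p) = x →
      ((‖slope j g x (Pi.single c.l 1)‖ ^ 2 : ℝ) : ℂ) * F p = W x) (hW : IntegrableOn W E) :
    IntegrableOn F (c.domain E) ∧ ∫ p in c.domain E, F p = ∫ x in E, W x ∧
      ∫⁻ p in c.domain E, ‖F p‖ₑ = ∫⁻ x in E, ‖W x‖ₑ := by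
  set ε := exchangeEquiv (n := n) (e := e) c.l j
  have hmp : MeasurePreserving ε := by
    have := measurePreserving_exchange (n := n) (e := e) c.l j
    rwa [← coe_exchangeEquiv] at this
  have hd : ∀ x ∈ E, HasFDerivWithinAt c.chart
      ((updateL (Sum.inl c.l) (fderiv ℂ (graphFun j g) x)).restrictScalars ℝ) E x :=
    fun x hx => (c.hasFDerivAt_chart hT hg (hE hx)).hasFDerivWithinAt
  have hinj : Set.InjOn c.chart E := c.chart.injOn.mono hE
  have hval : ∀ x ∈ E, |((updateL (Sum.inl c.l) (fderiv ℂ (graphFun j g) x)).restrictScalars ℝ).det|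
      • F (ε.symm (c.chart x)) = W x := by
    intro x hx
    have hex : exchange c.l j (ε.symm (c.chart x)) = c.chart x := by
      rw [← coe_exchangeEquiv]; exact ε.apply_symm_apply _
    rw [c.abs_det_chart hT hg (hE hx), Complex.real_smul]
    refine hFW _ _ ?_ ?_
    · rw [hex]; exact c.chart.map_source (hE hx)
    · rw [hex]; exact c.chart.left_inv (hE hx)
  have hcomp : (fun y => F (ε.symm y)) ∘ ε = F := by
    funext p; simp
  have h1 : IntegrableOn (fun y => F (ε.symm y)) (c.chart '' E) := by
    rw [integrableOn_image_iff_integrableOn_abs_det_fderiv_smul volume hEm hd hinj]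
    exact hW.congr_fun (fun x hx => (hval x hx).symm) hEm
  refine ⟨?_, ?_, ?_⟩
  · rw [c.domain_eq hE, ← hcomp]
    exact (hmp.integrableOn_comp_preimage ε.measurableEmbedding).mpr h1
  · rw [c.domain_eq hE]
    have := hmp.setIntegral_preimage_emb ε.measurableEmbedding (fun y => F (ε.symm y))
      (c.chart '' E)
    simp only [MeasurableEquiv.symm_apply_apply] at this
    rw [this, integral_image_eq_integral_abs_det_fderiv_smul volume hEm hd hinj]
    exact setIntegral_congr_fun hEm hval
  · rw [c.domain_eq hE]
    have := hmp.setLIntegral_comp_preimage_emb ε.measurableEmbedding (fun y => ‖F (ε.symm y)‖ₑ)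
      (c.chart '' E)
    simp only [MeasurableEquiv.symm_apply_apply] at this
    rw [this, lintegral_image_eq_lintegral_abs_det_fderiv_mul volume hEm hd hinj]
    refine setLIntegral_congr_fun hEm fun x hx => ?_
    rw [← hval x hx, enorm_smul, Real.enorm_of_nonneg (abs_nonneg _)]

end GraphChart

end Graph

end RandomZeros

end

noncomputable section

namespace RandomZeros

/-! ### The Gaussian average on one coordinate patch. -/

section Patch

variable {n e : ℕ} {j : Fin (e + 1)} {g : (Fin (n + 1) → ℂ) → (Fin (e + 1) → ℂ)}
  {T : Set (Fin (n + 1) → ℂ)} {ϕ : (Fin (n + 1) → ℂ) → Alt (n + 1) (2 * n)}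

theorem hermForm_zero_left {k : ℕ} (l : (Fin k → ℂ) →L[ℂ] ℂ) : hermForm 0 l = 0 := by
  ext v
  simp [hermForm_apply]

theorem hermForm_zero_right {k : ℕ} (l : (Fin k → ℂ) →L[ℂ] ℂ) : hermForm l 0 = 0 := by
  ext v
  simp [hermForm_apply]

/-- The `k`-th non-trivial component of the derivative of `g`. -/
def dcomp (j : Fin (e + 1)) (g : (Fin (n + 1) → ℂ) → (Fin (e + 1) → ℂ)) (z : Fin (n + 1) → ℂ)
    (k : Fin e) : (Fin (n + 1) → ℂ) →L[ℂ] ℂ :=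
  (ContinuousLinearMap.proj (j.succAbove k)).comp (fderiv ℂ g z)

theorem hermForm_slope (x : Fin (n + 1) ⊕ Fin e → ℂ) :
    hermForm (slope j g x) (slope j g x) = ∑ k, ∑ l, (x (Sum.inr k) * (starRingEnd ℂ) (x (Sum.inr l)))
      • hermForm (dcomp j g (fun i => x (Sum.inl i)) k) (dcomp j g (fun i => x (Sum.inl i)) l) := by
  ext v
  have hs : ∀ u, slope j g x u = -∑ k, x (Sum.inr k) * dcomp j g (fun i => x (Sum.inl i)) k u := by
    intro u
    simp [slope, dcomp, sum_apply, smul_apply]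
  simp only [alt_sum_apply, alt_smul_apply, hermForm_apply, hs, map_neg, neg_mul_neg, map_sum,
    map_mul, Finset.sum_mul_sum]
  rw [← Finset.sum_sub_distrib]
  refine Finset.sum_congr rfl fun k _ => ?_
  rw [← Finset.sum_sub_distrib]
  refine Finset.sum_congr rfl fun l _ => ?_
  ring

/-- The coefficient of the top form `(i/2) dg_k ∧ dḡ_l ∧ ϕ`. -/
def mixedCoeff (j : Fin (e + 1)) (g : (Fin (n + 1) → ℂ) → (Fin (e + 1) → ℂ))
    (ϕ : (Fin (n + 1) → ℂ) → Alt (n + 1) (2 * n)) (k l : Fin e) (z : Fin (n + 1) → ℂ) : ℂ :=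
  wedge (by ring) ((Complex.I / 2) • hermForm (dcomp j g z k) (dcomp j g z l)) (ϕ z)
    (realBasis (n + 1))

theorem continuousOn_mixedCoeff (hT : IsOpen T) (hg : DifferentiableOn ℂ g T)
    (hϕ : ∀ v, ContinuousOn (fun z => ϕ z v) T) (k l : Fin e) :
    ContinuousOn (mixedCoeff j g ϕ k l) T := by
  have h1 : ∀ k v, ContinuousOn (fun z => dcomp j g z k v) T := fun k v =>
    (continuous_apply (j.succAbove k)).comp_continuousOn
      ((continuousOn_fderiv_of_differentiableOn hT hg).clm_apply continuousOn_const)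
  unfold mixedCoeff
  simp only [wedge_apply, alt_smul_apply, hermForm_apply]
  refine continuousOn_finsetSum _ fun σ _ => ?_
  refine continuousOn_const.mul (ContinuousOn.mul (continuousOn_const.mul ?_) (hϕ _))
  exact ((h1 _ _).mul (Complex.continuous_conj.comp_continuousOn (h1 _ _))).sub
    ((h1 _ _).mul (Complex.continuous_conj.comp_continuousOn (h1 _ _)))

/-- The Gaussian weight on the incidence variety. -/
def graphGauss (j : Fin (e + 1)) (g : (Fin (n + 1) → ℂ) → (Fin (e + 1) → ℂ))
    (x : Fin (n + 1) ⊕ Fin e → ℂ) : ℂ :=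
  ((Real.exp (-∑ k, ‖x (Sum.inr k)‖ ^ 2 - ‖graphFun j g x‖ ^ 2) : ℝ) : ℂ)

/-- The density on the incidence variety of the Gaussian average of the zero currents. -/
def graphDensity (j : Fin (e + 1)) (g : (Fin (n + 1) → ℂ) → (Fin (e + 1) → ℂ))
    (ϕ : (Fin (n + 1) → ℂ) → Alt (n + 1) (2 * n)) (x : Fin (n + 1) ⊕ Fin e → ℂ) : ℂ :=
  graphGauss j g x * wedge (by ring) ((Complex.I / 2) • hermForm (slope j g x) (slope j g x))
        (ϕ fun i => x (Sum.inl i)) (realBasis (n + 1))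

theorem graphDensity_eq (x : Fin (n + 1) ⊕ Fin e → ℂ) :
    graphDensity j g ϕ x = ∑ k, ∑ l, graphGauss j g x *
      (x (Sum.inr k) * (starRingEnd ℂ) (x (Sum.inr l))) *
        mixedCoeff j g ϕ k l (fun i => x (Sum.inl i)) := by
  simp only [graphDensity, mixedCoeff, hermForm_slope, wedge_smul_left, wedge_sum_left,
    alt_smul_apply, alt_sum_apply, Finset.mul_sum]
  refine Finset.sum_congr rfl fun k _ => Finset.sum_congr rfl fun l _ => ?_
  ring

/-- Points with zero slope lie in no chart of the incidence variety; this shows that leaving them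
out costs nothing. -/
theorem graphDensity_eq_zero {x : Fin (n + 1) ⊕ Fin e → ℂ} (hx : slope j g x = 0) :
    graphDensity j g ϕ x = 0 := by
  rw [graphDensity, hx, hermForm_zero_left, smul_zero, wedge_zero_left]
  simp

theorem graphFun_elim (z : Fin (n + 1) → ℂ) (a : Fin e → ℂ) :
    graphFun j g (Sum.elim z a) = -hdot a fun k => (starRingEnd ℂ) (g z (j.succAbove k)) := by
  simp [graphFun, hdot]

/-- The Gaussian second moments on the hyperplane `∑ k, a_k g_k(z) = 0`. -/
def graphMoment (j : Fin (e + 1)) (w : Fin (e + 1) → ℂ) (k l : Fin e) : ℂ :=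
  (Real.pi : ℂ) ^ e * ((if k = l then 1 else 0) / ((1 + ∑ k, ‖w (j.succAbove k)‖ ^ 2 : ℝ) : ℂ) -
    (starRingEnd ℂ) (w (j.succAbove k)) * w (j.succAbove l) /
      ((1 + ∑ k, ‖w (j.succAbove k)‖ ^ 2 : ℝ) : ℂ) ^ 2)

theorem integral_graphGauss (z : Fin (n + 1) → ℂ) (k l : Fin e) :
    ∫ a : Fin e → ℂ, graphGauss j g (Sum.elim z a) * (a k * (starRingEnd ℂ) (a l)) =
      graphMoment j (g z) k l := by
  have h := integral_gauss_graph (γ := fun k => (starRingEnd ℂ) (g z (j.succAbove k))) k l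
  simp only [graphGauss, graphFun_elim, norm_neg, Sum.elim_inr, graphMoment]
  rw [h]
  simp

theorem norm_graphGauss_le (z : Fin (n + 1) → ℂ) (a : Fin e → ℂ) :
    ‖graphGauss j g (Sum.elim z a)‖ ≤ ‖gauss a‖ := by
  simp only [graphGauss, gauss, Complex.norm_real, Real.norm_eq_abs, Real.abs_exp, Sum.elim_inr]
  refine Real.exp_le_exp.mpr ?_
  have := sq_nonneg ‖graphFun j g (Sum.elim z a)‖
  linarith

theorem continuous_elim : Continuous fun p : (Fin (n + 1) → ℂ) × (Fin e → ℂ) =>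
    (Sum.elim p.1 p.2 : Fin (n + 1) ⊕ Fin e → ℂ) := by
  refine continuous_pi ?_
  rintro (i | i)
  · simp only [Sum.elim_inl]; fun_prop
  · simp only [Sum.elim_inr]; fun_prop

/-- The graph weight is at most the standard Gaussian in `a'`, and `u` is bounded on the compact set
`C`, so the integrand is dominated by a constant times a Gaussian moment. -/
theorem integrableOn_term (hT : IsOpen T) (hg : DifferentiableOn ℂ g T)
    {C K : Set (Fin (n + 1) → ℂ)} (hC : IsCompact C) (hCT : C ⊆ T) (hKC : K ⊆ C)
    (hK : MeasurableSet K) {u : (Fin (n + 1) → ℂ) → ℂ} (hu : ContinuousOn u T) (k l : Fin e) :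
    IntegrableOn (fun p : (Fin (n + 1) → ℂ) × (Fin e → ℂ) => graphGauss j g (Sum.elim p.1 p.2) *
      (p.2 k * (starRingEnd ℂ) (p.2 l)) * u p.1) (K ×ˢ Set.univ) := by
  have hKT := hKC.trans hCT
  obtain ⟨B, hB⟩ := hC.exists_bound_of_continuousOn (hu.mono hCT)
  have hKfin : volume K ≠ ⊤ := ne_top_of_le_ne_top hC.measure_lt_top.ne (measure_mono hKC)
  have hbase : Integrable (fun p : (Fin (n + 1) → ℂ) × (Fin e → ℂ) =>
      (B : ℂ) * (gauss p.2 * (p.2 k * (starRingEnd ℂ) (p.2 l))))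
      ((volume.restrict K).prod volume) := by
    have : IsFiniteMeasure (volume.restrict K) := ⟨by simpa using hKfin.lt_top⟩
    exact (integrable_const (B : ℂ)).mul_prod (integrable_gauss_mul k l)
  have hμ : (volume : Measure ((Fin (n + 1) → ℂ) × (Fin e → ℂ))).restrict (K ×ˢ Set.univ) =
      (volume.restrict K).prod volume := by
    rw [Measure.volume_eq_prod, ← Measure.prod_restrict, Measure.restrict_univ]
  have hcont : ContinuousOn (fun p : (Fin (n + 1) → ℂ) × (Fin e → ℂ) =>
      graphGauss j g (Sum.elim p.1 p.2) *
      (p.2 k * (starRingEnd ℂ) (p.2 l)) * u p.1) (T ×ˢ Set.univ) := by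
    have h1 : ContinuousOn (fun p : (Fin (n + 1) → ℂ) × (Fin e → ℂ) =>
        graphFun j g (Sum.elim p.1 p.2)) (T ×ˢ Set.univ) :=
      (differentiableOn_graphFun hg).continuousOn.comp continuous_elim.continuousOn
        fun p hp => hp.1
    have h2 : ContinuousOn (fun p : (Fin (n + 1) → ℂ) × (Fin e → ℂ) => u p.1) (T ×ˢ Set.univ) :=
      hu.comp continuous_fst.continuousOn fun p hp => hp.1
    refine ContinuousOn.mul (ContinuousOn.mul ?_ (by fun_prop)) h2
    simp only [graphGauss, Sum.elim_inr]
    exact Complex.continuous_ofReal.comp_continuousOn (Real.continuous_exp.comp_continuousOn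
      (ContinuousOn.sub (by fun_prop) (h1.norm.pow 2)))
  rw [IntegrableOn, hμ]
  refine hbase.mono ?_ ?_
  · rw [← hμ]
    exact (hcont.aestronglyMeasurable (hT.measurableSet.prod MeasurableSet.univ)).mono_set
      (Set.prod_mono hKT subset_rfl)
  · rw [← hμ]
    refine (ae_restrict_iff' (hK.prod MeasurableSet.univ)).mpr (Filter.Eventually.of_forall ?_)
    intro p hp
    have h1 := norm_graphGauss_le (j := j) (g := g) p.1 p.2
    have h2 := hB p.1 (hKC hp.1)
    have hB0 : 0 ≤ B := (norm_nonneg _).trans h2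
    rw [norm_mul, norm_mul, norm_mul, norm_mul, Complex.norm_real, Real.norm_of_nonneg hB0, mul_comm B]
    rw [norm_mul (gauss p.2), norm_mul (p.2 k)]
    gcongr

theorem setIntegral_term (hT : IsOpen T) (hg : DifferentiableOn ℂ g T)
    {C K : Set (Fin (n + 1) → ℂ)} (hC : IsCompact C) (hCT : C ⊆ T) (hKC : K ⊆ C)
    (hK : MeasurableSet K) {u : (Fin (n + 1) → ℂ) → ℂ} (hu : ContinuousOn u T) (k l : Fin e) :
    ∫ p in K ×ˢ (Set.univ : Set (Fin e → ℂ)), graphGauss j g (Sum.elim p.1 p.2) *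
      (p.2 k * (starRingEnd ℂ) (p.2 l)) * u p.1 = ∫ z in K, graphMoment j (g z) k l * u z ∧
    IntegrableOn (fun z => graphMoment j (g z) k l * u z) K := by
  have hint := integrableOn_term (j := j) hT hg hC hCT hKC hK hu k l
  have hμ : (volume : Measure ((Fin (n + 1) → ℂ) × (Fin e → ℂ))).restrict (K ×ˢ Set.univ) =
      (volume.restrict K).prod volume := by
    rw [Measure.volume_eq_prod, ← Measure.prod_restrict, Measure.restrict_univ]
  rw [IntegrableOn, hμ] at hint
  have h := hint.integral_prod_left
  simp only [integral_mul_const, integral_graphGauss] at h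
  refine ⟨?_, h⟩
  rw [hμ, integral_prod _ hint]
  simp only [integral_mul_const, integral_graphGauss]

/-- The coefficient of the top form `g^*ω_FS ∧ ϕ`. -/
def fsCoeff (g : (Fin (n + 1) → ℂ) → (Fin (e + 1) → ℂ))
    (ϕ : (Fin (n + 1) → ℂ) → Alt (n + 1) (2 * n)) (z : Fin (n + 1) → ℂ) : ℂ :=
  wedge (by ring) ((fubiniStudy (e + 1) (g z)).compLinearMap (realLinear (fderiv ℂ g z))) (ϕ z)
    (realBasis (n + 1))

/-- Since `g_j = 1`, its differential vanishes and the terms with index `j` drop out of the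
Fubini–Study form. The others carry the Gaussian moments divided by `π ^ e`; the extra factor `π` is
the ratio of `i / 2` to `i / (2π)`. -/
theorem fsCoeff_eq (hT : IsOpen T) (hg : DifferentiableOn ℂ g T) (hgj : ∀ z ∈ T, g z j = 1)
    {z : Fin (n + 1) → ℂ} (hz : z ∈ T) :
    (Real.pi : ℂ) ^ (e + 1) * fsCoeff g ϕ z =
      ∑ k, ∑ l, graphMoment j (g z) k l * mixedCoeff j g ϕ k l z := by
  have hdj : (ContinuousLinearMap.proj j).comp (fderiv ℂ g z) = 0 := by
    have h1 := hasFDerivAt_pi'.mp (hg.differentiableAt (hT.mem_nhds hz)).hasFDerivAt j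
    have h2 : (fun z => g z j) =ᶠ[𝓝 z] fun _ => 1 := by
      filter_upwards [hT.mem_nhds hz] with y hy using hgj y hy
    exact (h1.congr_of_eventuallyEq h2.symm).unique (hasFDerivAt_const 1 z)
  have hw : g z ≠ 0 := fun h0 => by simpa [h0] using hgj z hz
  have hdot1 : hdot (g z) (g z) = ((1 + ∑ k, ‖g z (j.succAbove k)‖ ^ 2 : ℝ) : ℂ) := by
    rw [hdot_self, Fin.sum_univ_succAbove _ j, hgj z hz]
    simp
  rw [fsCoeff, fubiniStudy_comp _ hw, Fin.sum_univ_succAbove _ j]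
  simp only [Fin.sum_univ_succAbove (fun l : Fin (e + 1) => _ • hermForm _ _) j, hdj,
    hermForm_zero_left, hermForm_zero_right, smul_zero, Finset.sum_const_zero, zero_add,
    wedge_sum_left, wedge_smul_left, alt_sum_apply, alt_smul_apply, Finset.mul_sum]
  refine Finset.sum_congr rfl fun k _ => Finset.sum_congr rfl fun l _ => ?_
  simp only [mixedCoeff, graphMoment, wedge_smul_left, alt_smul_apply, dcomp, hdot1,
    Fin.succAbove_right_inj]
  have hpi : (Real.pi : ℂ) ≠ 0 := by exact_mod_cast Real.pi_ne_zero
  field_simp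
  ring

/-- By Fubini the integral over `a'` is done first. It replaces each product `a_k ā_l` by its
Gaussian moment, and the sum over `k, l` reassembles the Fubini–Study form. -/
theorem integral_graphDensity (hT : IsOpen T) (hg : DifferentiableOn ℂ g T)
    (hgj : ∀ z ∈ T, g z j = 1) (hϕ : ∀ v, ContinuousOn (fun z => ϕ z v) T)
    {C K : Set (Fin (n + 1) → ℂ)} (hC : IsCompact C) (hCT : C ⊆ T) (hKC : K ⊆ C)
    (hK : MeasurableSet K) :
    IntegrableOn (graphDensity j g ϕ) {x | (fun i => x (Sum.inl i)) ∈ K} ∧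
    IntegrableOn (fsCoeff g ϕ) K ∧
    ∫ x in {x | (fun i => x (Sum.inl i)) ∈ K}, graphDensity j g ϕ x =
      (Real.pi : ℂ) ^ (e + 1) * ∫ z in K, fsCoeff g ϕ z := by
  have hpi : (Real.pi : ℂ) ≠ 0 := by exact_mod_cast Real.pi_ne_zero
  set ε := MeasurableEquiv.sumPiEquivProdPi (fun _ : Fin (n + 1) ⊕ Fin e => ℂ)
  have hmp : MeasurePreserving ε := volume_measurePreserving_sumPiEquivProdPi _
  let F : (Fin (n + 1) → ℂ) × (Fin e → ℂ) → ℂ := fun p =>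
    ∑ k, ∑ l, graphGauss j g (Sum.elim p.1 p.2) * (p.2 k * (starRingEnd ℂ) (p.2 l)) *
      mixedCoeff j g ϕ k l p.1
  have hF : graphDensity j g ϕ = F ∘ ε := by
    funext x
    rw [graphDensity_eq]
    have hx : x = Sum.elim (fun i => x (Sum.inl i)) fun k => x (Sum.inr k) := by
      ext (i | i) <;> rfl
    simp only [Function.comp_apply, F]
    have e1 : (ε x).1 = fun i => x (Sum.inl i) := rfl
    have e2 : (ε x).2 = fun i => x (Sum.inr i) := rfl
    rw [e1, e2, ← hx]
  have hset : {x : Fin (n + 1) ⊕ Fin e → ℂ | (fun i => x (Sum.inl i)) ∈ K} =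
      ε ⁻¹' (K ×ˢ Set.univ) := by
    ext x
    simp only [Set.mem_preimage, Set.mem_prod, Set.mem_univ, and_true]
    rfl
  have hterm := fun k l => integrableOn_term (j := j) hT hg hC hCT hKC hK
    (continuousOn_mixedCoeff (j := j) hT hg hϕ k l) k l
  have hterm2 := fun k l => setIntegral_term (j := j) hT hg hC hCT hKC hK
    (continuousOn_mixedCoeff (j := j) hT hg hϕ k l) k l
  have hFint : IntegrableOn F (K ×ˢ Set.univ) :=
    integrable_finsetSum _ fun k _ => integrable_finsetSum _ fun l _ => hterm k l
  have hfs : Set.EqOn (fun z => (Real.pi : ℂ) ^ (e + 1) * fsCoeff g ϕ z)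
      (fun z => ∑ k, ∑ l, graphMoment j (g z) k l * mixedCoeff j g ϕ k l z) K :=
    fun z hz => fsCoeff_eq hT hg hgj (hCT (hKC hz))
  have hint2 : IntegrableOn
      (fun z => ∑ k, ∑ l, graphMoment j (g z) k l * mixedCoeff j g ϕ k l z) K :=
    integrable_finsetSum _ fun k _ => integrable_finsetSum _ fun l _ => (hterm2 k l).2
  refine ⟨?_, ?_, ?_⟩
  · rw [hF, hset]
    exact (hmp.integrableOn_comp_preimage ε.measurableEmbedding).mpr hFint
  · have := (hint2.congr_fun hfs.symm hK).const_mul ((Real.pi : ℂ) ^ (e + 1))⁻¹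
    refine this.congr (Filter.Eventually.of_forall fun z => ?_)
    field_simp
  · rw [hF, hset, ← integral_const_mul]
    have := hmp.setIntegral_preimage_emb ε.measurableEmbedding F (K ×ˢ Set.univ)
    simp only [Function.comp_apply]
    rw [this, setIntegral_congr_fun hK hfs]
    simp only [F]
    rw [integral_finsetSum _ fun k _ => integrable_finsetSum _ fun l _ => hterm k l,
      integral_finsetSum _ fun k _ => integrable_finsetSum _ fun l _ => (hterm2 k l).2]
    refine Finset.sum_congr rfl fun k _ => ?_
    rw [integral_finsetSum _ fun l _ => hterm k l,
      integral_finsetSum _ fun l _ => (hterm2 k l).2]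
    exact Finset.sum_congr rfl fun l _ => (hterm2 k l).1

/-- The Gaussian average of the integrals of `ϕ` over the hypersurfaces `∑ k, a_k g_k = 0`, written
in the coordinates of a family of charts. -/
theorem patch_average (hT : IsOpen T) (hg : DifferentiableOn ℂ g T)
    (hgj : ∀ z ∈ T, g z j = 1) (hϕ : ∀ v, ContinuousOn (fun z => ϕ z v) T)
    {C K : Set (Fin (n + 1) → ℂ)} (hC : IsCompact C) (hCT : C ⊆ T) (hKC : K ⊆ C)
    (hK : MeasurableSet K) {ι : Type*} [Countable ι] (c : ι → GraphChart j g T)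
    (E : ι → Set (Fin (n + 1) ⊕ Fin e → ℂ)) (hEm : ∀ i, MeasurableSet (E i))
    (hEs : ∀ i, E i ⊆ (c i).chart.source) (hEd : Pairwise fun i i' => Disjoint (E i) (E i'))
    (hEU : ⋃ i, E i = {x | (fun i => x (Sum.inl i)) ∈ K ∧ slope j g x ≠ 0}) :
    (∀ i, IntegrableOn (fun p => gauss p.2 * (c i).pull ϕ p) ((c i).domain (E i))) ∧
    ∑' i, ∫⁻ p in (c i).domain (E i), ‖gauss p.2 * (c i).pull ϕ p‖ₑ ≠ ⊤ ∧
    HasSum (fun i => ∫ p in (c i).domain (E i), gauss p.2 * (c i).pull ϕ p)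
      ((Real.pi : ℂ) ^ (e + 1) * ∫ z in K, fsCoeff g ϕ z) := by
  obtain ⟨hW, -, hWint⟩ := integral_graphDensity hT hg hgj hϕ hC hCT hKC hK
  have hsub : ⋃ i, E i ⊆ {x | (fun i => x (Sum.inl i)) ∈ K} := by
    rw [hEU]; exact fun x hx => hx.1
  have hFW : ∀ i, ∀ p x, exchange (c i).l j p ∈ (c i).chart.target →
      (c i).chart.symm (exchange (c i).l j p) = x →
      ((‖slope j g x (Pi.single (c i).l 1)‖ ^ 2 : ℝ) : ℂ) * (gauss p.2 * (c i).pull ϕ p) =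
        graphDensity j g ϕ x := by
    intro i p x hp hx
    -- On the incidence variety `a_j` is the value of the graph function, so the weight `exp
    -- (-|a|²)` is a function of `(z, a')`.
    have hgauss : gauss p.2 = graphGauss j g x := by
      obtain ⟨h1, h2, h3⟩ := (c i).symm_exchange hp
      rw [hx] at h1 h3
      rw [gauss, graphGauss, h3, Fin.sum_univ_succAbove _ j]
      have : ∀ k, x (Sum.inr k) = p.2 (j.succAbove k) := fun k => by rw [h1]; rfl
      simp only [this]
      ring_nf
    rw [graphDensity, ← (c i).pull_eq hT hg ϕ hp hx, hgauss]
    ring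
  have key := fun i => (c i).change_variables hT hg (hEs i) (hEm i) (hFW i)
    (hW.mono_set ((Set.subset_iUnion E i).trans hsub))
  refine ⟨fun i => (key i).1, ?_, ?_⟩
  · simp only [fun i => (key i).2.2]
    rw [← lintegral_iUnion hEm hEd]
    exact (hW.mono_set hsub).2.ne
  · simp only [fun i => (key i).2.1]
    have := hasSum_integral_iUnion hEm hEd (hW.mono_set hsub)
    rw [← hWint]
    -- The charts miss exactly the points over `K` with zero slope, where the density vanishes.
    have h0 := setIntegral_eq_of_subset_of_forall_sdiff_eq_zero (f := graphDensity j g ϕ)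
      (μ := volume) ?_ hsub ?_
    · rw [h0]; exact this
    · exact hK.preimage (by fun_prop)
    · intro x hx
      refine graphDensity_eq_zero (by_contra fun h => hx.2 ?_)
      rw [hEU]
      exact ⟨hx.1, h⟩

end Patch

end RandomZeros

end

noncomputable section

namespace RandomZeros

/-! ### Globalization: ratios of sections, patches, and decompositions of zero sets. -/

section Chart

variable {m : ℕ} {M : Type*} [TopologicalSpace M] [ChartedSpace (Fin m → ℂ) M]
  [IsManifold 𝓘(ℂ, Fin m → ℂ) ω M]

theorem mdifferentiableOn_chart {x : M} : MDifferentiableOn 𝓘(ℂ, Fin m → ℂ) 𝓘(ℂ, Fin m → ℂ)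
    (chartAt (Fin m → ℂ) x) (chartAt (Fin m → ℂ) x).source :=
  (contMDiffOn_chart (I := 𝓘(ℂ, Fin m → ℂ)) (n := ω)).mdifferentiableOn (by simp)

theorem mdifferentiableOn_chart_symm {x : M} : MDifferentiableOn 𝓘(ℂ, Fin m → ℂ) 𝓘(ℂ, Fin m → ℂ)
    (chartAt (Fin m → ℂ) x).symm (chartAt (Fin m → ℂ) x).target :=
  (contMDiffOn_chart_symm (I := 𝓘(ℂ, Fin m → ℂ)) (n := ω)).mdifferentiableOn (by simp)

end Chart

/-- The affine coordinate expressions `R j = (s₀/s_j, …, s_e/s_j)` of holomorphic sections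
`s₀, …, s_e` without common zeros of a line bundle, on the open sets `W j = {s_j ≠ 0}`. -/
structure RatioSystem (n e : ℕ) (M : Type*) [TopologicalSpace M]
    [ChartedSpace (Fin (n + 1) → ℂ) M] where
  W : Fin (e + 1) → Set M
  R : Fin (e + 1) → M → (Fin (e + 1) → ℂ)
  isOpen_W : ∀ j, IsOpen (W j)
  exists_mem_W : ∀ y, ∃ j, y ∈ W j
  mdiff : ∀ j, MDifferentiableOn 𝓘(ℂ, Fin (n + 1) → ℂ) 𝓘(ℂ, Fin (e + 1) → ℂ) (R j) (W j)
  R_self : ∀ j, ∀ y ∈ W j, R j y j = 1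
  transition : ∀ j j' y, y ∈ W j → y ∈ W j' → R j' y = R j' y j • R j y

namespace RatioSystem

variable {n e : ℕ} {M : Type*} [TopologicalSpace M] [ChartedSpace (Fin (n + 1) → ℂ) M]
  (Q : RatioSystem n e M)

/-- The affine expression of the section `∑ k, a_k s_k`. -/
def comb (a : Fin (e + 1) → ℂ) (j : Fin (e + 1)) (y : M) : ℂ := ∑ k, a k * Q.R j y k

/-- The zero set of the section `∑ k, a_k s_k`. -/
def zeros (a : Fin (e + 1) → ℂ) : Set M := {y | ∀ j, y ∈ Q.W j → Q.comb a j y = 0}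

theorem mem_zeros_iff (a : Fin (e + 1) → ℂ) {j : Fin (e + 1)} {y : M} (hy : y ∈ Q.W j) :
    y ∈ Q.zeros a ↔ Q.comb a j y = 0 := by
  refine ⟨fun h => h j hy, fun h j' hy' => ?_⟩
  have : Q.comb a j' y = Q.R j' y j * Q.comb a j y := by
    simp only [comb, Finset.mul_sum]
    refine Finset.sum_congr rfl fun k _ => ?_
    conv_lhs => rw [Q.transition j j' y hy hy']
    simp only [Pi.smul_apply, smul_eq_mul]
    ring
  rw [this, h, mul_zero]

/-- The domain in `ℂⁿ⁺¹` of the `j`-th affine expression in the chart at `x`. -/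
def T (x : M) (j : Fin (e + 1)) : Set (Fin (n + 1) → ℂ) :=
  (chartAt (Fin (n + 1) → ℂ) x).target ∩ (chartAt (Fin (n + 1) → ℂ) x).symm ⁻¹' Q.W j

/-- The `j`-th affine expression in the chart at `x`. -/
def G (x : M) (j : Fin (e + 1)) (z : Fin (n + 1) → ℂ) : Fin (e + 1) → ℂ :=
  Q.R j ((chartAt (Fin (n + 1) → ℂ) x).symm z)

theorem isOpen_T (x : M) (j : Fin (e + 1)) : IsOpen (Q.T x j) :=
  (chartAt (Fin (n + 1) → ℂ) x).isOpen_inter_preimage_symm (Q.isOpen_W j)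

theorem G_self {x : M} {j : Fin (e + 1)} : ∀ z ∈ Q.T x j, Q.G x j z j = 1 := fun _ hz =>
  Q.R_self j _ hz.2

theorem differentiableOn_G [IsManifold 𝓘(ℂ, Fin (n + 1) → ℂ) ω M] (x : M) (j : Fin (e + 1)) :
    DifferentiableOn ℂ (Q.G x j) (Q.T x j) := by
  rw [← mdifferentiableOn_iff_differentiableOn]
  exact (Q.mdiff j).comp (mdifferentiableOn_chart_symm.mono
    Set.inter_subset_left) fun z hz => hz.2

/-- Since the `j`-th ratio is 1, the equation of the zero set can be solved for `a_j`. -/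
theorem graphFun_G_eq (a : Fin (e + 1) → ℂ) {x : M} {j : Fin (e + 1)} {z : Fin (n + 1) → ℂ}
    (hz : z ∈ Q.T x j) :
    graphFun j (Q.G x j) (Sum.elim z (j.removeNth a)) = a j ↔
      (chartAt (Fin (n + 1) → ℂ) x).symm z ∈ Q.zeros a := by
  rw [Q.mem_zeros_iff a hz.2, comb, Fin.sum_univ_succAbove _ j, Q.R_self j _ hz.2]
  simp only [graphFun, Sum.elim_inr, Sum.elim_inl, Fin.removeNth, G, mul_one]
  rw [neg_eq_iff_add_eq_zero, add_comm]

/-- A finite family of coordinate patches subordinate to the sets `W j`, with a partition of the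
manifold into measurable pieces of the patches. -/
structure PatchFamily [MeasurableSpace M] (κ : Type*) where
  x : κ → M
  j : κ → Fin (e + 1)
  N : κ → Set M
  P : κ → Set M
  isCompact_N : ∀ q, IsCompact (N q)
  N_subset : ∀ q, N q ⊆ (chartAt (Fin (n + 1) → ℂ) (x q)).source ∩ Q.W (j q)
  P_subset : ∀ q, P q ⊆ N q
  measurableSet_P : ∀ q, MeasurableSet (P q)
  disjoint_P : Pairwise fun q q' => Disjoint (P q) (P q')
  iUnion_P : ⋃ q, P q = Set.univ

theorem exists_patchFamily [T2Space M] [CompactSpace M] [MeasurableSpace M] [BorelSpace M] :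
    ∃ t : Finset M, Nonempty (Q.PatchFamily t) := by
  have key : ∀ x : M, ∃ (j : Fin (e + 1)) (N : Set M), N ∈ 𝓝 x ∧ IsCompact N ∧
      N ⊆ (chartAt (Fin (n + 1) → ℂ) x).source ∩ Q.W j := by
    intro x
    obtain ⟨j, hj⟩ := Q.exists_mem_W x
    obtain ⟨N, hN, hsub, hc⟩ := local_compact_nhds
      (((chartAt (Fin (n + 1) → ℂ) x).open_source.inter (Q.isOpen_W j)).mem_nhds
        ⟨mem_chart_source _ x, hj⟩)
    exact ⟨j, N, hN, hc, hsub⟩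
  choose j N hN hc hsub using key
  obtain ⟨t, -, ht⟩ := isCompact_univ.elim_nhds_subcover N fun x _ => hN x
  obtain ⟨P, hPm, hPs, hPd, hPU⟩ := exists_disjoint_refinement (fun q : t => N q)
    fun q => (hc q).isClosed.measurableSet
  refine ⟨t, ⟨⟨fun q => q, fun q => j q, fun q => N q, P, fun q => hc q, fun q => hsub q, hPs, hPm,
    hPd, ?_⟩⟩⟩
  rw [hPU, Set.eq_univ_iff_forall]
  intro y
  obtain ⟨q, hq, hy⟩ := Set.mem_iUnion₂.mp (ht (Set.mem_univ y))
  exact Set.mem_iUnion.mpr ⟨⟨q, hq⟩, hy⟩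

namespace PatchFamily

variable {Q} [MeasurableSpace M] {κ : Type*} (F : Q.PatchFamily κ)

/-- The chart of a patch. -/
abbrev χ (q : κ) : OpenPartialHomeomorph M (Fin (n + 1) → ℂ) := chartAt (Fin (n + 1) → ℂ) (F.x q)

/-- The compact image of a patch in its chart. -/
def C (q : κ) : Set (Fin (n + 1) → ℂ) := F.χ q '' F.N q

/-- The image in the chart of the piece of a patch. -/
def K (q : κ) : Set (Fin (n + 1) → ℂ) := F.χ q '' F.P q

theorem isCompact_C (q : κ) : IsCompact (F.C q) :=
  (F.isCompact_N q).image_of_continuousOn ((F.χ q).continuousOn.mono fun _ hy => (F.N_subset q hy).1)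

theorem C_subset (q : κ) : F.C q ⊆ Q.T (F.x q) (F.j q) := by
  rintro _ ⟨y, hy, rfl⟩
  have h := F.N_subset q hy
  refine ⟨(F.χ q).map_source h.1, ?_⟩
  rw [Set.mem_preimage, (F.χ q).left_inv h.1]
  exact h.2

theorem K_subset (q : κ) : F.K q ⊆ F.C q := Set.image_mono (F.P_subset q)

theorem P_source {q : κ} {y : M} (hy : y ∈ F.P q) : y ∈ (F.χ q).source :=
  (F.N_subset q (F.P_subset q hy)).1

theorem K_eq (q : κ) : F.K q = (F.χ q).target ∩ (F.χ q).symm ⁻¹' F.P q :=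
  (F.χ q).image_eq_target_inter_inv_preimage fun _ hy => F.P_source hy

theorem mem_K_iff {q : κ} {y : M} (hy : y ∈ (F.χ q).source) : F.χ q y ∈ F.K q ↔ y ∈ F.P q := by
  rw [F.K_eq]
  simp [(F.χ q).map_source hy, (F.χ q).left_inv hy]

theorem measurableSet_K [BorelSpace M] (q : κ) : MeasurableSet (F.K q) := by
  rw [F.K_eq]
  exact measurableSet_inter_preimage (F.χ q).open_target (F.χ q).continuousOn_symm
    (F.measurableSet_P q)

/-- The charts of the patches as a decomposition of the whole manifold. -/
def univSystem [IsManifold 𝓘(ℂ, Fin (n + 1) → ℂ) ω M] :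
    RefSystem (n + 1) (n + 1) (Set.univ : Set M) κ where
  V q := (F.χ q).source
  E := F.P
  r q := F.χ q
  U q := (F.χ q).target
  g q := (F.χ q).symm
  isOpen_V q := (F.χ q).open_source
  measurable_E := F.measurableSet_P
  E_subset _ _ hy := F.P_source hy
  isOpen_U q := (F.χ q).open_target
  mdiff_r _ := mdifferentiableOn_chart
  mdiff_g _ := mdifferentiableOn_chart_symm
  r_mem q _ hy _ := (F.χ q).map_source hy
  g_r q _ hy _ := (F.χ q).left_inv hy
  g_mem _ _ _ := Set.mem_univ _
  g_mem_V q _ hz := (F.χ q).map_target hz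
  r_g q _ hz := (F.χ q).right_inv hz
  disjoint := F.disjoint_P
  covers := F.iUnion_P.ge

theorem univSystem_A [IsManifold 𝓘(ℂ, Fin (n + 1) → ℂ) ω M] (q : κ) : F.univSystem.A q = F.K q := by
  rw [F.K_eq]
  rfl

/-- Charts of the incidence variety over the pieces of the patches. -/
structure Charts (ι : κ → Type) where
  c : ∀ q, ι q → GraphChart (F.j q) (Q.G (F.x q) (F.j q)) (Q.T (F.x q) (F.j q))
  E : ∀ q, ι q → Set (Fin (n + 1) ⊕ Fin e → ℂ)
  measurableSet_E : ∀ q i, MeasurableSet (E q i)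
  E_subset : ∀ q i, E q i ⊆ (c q i).chart.source
  disjoint_E : ∀ q, Pairwise fun i i' => Disjoint (E q i) (E q i')
  iUnion_E : ∀ q, ⋃ i, E q i =
    {x | (fun i => x (Sum.inl i)) ∈ F.K q ∧ slope (F.j q) (Q.G (F.x q) (F.j q)) x ≠ 0}

theorem exists_charts [BorelSpace M] [IsManifold 𝓘(ℂ, Fin (n + 1) → ℂ) ω M] :
    ∃ ι : κ → Type, (∀ q, Countable (ι q)) ∧ Nonempty (F.Charts ι) := by
  have key : ∀ q, ∃ (ι : Type) (_ : Countable ι)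
      (c : ι → GraphChart (F.j q) (Q.G (F.x q) (F.j q)) (Q.T (F.x q) (F.j q)))
      (E : ι → Set (Fin (n + 1) ⊕ Fin e → ℂ)), (∀ i, MeasurableSet (E i)) ∧
      (∀ i, E i ⊆ (c i).chart.source) ∧ (Pairwise fun i i' => Disjoint (E i) (E i')) ∧
      ⋃ i, E i = {x | (fun i => x (Sum.inl i)) ∈ F.K q ∧
        slope (F.j q) (Q.G (F.x q) (F.j q)) x ≠ 0} := by
    intro q
    obtain ⟨ι, hι, c, hc⟩ := exists_graphCharts (Q.isOpen_T (F.x q) (F.j q))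
      (Q.differentiableOn_G (F.x q) (F.j q)) (j := F.j q)
    obtain ⟨E, hEm, hEs, hEd, hEU⟩ := exists_disjoint_refinement
      (fun i => (c i).chart.source ∩ {x | (fun i => x (Sum.inl i)) ∈ F.K q})
      fun i => (c i).chart.open_source.measurableSet.inter
        ((F.measurableSet_K q).preimage (by fun_prop))
    refine ⟨ι, hι, c, E, hEm, fun i => (hEs i).trans Set.inter_subset_left, hEd, ?_⟩
    rw [hEU, ← Set.iUnion_inter, hc]
    ext x
    simp only [Set.mem_inter_iff, Set.mem_ofPred_eq]
    exact ⟨fun h => ⟨h.2, h.1.2⟩, fun h => ⟨⟨F.C_subset q (F.K_subset q h.1), h.2⟩, h.1⟩⟩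
  choose ι hι c E h1 h2 h3 h4 using key
  exact ⟨ι, hι, ⟨⟨c, E, h1, h2, h3, h4⟩⟩⟩

/-- The section with coefficients `a` has no critical zero, in the coordinates of the patches. -/
def Good (a : Fin (e + 1) → ℂ) : Prop :=
  ∀ q, ∀ y ∈ F.N q, y ∈ Q.zeros a → slope (F.j q) (Q.G (F.x q) (F.j q))
    (Sum.elim (F.χ q y) ((F.j q).removeNth a)) ≠ 0

namespace Charts

variable {F} {ι : κ → Type} (H : F.Charts ι)

theorem E_K {q : κ} {i : ι q} {x : Fin (n + 1) ⊕ Fin e → ℂ} (hx : x ∈ H.E q i) :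
    (fun i => x (Sum.inl i)) ∈ F.K q := by
  have h : x ∈ ⋃ i, H.E q i := Set.mem_iUnion.mpr ⟨i, hx⟩
  rw [H.iUnion_E] at h
  exact h.1

theorem point_mem {a : Fin (e + 1) → ℂ} {q : κ} {i : ι q} {w : Fin n → ℂ}
    (hw : exchange (H.c q i).l (F.j q) (w, a) ∈ (H.c q i).chart.target) :
    (H.c q i).point (w, a) ∈ Q.T (F.x q) (F.j q) :=
  (H.c q i).source_subset _ ((H.c q i).chart.map_target hw)

/-- The charts of the incidence variety as a decomposition of the zero set of a section. -/
def zeroSystem [BorelSpace M] [IsManifold 𝓘(ℂ, Fin (n + 1) → ℂ) ω M] (a : Fin (e + 1) → ℂ)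
    (ha : F.Good a) :
    RefSystem (n + 1) n (Q.zeros a) (Σ q, ι q) where
  V s := ((F.χ s.1).source ∩ Q.W (F.j s.1)) ∩
    (fun y => Sum.elim (F.χ s.1 y) ((F.j s.1).removeNth a)) ⁻¹' (H.c s.1 s.2).chart.source
  E s := F.P s.1 ∩ ((F.χ s.1).source ∩
    (fun y => Sum.elim (F.χ s.1 y) ((F.j s.1).removeNth a)) ⁻¹' H.E s.1 s.2)
  r s y := (H.c s.1 s.2).l.removeNth (F.χ s.1 y)
  U s := {w | exchange (H.c s.1 s.2).l (F.j s.1) (w, a) ∈ (H.c s.1 s.2).chart.target}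
  g s w := (F.χ s.1).symm ((H.c s.1 s.2).point (w, a))
  isOpen_V s := by
    refine ContinuousOn.isOpen_inter_preimage ?_
      ((F.χ s.1).open_source.inter (Q.isOpen_W _)) (H.c s.1 s.2).chart.open_source
    refine continuous_elim.comp_continuousOn
      (ContinuousOn.prodMk ((F.χ s.1).continuousOn.mono Set.inter_subset_left) continuousOn_const)
  measurable_E s := by
    refine (F.measurableSet_P s.1).inter (measurableSet_inter_preimage (F.χ s.1).open_source ?_
      (H.measurableSet_E s.1 s.2))
    exact continuous_elim.comp_continuousOn
      (ContinuousOn.prodMk (F.χ s.1).continuousOn continuousOn_const)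
  E_subset s y hy := ⟨F.N_subset _ (F.P_subset _ hy.1), H.E_subset _ _ hy.2.2⟩
  isOpen_U s := (H.c s.1 s.2).isOpen_slice a
  mdiff_r s := by
    have h1 : MDifferentiableOn 𝓘(ℂ, Fin (n + 1) → ℂ) 𝓘(ℂ, Fin (n + 1) → ℂ) (F.χ s.1)
      (F.χ s.1).source := mdifferentiableOn_chart
    have h2 : Differentiable ℂ fun z : Fin (n + 1) → ℂ => (H.c s.1 s.2).l.removeNth z := by
      unfold Fin.removeNth
      fun_prop
    exact h2.mdifferentiable.comp_mdifferentiableOn (h1.mono fun y hy => hy.1.1)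
  mdiff_g s := by
    have h1 : MDifferentiableOn 𝓘(ℂ, Fin (n + 1) → ℂ) 𝓘(ℂ, Fin (n + 1) → ℂ) (F.χ s.1).symm
      (F.χ s.1).target := mdifferentiableOn_chart_symm
    exact h1.comp ((H.c s.1 s.2).differentiableOn_point a).mdifferentiableOn
      fun w hw => (H.point_mem hw).1
  r_mem s y hy hyS := by
    have hz : F.χ s.1 y ∈ Q.T (F.x s.1) (F.j s.1) :=
      ⟨(F.χ s.1).map_source hy.1.1, by rw [Set.mem_preimage, (F.χ s.1).left_inv hy.1.1]; exact hy.1.2⟩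
    have hG := (Q.graphFun_G_eq a hz).mpr (by rwa [(F.χ s.1).left_inv hy.1.1])
    rw [Set.mem_ofPred_eq, ← (H.c s.1 s.2).exchange_eq hG]
    exact (H.c s.1 s.2).chart.map_source hy.2
  g_r s y hy hyS := by
    have hz : F.χ s.1 y ∈ Q.T (F.x s.1) (F.j s.1) :=
      ⟨(F.χ s.1).map_source hy.1.1, by rw [Set.mem_preimage, (F.χ s.1).left_inv hy.1.1]; exact hy.1.2⟩
    have hG := (Q.graphFun_G_eq a hz).mpr (by rwa [(F.χ s.1).left_inv hy.1.1])
    have hp : (H.c s.1 s.2).point ((H.c s.1 s.2).l.removeNth (F.χ s.1 y), a) = F.χ s.1 y := by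
      unfold GraphChart.point
      rw [← (H.c s.1 s.2).exchange_eq hG, (H.c s.1 s.2).chart.left_inv hy.2]
      rfl
    rw [hp, (F.χ s.1).left_inv hy.1.1]
  g_mem s w hw := by
    rw [← Q.graphFun_G_eq a (H.point_mem hw)]
    obtain ⟨h1, h2, h3⟩ := (H.c s.1 s.2).symm_exchange hw
    rwa [h1] at h3
  g_mem_V s w hw := by
    have hT := H.point_mem hw
    refine ⟨⟨(F.χ s.1).map_target hT.1, hT.2⟩, ?_⟩
    rw [Set.mem_preimage, (F.χ s.1).right_inv hT.1]
    obtain ⟨h1, h2, h3⟩ := (H.c s.1 s.2).symm_exchange hw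
    rw [← h1]
    exact (H.c s.1 s.2).chart.map_target hw
  r_g s w hw := by
    rw [(F.χ s.1).right_inv (H.point_mem hw).1]
    exact ((H.c s.1 s.2).symm_exchange hw).2.1
  disjoint := by
    rintro ⟨q, i⟩ ⟨q', i'⟩ hne
    by_cases hq : q = q'
    · subst hq
      have hi : i ≠ i' := fun h => hne (by rw [h])
      rw [Set.disjoint_left]
      exact fun y hy hy' => Set.disjoint_left.mp (H.disjoint_E q hi) hy.2.2 hy'.2.2
    · rw [Set.disjoint_left]
      exact fun y hy hy' => Set.disjoint_left.mp (F.disjoint_P hq) hy.1 hy'.1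
  covers y hy := by
    obtain ⟨q, hq⟩ := Set.mem_iUnion.mp (F.iUnion_P.ge (Set.mem_univ y))
    -- The absence of critical zeros is what places every zero in a chart of the incidence variety.
    have hx : Sum.elim (F.χ q y) ((F.j q).removeNth a) ∈ ⋃ i, H.E q i := by
      rw [H.iUnion_E]
      exact ⟨(F.mem_K_iff (F.P_source hq)).mpr hq, ha q y (F.P_subset q hq) hy⟩
    obtain ⟨i, hi⟩ := Set.mem_iUnion.mp hx
    exact Set.mem_iUnion.mpr ⟨⟨q, i⟩, hq, F.P_source hq, hi⟩

/-- The parameter domains for a fixed section are the slices of the chart domains, so Fubini in `(w,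
a)` speaks about integrals over zero sets. -/
theorem zeroSystem_A [BorelSpace M] [IsManifold 𝓘(ℂ, Fin (n + 1) → ℂ) ω M] (a : Fin (e + 1) → ℂ)
    (ha : F.Good a) (s : Σ q, ι q) :
    (H.zeroSystem a ha).A s = {w | (w, a) ∈ (H.c s.1 s.2).domain (H.E s.1 s.2)} := by
  ext w
  constructor
  · rintro ⟨hw, -, -, hE⟩
    refine ⟨hw, ?_⟩
    have hE' : Sum.elim (F.χ s.1 ((F.χ s.1).symm ((H.c s.1 s.2).point (w, a))))
      ((F.j s.1).removeNth a) ∈ H.E s.1 s.2 := hE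
    rw [(F.χ s.1).right_inv (H.point_mem hw).1] at hE'
    rwa [((H.c s.1 s.2).symm_exchange hw).1]
  · rintro ⟨hw, hE⟩
    have hT := H.point_mem hw
    have hK : (H.c s.1 s.2).point (w, a) ∈ F.K s.1 := H.E_K hE
    refine ⟨hw, ?_, (F.χ s.1).map_target hT.1, ?_⟩
    · rw [F.K_eq] at hK
      exact hK.2
    · change Sum.elim (F.χ s.1 ((F.χ s.1).symm ((H.c s.1 s.2).point (w, a))))
        ((F.j s.1).removeNth a) ∈ H.E s.1 s.2
      rw [(F.χ s.1).right_inv hT.1]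
      rwa [((H.c s.1 s.2).symm_exchange hw).1] at hE

theorem pullback_zeroSystem [BorelSpace M] [IsManifold 𝓘(ℂ, Fin (n + 1) → ℂ) ω M]
    (a : Fin (e + 1) → ℂ) (ha : F.Good a) (s : Σ q, ι q) (φ : Form (n + 1) M (2 * n))
    {w : Fin n → ℂ} (hw : w ∈ (H.zeroSystem a ha).U s) :
    pullback ((H.zeroSystem a ha).g s) φ w (realBasis n) =
      (H.c s.1 s.2).pull (pullback (F.χ s.1).symm φ) (w, a) := by
  have h1 : MDifferentiableOn 𝓘(ℂ, Fin (n + 1) → ℂ) 𝓘(ℂ, Fin (n + 1) → ℂ) (F.χ s.1).symm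
      (F.χ s.1).target := mdifferentiableOn_chart_symm
  rw [pullback_comp (g := (H.zeroSystem a ha).g s) (g' := (F.χ s.1).symm)
    (τ := fun w => (H.c s.1 s.2).point (w, a)) Filter.EventuallyEq.rfl
    (h1.mdifferentiableAt ((F.χ s.1).open_target.mem_nhds (H.point_mem hw).1))
    (((H.c s.1 s.2).differentiableOn_point a).differentiableAt
      (((H.c s.1 s.2).isOpen_slice a).mem_nhds hw))]
  rfl

end Charts

end PatchFamily

end RatioSystem

end RandomZeros

end

noncomputable section

namespace RandomZeros

/-! ### Almost every section has only simple zeros. -/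

section Sard

variable {n e : ℕ} {j : Fin (e + 1)} {g : (Fin (n + 1) → ℂ) → (Fin (e + 1) → ℂ)}
  {T : Set (Fin (n + 1) → ℂ)}

/-- The parameters `(a_j, a')` for which `∑ k, a_k g_k` has a critical zero in `C`. -/
def criticalParams (j : Fin (e + 1)) (g : (Fin (n + 1) → ℂ) → (Fin (e + 1) → ℂ))
    (C : Set (Fin (n + 1) → ℂ)) : Set (ℂ × (Fin e → ℂ)) :=
  {p | ∃ z ∈ C, graphFun j g (Sum.elim z p.2) = p.1 ∧ slope j g (Sum.elim z p.2) = 0}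

/-- The set is the projection of a closed set along the compact factor `C`. Closedness provides the
measurability needed to compute its measure by slices. -/
theorem isClosed_criticalParams (hT : IsOpen T) (hg : DifferentiableOn ℂ g T)
    {C : Set (Fin (n + 1) → ℂ)} (hC : IsCompact C) (hCT : C ⊆ T) :
    IsClosed (criticalParams j g C) := by
  have : CompactSpace C := isCompact_iff_compactSpace.mp hC
  have hcont : Continuous fun p : C × (ℂ × (Fin e → ℂ)) =>
      (Sum.elim p.1.1 p.2.2 : Fin (n + 1) ⊕ Fin e → ℂ) :=
    continuous_elim.comp (by fun_prop :
      Continuous fun p : C × (ℂ × (Fin e → ℂ)) => (p.1.1, p.2.2))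
  have h1 : Continuous fun p : C × (ℂ × (Fin e → ℂ)) => graphFun j g (Sum.elim p.1.1 p.2.2) :=
    (differentiableOn_graphFun hg).continuousOn.comp_continuous hcont fun p => hCT p.1.2
  have h2 : Continuous fun p : C × (ℂ × (Fin e → ℂ)) => slope j g (Sum.elim p.1.1 p.2.2) := by
    have h3 : Continuous fun p : C × (ℂ × (Fin e → ℂ)) => fderiv ℂ g p.1.1 :=
      (continuousOn_fderiv_of_differentiableOn hT hg).comp_continuous (by fun_prop)
        fun p => hCT p.1.2
    simp only [slope, Sum.elim_inr, Sum.elim_inl]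
    refine (continuous_finsetSum _ fun k _ => ?_).neg
    have h5 : Continuous fun p : C × (ℂ × (Fin e → ℂ)) => p.2.2 k := by fun_prop
    exact h5.smul (continuous_const.clm_comp h3)
  have h4 : criticalParams j g C = Prod.snd '' {p : C × (ℂ × (Fin e → ℂ)) |
      graphFun j g (Sum.elim p.1.1 p.2.2) = p.2.1 ∧ slope j g (Sum.elim p.1.1 p.2.2) = 0} := by
    ext p
    constructor
    · rintro ⟨z, hz, h⟩
      exact ⟨(⟨z, hz⟩, p), h, rfl⟩
    · rintro ⟨⟨z, p⟩, h, rfl⟩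
      exact ⟨z, z.2, h⟩
  rw [h4]
  exact isClosedMap_snd_of_compactSpace _
    ((isClosed_eq h1 (by fun_prop)).inter (isClosed_eq h2 continuous_const))

/-- For fixed `a'`, the parameters `a_j` giving a critical zero are critical values of one
holomorphic function of `z`, hence countable and of measure zero. -/
theorem volume_criticalParams (hT : IsOpen T) (hg : DifferentiableOn ℂ g T)
    {C : Set (Fin (n + 1) → ℂ)} (hC : IsCompact C) (hCT : C ⊆ T) :
    volume (criticalParams j g C) = 0 := by
  have hm := (isClosed_criticalParams (j := j) hT hg hC hCT).measurableSet
  have hsw : volume (criticalParams j g C) = volume (Prod.swap ⁻¹' criticalParams j g C) :=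
    (Measure.measurePreserving_swap.measure_preimage hm.nullMeasurableSet).symm
  rw [hsw, Measure.volume_eq_prod, Measure.measure_prod_null (measurable_swap hm)]
  refine Filter.Eventually.of_forall fun a => ?_
  have hcomb : DifferentiableOn ℂ (fun z => -∑ k, a k * g z (j.succAbove k)) T := by
    intro z hz
    exact (hasFDerivAt_linear_comb (j := j) (x := Sum.elim z a) hT hg hz).differentiableAt
      |>.differentiableWithinAt
  refine Set.Countable.measure_zero ((countable_critical_values _ hT hcomb).mono ?_) _
  rintro t ⟨z, hz, h1, h2⟩
  refine ⟨z, ⟨hCT hz, ?_⟩, h1⟩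
  have h := (hasFDerivAt_linear_comb (j := j) (x := Sum.elim z a) hT hg (hCT hz)).fderiv
  exact h.trans h2

theorem ae_noncritical (hT : IsOpen T) (hg : DifferentiableOn ℂ g T)
    {C : Set (Fin (n + 1) → ℂ)} (hC : IsCompact C) (hCT : C ⊆ T) :
    ∀ᵐ a : Fin (e + 1) → ℂ, ∀ z ∈ C, graphFun j g (Sum.elim z (j.removeNth a)) = a j →
      slope j g (Sum.elim z (j.removeNth a)) ≠ 0 := by
  have h1 : MeasurePreserving (MeasurableEquiv.piFinSuccAbove (fun _ : Fin (e + 1) => ℂ) j) :=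
    volume_preserving_piFinSuccAbove (fun _ : Fin (e + 1) => ℂ) j
  have h2 := h1.quasiMeasurePreserving.preimage_null
    (volume_criticalParams (j := j) hT hg hC hCT)
  rw [ae_iff]
  refine measure_mono_null (fun a ha => ?_) h2
  simp only [not_forall, not_not] at ha
  obtain ⟨z, hz, hG, hs⟩ := ha
  exact ⟨z, hz, hG, hs⟩

end Sard

/-! ### The Gaussian average on the whole manifold. -/

namespace RatioSystem

variable {n e : ℕ} {M : Type*} [TopologicalSpace M] [ChartedSpace (Fin (n + 1) → ℂ) M]
  {Q : RatioSystem n e M}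

theorem PatchFamily.ae_good [IsManifold 𝓘(ℂ, Fin (n + 1) → ℂ) ω M] [MeasurableSpace M] {κ : Type*} [Countable κ] (F : Q.PatchFamily κ) :
    ∀ᵐ a, F.Good a := by
  unfold Good
  rw [ae_all_iff]
  intro q
  filter_upwards [ae_noncritical (j := F.j q) (Q.isOpen_T (F.x q) (F.j q))
    (Q.differentiableOn_G (F.x q) (F.j q)) (F.isCompact_C q) (F.C_subset q)] with a ha y hy hya
  have hz : F.χ q y ∈ F.C q := ⟨y, hy, rfl⟩
  refine ha _ hz ?_
  rw [Q.graphFun_G_eq a (F.C_subset q hz), (F.χ q).left_inv (F.N_subset q hy).1]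
  exact hya

variable (Q) in
/-- The zeros of `∑ k, a_k s_k` are all simple. -/
def Regular (a : Fin (e + 1) → ℂ) : Prop :=
  ∀ y ∈ Q.zeros a, ∃ x j, y ∈ (chartAt (Fin (n + 1) → ℂ) x).source ∧ y ∈ Q.W j ∧
    slope j (Q.G x j) (Sum.elim (chartAt (Fin (n + 1) → ℂ) x y) (j.removeNth a)) ≠ 0

theorem PatchFamily.Good.regular [MeasurableSpace M] {κ : Type*} {F : Q.PatchFamily κ}
    {a : Fin (e + 1) → ℂ} (ha : F.Good a) : Q.Regular a := by
  intro y hy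
  obtain ⟨q, hq⟩ := Set.mem_iUnion.mp (F.iUnion_P.ge (Set.mem_univ y))
  have hN := F.P_subset q hq
  exact ⟨F.x q, F.j q, (F.N_subset q hN).1, (F.N_subset q hN).2, ha q y hN hy⟩

variable (Q) in
/-- The Gaussian average of the currents of integration over the zero sets of `∑ k, a_k s_k`. -/
theorem gaussian_average [IsManifold 𝓘(ℂ, Fin (n + 1) → ℂ) ω M] [T2Space M] [CompactSpace M] [Nonempty M] (φ : Form (n + 1) M (2 * n))
    (hφ : ∀ (x : M) v, ContinuousOn (fun z => pullback (chartAt (Fin (n + 1) → ℂ) x).symm φ z v)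
      (chartAt (Fin (n + 1) → ℂ) x).target) (η : Form (n + 1) M 2)
    (hη : ∀ x j, ∀ z ∈ Q.T x j, pullback (chartAt (Fin (n + 1) → ℂ) x).symm η z =
      (fubiniStudy (e + 1) (Q.G x j z)).compLinearMap (realLinear (fderiv ℂ (Q.G x j) z))) :
    (∀ᵐ a, Q.Regular a ∧ FormIntegrable (k := n) (Q.zeros a) φ) ∧
    Integrable (fun a => gauss a * formIntegral (k := n) (Q.zeros a) φ) ∧
    ∫ a, gauss a * formIntegral (k := n) (Q.zeros a) φ = (Real.pi : ℂ) ^ (e + 1) *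
      formIntegral (k := n + 1) (Set.univ : Set M) fun x => wedge (by ring) (η x) (φ x) := by
  borelize M
  obtain ⟨t, ⟨F⟩⟩ := Q.exists_patchFamily
  obtain ⟨ι, hι, ⟨H⟩⟩ := F.exists_charts
  let ϕ : t → (Fin (n + 1) → ℂ) → Alt (n + 1) (2 * n) := fun q => pullback (F.χ q).symm φ
  have hϕ : ∀ q v, ContinuousOn (fun z => ϕ q z v) (Q.T (F.x q) (F.j q)) := fun q v =>
    (hφ (F.x q) v).mono Set.inter_subset_left
  have havg := fun q => patch_average (Q.isOpen_T (F.x q) (F.j q))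
    (Q.differentiableOn_G (F.x q) (F.j q)) Q.G_self (hϕ q) (F.isCompact_C q) (F.C_subset q)
    (F.K_subset q) (F.measurableSet_K q) (H.c q) (H.E q) (H.measurableSet_E q) (H.E_subset q)
    (H.disjoint_E q) (H.iUnion_E q)
  have hfs := fun q => (integral_graphDensity (Q.isOpen_T (F.x q) (F.j q))
    (Q.differentiableOn_G (F.x q) (F.j q)) Q.G_self (hϕ q) (F.isCompact_C q) (F.C_subset q)
    (F.K_subset q) (F.measurableSet_K q)).2.1
  have hfin : ∑' s : Σ q, ι q, ∫⁻ p in (H.c s.1 s.2).domain (H.E s.1 s.2),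
      ‖gauss p.2 * (H.c s.1 s.2).pull (ϕ s.1) p‖ₑ ≠ ⊤ := by
    rw [ENNReal.tsum_sigma', tsum_fintype]
    exact ENNReal.sum_ne_top.mpr fun q _ => (havg q).2.1
  have hsum : HasSum (fun s : Σ q, ι q => ∫ p in (H.c s.1 s.2).domain (H.E s.1 s.2),
      gauss p.2 * (H.c s.1 s.2).pull (ϕ s.1) p)
      (∑ q, (Real.pi : ℂ) ^ (e + 1) * ∫ z in F.K q, fsCoeff (Q.G (F.x q) (F.j q)) (ϕ q) z) := by
    refine HasSum.sigma_of_hasSum (hasSum_fintype _) (fun q => (havg q).2.2) ?_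
    refine .of_enorm (ne_top_of_le_ne_top hfin (ENNReal.tsum_le_tsum fun s => ?_))
    exact enorm_integral_le_lintegral_enorm _
  obtain ⟨hs1, hs2, hs3⟩ := integral_tsum_slices (volume : Measure (Fin n → ℂ))
    (volume : Measure (Fin (e + 1) → ℂ)) (fun s : Σ q, ι q => (H.c s.1 s.2).domain (H.E s.1 s.2))
    (fun s => (H.c s.1 s.2).measurableSet_domain (H.E_subset _ _) (H.measurableSet_E _ _))
    (fun s p => (H.c s.1 s.2).pull (ϕ s.1) p) gauss
    (fun a => by simp only [gauss]; exact_mod_cast (Real.exp_pos _).ne')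
    (fun s => (havg s.1).1 s.2) hfin
  -- For a section without critical zeros, the integral over its zero set is computed in
  -- `zeroSystem` and is the sum of the slice integrals.
  have hA : ∀ a, F.Good a →
      ((∀ s : Σ q, ι q, IntegrableOn (fun w => (H.c s.1 s.2).pull (ϕ s.1) (w, a))
        {w | (w, a) ∈ (H.c s.1 s.2).domain (H.E s.1 s.2)}) ∧
      ∑' s : Σ q, ι q, ∫⁻ w in {w | (w, a) ∈ (H.c s.1 s.2).domain (H.E s.1 s.2)},
        ‖(H.c s.1 s.2).pull (ϕ s.1) (w, a)‖ₑ ≠ ⊤) →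
      FormIntegrable (k := n) (Q.zeros a) φ ∧ formIntegral (k := n) (Q.zeros a) φ =
        ∑' s : Σ q, ι q, ∫ w in {w | (w, a) ∈ (H.c s.1 s.2).domain (H.E s.1 s.2)},
          (H.c s.1 s.2).pull (ϕ s.1) (w, a) := by
    intro a ha hint
    have hm : ∀ s, MeasurableSet ((H.zeroSystem a ha).A s) := (H.zeroSystem a ha).measurableSet_A
    have hpull : ∀ s, Set.EqOn (fun w => pullback ((H.zeroSystem a ha).g s) φ w (realBasis n))
        (fun w => (H.c s.1 s.2).pull (ϕ s.1) (w, a)) ((H.zeroSystem a ha).A s) :=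
      fun s w hw => H.pullback_zeroSystem a ha s φ hw.1
    simp only [← H.zeroSystem_A a ha] at hint ⊢
    have key := (H.zeroSystem a ha).formIntegral_eq φ
      (fun s => (hint.1 s).congr_fun (hpull s).symm (hm s)) (by
        convert hint.2 using 3 with s
        exact setLIntegral_congr_fun (hm s) fun w hw => congrArg _ (hpull s hw))
    refine ⟨key.1, key.2.trans (tsum_congr fun s => setIntegral_congr_fun (hm s) (hpull s))⟩
  have hae : (fun a => gauss a * ∑' s : Σ q, ι q,
      ∫ w in {w | (w, a) ∈ (H.c s.1 s.2).domain (H.E s.1 s.2)}, (H.c s.1 s.2).pull (ϕ s.1) (w, a))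
      =ᵐ[volume] fun a => gauss a * formIntegral (k := n) (Q.zeros a) φ := by
    filter_upwards [F.ae_good, hs1] with a ha h1
    rw [(hA a ha h1).2]
  refine ⟨?_, hs2.congr hae, ?_⟩
  · filter_upwards [F.ae_good, hs1] with a ha h1 using ⟨ha.regular, (hA a ha h1).1⟩
  · rw [← integral_congr_ae hae, hs3]
    refine hsum.tsum_eq.trans ?_
    -- The right-hand side is computed in the same patches, where the integrand is the Fubini–Study
    -- coefficient already found.
    have hU : ∀ q, Set.EqOn (fun z => pullback (F.univSystem.g q)
        (fun x => wedge (by ring) (η x) (φ x)) z (realBasis (n + 1)))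
        (fsCoeff (Q.G (F.x q) (F.j q)) (ϕ q)) (F.K q) := by
      intro q z hz
      simp only [pullback_wedge, fsCoeff]
      rw [← hη _ _ z (F.C_subset q (F.K_subset q hz))]
      rfl
    have key := F.univSystem.formIntegral_eq (fun x => wedge (by ring) (η x) (φ x))
      (fun q => by
        rw [F.univSystem_A]
        exact (hfs q).congr_fun (hU q).symm (F.measurableSet_K q)) (by
        rw [tsum_fintype]
        refine ENNReal.sum_ne_top.mpr fun q _ => ?_
        rw [F.univSystem_A]
        exact ((hfs q).congr_fun (hU q).symm (F.measurableSet_K q)).2.ne)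
    rw [key.2, tsum_fintype, Finset.mul_sum]
    refine Finset.sum_congr rfl fun q _ => ?_
    rw [F.univSystem_A, setIntegral_congr_fun (F.measurableSet_K q) (hU q)]

end RatioSystem

end RandomZeros

end

noncomputable section

namespace RandomZeros

/-! ### Polar coordinates and functions constant on rays. -/

section Polar

variable {E : Type*} [NormedAddCommGroup E] [NormedSpace ℝ E] [FiniteDimensional ℝ E]
  [MeasurableSpace E] [BorelSpace E] (μ : Measure E) [μ.IsAddHaarMeasure]

theorem volumeIoiPow_ne_zero (k : ℕ) : Measure.volumeIoiPow k ≠ 0 := by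
  intro h
  have h1 := Measure.volumeIoiPow_apply_Iio k ⟨1, Set.mem_Ioi.mpr one_pos⟩
  rw [h] at h1
  simp only [Measure.coe_zero, Pi.zero_apply, one_pow] at h1
  exact (ENNReal.ofReal_pos.mpr (by positivity : (0 : ℝ) < 1 / (k + 1))).ne h1

theorem measurePreserving_polar [Nontrivial E] :
    MeasurePreserving (fun p : Metric.sphere (0 : E) 1 × Set.Ioi (0 : ℝ) => p.2.1 • p.1.1)
      (μ.toSphere.prod (Measure.volumeIoiPow (Module.finrank ℝ E - 1))) μ := by
  have h1 := (μ.measurePreserving_homeomorphUnitSphereProd).symm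
    (homeomorphUnitSphereProd E).toMeasurableEquiv
  have h2 : MeasurePreserving (Subtype.val : ({0}ᶜ : Set E) → E) (μ.comap (↑)) μ := by
    refine ⟨measurable_subtype_coe, ?_⟩
    rw [map_comap_subtype_coe (measurableSet_singleton _).compl, restrict_compl_singleton]
  exact h2.comp h1

theorem measurableEmbedding_polar :
    MeasurableEmbedding fun p : Metric.sphere (0 : E) 1 × Set.Ioi (0 : ℝ) => p.2.1 • p.1.1 :=
  (MeasurableEmbedding.subtype_coe (measurableSet_singleton (0 : E)).compl).comp
    (homeomorphUnitSphereProd E).toMeasurableEquiv.symm.measurableEmbedding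

/-- In polar coordinates, almost every direction has some positive radius at which `P` holds,
because the radial measure is nonzero; `hP` brings the property back to the unit sphere. -/
theorem ae_sphere_of_ae [Nontrivial E] {P : E → Prop} (hP : ∀ r : ℝ, 0 < r → ∀ x, P (r • x) → P x)
    (h : ∀ᵐ x ∂μ, P x) : ∀ᵐ x ∂μ.toSphere, P x.1 := by
  have h1 := (measurePreserving_polar μ).quasiMeasurePreserving.ae h
  filter_upwards [Measure.ae_ae_of_ae_prod h1] with x hx
  have : (ae (Measure.volumeIoiPow (Module.finrank ℝ E - 1))).NeBot :=
    ae_neBot.mpr (volumeIoiPow_ne_zero _)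
  obtain ⟨r, hr⟩ := hx.exists
  exact hP r.1 r.2 _ hr

theorem integral_polar [Nontrivial E] {F : E → ℂ} (hF : ∀ r : ℝ, 0 < r → ∀ x, F (r • x) = F x)
    {ρ : ℝ → ℂ} (hρ : ∀ r, ρ r ≠ 0) (hint : Integrable (fun x => ρ ‖x‖ * F x) μ) :
    Integrable (fun x : Metric.sphere (0 : E) 1 => F x.1) μ.toSphere ∧
    ∫ x, ρ ‖x‖ * F x ∂μ = (∫ x : Metric.sphere (0 : E) 1, F x.1 ∂μ.toSphere) *
      ∫ r, ρ r.1 ∂(Measure.volumeIoiPow (Module.finrank ℝ E - 1)) := by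
  have hmp := measurePreserving_polar μ
  have he : ∀ p : Metric.sphere (0 : E) 1 × Set.Ioi (0 : ℝ),
      ρ ‖p.2.1 • p.1.1‖ * F (p.2.1 • p.1.1) = F p.1.1 * ρ p.2.1 := by
    intro p
    have hr : 0 < p.2.1 := p.2.2
    have hx : ‖p.1.1‖ = 1 := by simp
    rw [hF _ hr, norm_smul, hx, mul_one, Real.norm_of_nonneg hr.le, mul_comm]
  have h1 := (hmp.integrable_comp_emb measurableEmbedding_polar).mpr hint
  simp only [Function.comp_def, he] at h1
  have : (ae (Measure.volumeIoiPow (Module.finrank ℝ E - 1))).NeBot :=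
    ae_neBot.mpr (volumeIoiPow_ne_zero _)
  -- At some fixed radius the product is integrable on the sphere, and its radial factor is a
  -- nonzero constant.
  obtain ⟨r, hr⟩ := h1.prod_left_ae.exists
  constructor
  · refine (hr.mul_const (ρ r.1)⁻¹).congr (Filter.Eventually.of_forall fun x => ?_)
    simp [hρ]
  · rw [← hmp.integral_comp measurableEmbedding_polar]
    simp only [he]
    exact integral_prod_mul (fun x : Metric.sphere (0 : E) 1 => F x.1)
      fun r : Set.Ioi (0 : ℝ) => ρ r.1

end Polar

/-! ### From the Gaussian average to the sphere average. -/

section Sphere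

variable {e : ℕ}

/-- The volume of the Euclidean space `ℂᵈ` is proportional to the product measure. -/
theorem exists_map_ofLp (d : ℕ) : ∃ c : NNReal, c ≠ 0 ∧
    (volume : Measure (EuclideanSpace ℂ (Fin d))).map (PiLp.continuousLinearEquiv 2 ℝ fun _ : Fin d => ℂ) =
      c • (volume : Measure (Fin d → ℂ)) := by
  have : ((volume : Measure (EuclideanSpace ℂ (Fin d))).map
      (PiLp.continuousLinearEquiv 2 ℝ fun _ : Fin d => ℂ)).IsAddHaarMeasure :=
    ContinuousLinearEquiv.isAddHaarMeasure_map _ _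
  exact ⟨_, (Measure.addHaarScalarFactor_pos_of_isAddHaarMeasure _ _).ne',
    Measure.isAddLeftInvariant_eq_smul _ _⟩

theorem gauss_ofLp {d : ℕ} (x : EuclideanSpace ℂ (Fin d)) :
    gauss (fun k => x k) = ((Real.exp (-‖x‖ ^ 2) : ℝ) : ℂ) := by
  rw [gauss, EuclideanSpace.norm_sq_eq]

theorem ae_sphereMeasure {P : (Fin (e + 1) → ℂ) → Prop}
    (hP : ∀ r : ℝ, 0 < r → ∀ a, P (r • a) → P a) (h : ∀ᵐ a, P a) :
    ∀ᵐ a ∂(sphereMeasure (e + 1)), P fun k => a.1 k := by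
  obtain ⟨c, hc, hmap⟩ := exists_map_ofLp (e + 1)
  have h1 : ∀ᵐ x : EuclideanSpace ℂ (Fin (e + 1)), P fun k => x k := by
    have h2 : ∀ᵐ a ∂((volume : Measure (EuclideanSpace ℂ (Fin (e + 1)))).map
        (PiLp.continuousLinearEquiv 2 ℝ fun _ : Fin (e + 1) => ℂ)), P a := by
      rw [hmap]
      exact Measure.ae_smul_measure h _
    exact ae_of_ae_map (by fun_prop) h2
  refine Measure.ae_smul_measure ?_ _
  exact ae_sphere_of_ae _ (P := fun x : EuclideanSpace ℂ (Fin (e + 1)) => P fun k => x k)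
    (fun r hr x hx => hP r hr _ hx) h1

/-- The two averages of a function constant on rays are proportional, and the constant function 1
fixes the factor, since the Gaussian weight has total mass `π ^ (e + 1)`. -/
theorem integral_sphereMeasure {F : (Fin (e + 1) → ℂ) → ℂ}
    (hF : ∀ r : ℝ, 0 < r → ∀ a, F (r • a) = F a) (hint : Integrable fun a => gauss a * F a) :
    Integrable (fun a : Metric.sphere (0 : EuclideanSpace ℂ (Fin (e + 1))) 1 => F fun k => a.1 k)
      (sphereMeasure (e + 1)) ∧
    (Real.pi : ℂ) ^ (e + 1) * ∫ a : Metric.sphere (0 : EuclideanSpace ℂ (Fin (e + 1))) 1,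
      F (fun k => a.1 k) ∂(sphereMeasure (e + 1)) = ∫ a, gauss a * F a := by
  obtain ⟨c, hc, hmap⟩ := exists_map_ofLp (e + 1)
  have hc' : ((c : ℝ) : ℂ) ≠ 0 := by simpa using hc
  set ε := (PiLp.continuousLinearEquiv 2 ℝ fun _ : Fin (e + 1) => ℂ)
  have hemb : MeasurableEmbedding ε := ε.toHomeomorph.measurableEmbedding
  have key : ∀ F : (Fin (e + 1) → ℂ) → ℂ, (∀ r : ℝ, 0 < r → ∀ a, F (r • a) = F a) →
      Integrable (fun a => gauss a * F a) →
      Integrable (fun a : Metric.sphere (0 : EuclideanSpace ℂ (Fin (e + 1))) 1 => F fun k => a.1 k)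
        (volume : Measure (EuclideanSpace ℂ (Fin (e + 1)))).toSphere ∧
      ((c : ℝ) : ℂ) * ∫ a, gauss a * F a =
        (∫ a : Metric.sphere (0 : EuclideanSpace ℂ (Fin (e + 1))) 1, F (fun k => a.1 k)
          ∂(volume : Measure (EuclideanSpace ℂ (Fin (e + 1)))).toSphere) *
        ∫ r, ((Real.exp (-r.1 ^ 2) : ℝ) : ℂ) ∂(Measure.volumeIoiPow
          (Module.finrank ℝ (EuclideanSpace ℂ (Fin (e + 1))) - 1)) := by
    intro F hF hint
    have h1 : Integrable (fun x : EuclideanSpace ℂ (Fin (e + 1)) =>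
        ((Real.exp (-‖x‖ ^ 2) : ℝ) : ℂ) * F fun k => x k) := by
      have h2 : Integrable (fun a => gauss a * F a) (Measure.map ε volume) := by
        rw [hmap]
        exact hint.smul_measure_nnreal
      refine (hemb.integrable_map_iff.mp h2).congr (Filter.Eventually.of_forall fun x => ?_)
      simp only [← gauss_ofLp]
      rfl
    have h3 := integral_polar (volume : Measure (EuclideanSpace ℂ (Fin (e + 1))))
      (F := fun x => F fun k => x k) (fun r hr x => hF r hr _)
      (ρ := fun r => ((Real.exp (-r ^ 2) : ℝ) : ℂ))
      (fun r => by exact_mod_cast (Real.exp_pos _).ne') h1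
    refine ⟨h3.1, ?_⟩
    rw [← h3.2]
    have h4 := hemb.integral_map (μ := volume) fun a => gauss a * F a
    rw [hmap, integral_smul_nnreal_measure] at h4
    have h5 : ((c : ℝ) : ℂ) * ∫ a, gauss a * F a = c • ∫ a, gauss a * F a := by
      rw [NNReal.smul_def, Complex.real_smul]
    rw [h5, h4]
    refine integral_congr_ae (Filter.Eventually.of_forall fun x => ?_)
    simp only [← gauss_ofLp]
    rfl
  obtain ⟨k1, k2⟩ := key F hF hint
  -- This relates the scale factor `c`, the area of the sphere and the radial integral, none of
  -- which has to be evaluated.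
  obtain ⟨-, k3⟩ := key (fun _ => 1) (fun _ _ _ => rfl) (by simpa using integrable_gauss)
  set σ := (volume : Measure (EuclideanSpace ℂ (Fin (e + 1)))).toSphere
  set J := ∫ r, ((Real.exp (-r.1 ^ 2) : ℝ) : ℂ) ∂(Measure.volumeIoiPow
          (Module.finrank ℝ (EuclideanSpace ℂ (Fin (e + 1))) - 1))
  simp only [mul_one, integral_gauss, integral_const] at k3
  rw [Complex.real_smul, mul_one] at k3
  have hσ0 : σ Set.univ ≠ 0 := by
    rw [Ne, Measure.measure_univ_eq_zero]
    exact Measure.toSphere_ne_zero _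
  have hpi : (Real.pi : ℂ) ^ (e + 1) ≠ 0 := pow_ne_zero _ (by exact_mod_cast Real.pi_ne_zero)
  have hσ : ((σ.real Set.univ : ℝ) : ℂ) ≠ 0 := fun h => by
    rw [h, zero_mul] at k3
    exact mul_ne_zero hc' hpi k3
  refine ⟨k1.smul_measure (ENNReal.inv_ne_top.mpr hσ0), ?_⟩
  rw [sphereMeasure, integral_smul_measure, ENNReal.toReal_inv, Complex.real_smul]
  change (Real.pi : ℂ) ^ (e + 1) * (((σ.real Set.univ)⁻¹ : ℝ) * _) = _
  apply mul_left_cancel₀ hc'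
  rw [k2, ← mul_assoc, k3]
  push_cast
  field_simp
  rfl

end Sphere

end RandomZeros

end

noncomputable section

namespace RandomZeros

/-! ### Dependence of integrals on the form. -/

section Congr

variable {m : ℕ} {M : Type*} [TopologicalSpace M] [ChartedSpace (Fin m → ℂ) M]

theorem pullback_congr {k p : ℕ} {g : (Fin k → ℂ) → M} {η η' : Form m M p} {z : Fin k → ℂ}
    (h : η (g z) = η' (g z)) : pullback g η z = pullback g η' z := by
  simp only [pullback, h]

theorem formIntegral_congr {k : ℕ} {S : Set M} {η η' : Form m M (2 * k)}
    (h : ∀ x ∈ S, η x = η' x) : formIntegral S η = formIntegral S η' := by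
  unfold formIntegral
  split_ifs with hS
  · refine tsum_congr fun i => setIntegral_congr_fun (hS.some.measurable i) fun z hz => ?_
    simp only [pullback_congr (h _ (hS.some.mapsTo i (hS.some.subset i hz)))]
  · rfl

theorem FormIntegrable.congr {k : ℕ} {S : Set M} {η η' : Form m M (2 * k)}
    (h : ∀ x ∈ S, η x = η' x) (hη : FormIntegrable S η) : FormIntegrable S η' := by
  obtain ⟨hS, h1, h2⟩ := hη
  have key : ∀ i, Set.EqOn (fun z => pullback (hS.some.g i) η z (realBasis k))
      (fun z => pullback (hS.some.g i) η' z (realBasis k)) (hS.some.A i) := fun i z hz => by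
    simp only [pullback_congr (h _ (hS.some.mapsTo i (hS.some.subset i hz)))]
  refine ⟨hS, fun i => (h1 i).congr_fun (key i) (hS.some.measurable i), ?_⟩
  convert h2 using 2 with i
  exact setIntegral_congr_fun (hS.some.measurable i) fun z hz => congrArg norm (key i hz).symm

theorem formIntegral_smul {k : ℕ} (S : Set M) (c : ℂ) (η : Form m M (2 * k)) :
    formIntegral S (fun x => c • η x) = c * formIntegral S η := by
  unfold formIntegral
  split_ifs with hS
  · rw [← tsum_mul_left]
    refine tsum_congr fun i => ?_
    rw [← integral_const_mul]
    rfl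
  · simp

end Congr

/-! ### Holomorphic charts adapted to a function. -/

section MaximalAtlas

variable {m : ℕ} {M : Type*} [TopologicalSpace M] [ChartedSpace (Fin m → ℂ) M]
  [IsManifold 𝓘(ℂ, Fin m → ℂ) ω M]

theorem trans_mem_maximalAtlas (x : M) (f : OpenPartialHomeomorph (Fin m → ℂ) (Fin m → ℂ))
    (h1 : ContDiffOn ℂ ω f f.source) (h2 : ContDiffOn ℂ ω f.symm f.target) :
    (chartAt (Fin m → ℂ) x).trans f ∈ IsManifold.maximalAtlas 𝓘(ℂ, Fin m → ℂ) ω M := by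
  have hf : f ∈ contDiffGroupoid ω 𝓘(ℂ, Fin m → ℂ) := by
    rw [contDiffGroupoid, mem_groupoid_of_pregroupoid]
    constructor
    · simpa [contDiffPregroupoid] using h1
    · simpa [contDiffPregroupoid] using h2
  have hx : chartAt (Fin m → ℂ) x ∈ (contDiffGroupoid ω 𝓘(ℂ, Fin m → ℂ)).maximalAtlas M :=
    StructureGroupoid.chart_mem_maximalAtlas _ x
  intro e' he'
  constructor
  · rw [OpenPartialHomeomorph.trans_symm_eq_symm_trans_symm, OpenPartialHomeomorph.trans_assoc]
    exact StructureGroupoid.trans _ (StructureGroupoid.symm _ hf) (hx e' he').1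
  · rw [← OpenPartialHomeomorph.trans_assoc]
    exact StructureGroupoid.trans _ (hx e' he').2 hf

/-- A function with nonvanishing derivative is locally the first coordinate of a chart. -/
theorem exists_chart_first_coordinate {n : ℕ} {M : Type*} [TopologicalSpace M]
    [ChartedSpace (Fin (n + 1) → ℂ) M] [IsManifold 𝓘(ℂ, Fin (n + 1) → ℂ) ω M]
    {x p : M} (hp : p ∈ (chartAt (Fin (n + 1) → ℂ) x).source) {T : Set (Fin (n + 1) → ℂ)}
    (hT : IsOpen T) {f : (Fin (n + 1) → ℂ) → ℂ} (hf : DifferentiableOn ℂ f T)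
    (hpT : chartAt (Fin (n + 1) → ℂ) x p ∈ T)
    (hd : fderiv ℂ f (chartAt (Fin (n + 1) → ℂ) x p) ≠ 0) :
    ∃ χ ∈ IsManifold.maximalAtlas 𝓘(ℂ, Fin (n + 1) → ℂ) ω M, p ∈ χ.source ∧
      ∀ y ∈ χ.source, y ∈ (chartAt (Fin (n + 1) → ℂ) x).source ∧
        chartAt (Fin (n + 1) → ℂ) x y ∈ T ∧ χ y 0 = f (chartAt (Fin (n + 1) → ℂ) x y) := by
  obtain ⟨l, hl⟩ := exists_single_ne_zero hd
  obtain ⟨c, hc1, hc2, hc3, hc4, hc5, hc6⟩ := exists_updateHomeomorph hT hf hpT hl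
  -- The function replaces the `l`-th coordinate, while `regularPart` asks for coordinate 0; a
  -- transposition moves it there.
  let σ : (Fin (n + 1) → ℂ) ≃L[ℂ] (Fin (n + 1) → ℂ) :=
    (LinearEquiv.funCongrLeft ℂ ℂ (Equiv.swap 0 l)).toContinuousLinearEquiv
  have hσ : ∀ v, σ v 0 = v l := fun v => by
    change v (Equiv.swap 0 l 0) = v l
    rw [Equiv.swap_apply_left]
  refine ⟨(chartAt (Fin (n + 1) → ℂ) x).trans (c.transHomeomorph σ.toHomeomorph),
    trans_mem_maximalAtlas x _ ?_ ?_, ?_, ?_⟩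
  · exact σ.contDiff.comp_contDiffOn hc5
  · exact hc6.comp σ.symm.contDiff.contDiffOn fun y hy => hy
  · rw [OpenPartialHomeomorph.trans_source]
    exact ⟨hp, hc1⟩
  · intro y hy
    rw [OpenPartialHomeomorph.trans_source] at hy
    refine ⟨hy.1, hc2 hy.2, ?_⟩
    change σ (c (chartAt (Fin (n + 1) → ℂ) x y)) 0 = _
    rw [hσ, hc3, Function.update_self]

end MaximalAtlas

/-! ### Scaling invariance, regularity of zero sets, and the pulled-back Fubini–Study form. -/

namespace RatioSystem

variable {n e : ℕ} {M : Type*} [TopologicalSpace M] [ChartedSpace (Fin (n + 1) → ℂ) M]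
  (Q : RatioSystem n e M)

theorem zeros_smul {r : ℝ} (hr : 0 < r) (a : Fin (e + 1) → ℂ) : Q.zeros (r • a) = Q.zeros a := by
  have h : ∀ j y, Q.comb (r • a) j y = r * Q.comb a j y := fun j y => by
    simp [comb, Finset.mul_sum, mul_assoc]
  have hr' : (r : ℂ) ≠ 0 := by exact_mod_cast hr.ne'
  ext y
  simp [zeros, h, hr']

theorem Regular.of_smul {r : ℝ} (hr : 0 < r) {a : Fin (e + 1) → ℂ} (h : Q.Regular (r • a)) :
    Q.Regular a := by
  intro y hy
  rw [← Q.zeros_smul hr] at hy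
  obtain ⟨x, j, h1, h2, h3⟩ := h y hy
  refine ⟨x, j, h1, h2, fun h0 => h3 ?_⟩
  ext v
  have h4 := DFunLike.congr_fun h0 v
  simp only [slope, neg_apply, sum_apply, smul_apply, Sum.elim_inr, Sum.elim_inl, Fin.removeNth,
    Pi.smul_apply, smul_eq_mul, Complex.real_smul, mul_assoc, ← Finset.mul_sum, zero_apply,
    neg_eq_zero] at h4 ⊢
  rw [h4, mul_zero]

theorem mem_T {x y : M} {j : Fin (e + 1)} (hy : y ∈ (chartAt (Fin (n + 1) → ℂ) x).source)
    (hyj : y ∈ Q.W j) : chartAt (Fin (n + 1) → ℂ) x y ∈ Q.T x j :=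
  ⟨(chartAt (Fin (n + 1) → ℂ) x).map_source hy, by
    rw [Set.mem_preimage, (chartAt (Fin (n + 1) → ℂ) x).left_inv hy]; exact hyj⟩

variable [IsManifold 𝓘(ℂ, Fin (n + 1) → ℂ) ω M]

theorem hasFDerivAt_comb (a : Fin (e + 1) → ℂ) {x : M} {j : Fin (e + 1)} {z : Fin (n + 1) → ℂ}
    (hz : z ∈ Q.T x j) :
    HasFDerivAt (fun z => Q.comb a j ((chartAt (Fin (n + 1) → ℂ) x).symm z))
      (-slope j (Q.G x j) (Sum.elim z (j.removeNth a))) z := by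
  have h1 := hasFDerivAt_linear_comb (j := j) (x := Sum.elim z (j.removeNth a)) (Q.isOpen_T x j)
    (Q.differentiableOn_G x j) hz
  have h2 : (fun z => Q.comb a j ((chartAt (Fin (n + 1) → ℂ) x).symm z)) =ᶠ[𝓝 z]
      fun z => a j - -∑ k, j.removeNth a k * Q.G x j z (j.succAbove k) := by
    filter_upwards [(Q.isOpen_T x j).mem_nhds hz] with y hy
    rw [comb, Fin.sum_univ_succAbove _ j, Q.R_self j _ hy.2]
    simp [Fin.removeNth, G]
  exact (h1.const_sub (a j)).congr_of_eventuallyEq h2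

/-- At a simple zero the affine expression of the section is itself the first coordinate of a chart.
-/
theorem regularPart_zeros {a : Fin (e + 1) → ℂ} (ha : Q.Regular a) :
    regularPart n (Q.zeros a) = Q.zeros a := by
  refine subset_antisymm (fun y hy => hy.1) fun p hp => ⟨hp, ?_⟩
  obtain ⟨x, j, hpx, hpj, hs⟩ := ha p hp
  have hd := Q.hasFDerivAt_comb a (Q.mem_T hpx hpj)
  obtain ⟨χ, h1, h2, h3⟩ := exists_chart_first_coordinate hpx (Q.isOpen_T x j)
    (f := fun z => Q.comb a j ((chartAt (Fin (n + 1) → ℂ) x).symm z))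
    (fun z hz => (Q.hasFDerivAt_comb a hz).differentiableAt.differentiableWithinAt)
    (Q.mem_T hpx hpj) (by rw [hd.fderiv]; exact neg_ne_zero.mpr hs)
  refine ⟨χ, h1, h2, fun y hy => ?_⟩
  obtain ⟨h4, h5, h6⟩ := h3 y hy
  have h7 := h5.2
  rw [Set.mem_preimage, (chartAt (Fin (n + 1) → ℂ) x).left_inv h4] at h7
  rw [h6, (chartAt (Fin (n + 1) → ℂ) x).left_inv h4, Q.mem_zeros_iff a h7]

/-- The derivative at a simple zero does not vanish in the preferred chart either. -/
theorem Regular.fderiv_comb_ne_zero {a : Fin (e + 1) → ℂ} (ha : Q.Regular a) {p : M}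
    (hp : p ∈ Q.zeros a) : ∃ j, p ∈ Q.W j ∧
      fderiv ℂ (fun z => Q.comb a j ((chartAt (Fin (n + 1) → ℂ) p).symm z))
        (chartAt (Fin (n + 1) → ℂ) p p) ≠ 0 := by
  obtain ⟨x, j, hpx, hpj, hs⟩ := ha p hp
  refine ⟨j, hpj, fun h0 => hs ?_⟩
  set χ := chartAt (Fin (n + 1) → ℂ) x
  set ψ := chartAt (Fin (n + 1) → ℂ) p
  have hpp : p ∈ ψ.source := mem_chart_source _ p
  have h1 := (Q.hasFDerivAt_comb a (Q.mem_T hpp hpj)).differentiableAt.hasFDerivAt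
  rw [h0] at h1
  have h2 : DifferentiableAt ℂ (fun z => ψ (χ.symm z)) (χ p) := by
    rw [← mdifferentiableAt_iff_differentiableAt]
    have h3 : MDifferentiableAt 𝓘(ℂ, Fin (n + 1) → ℂ) 𝓘(ℂ, Fin (n + 1) → ℂ) χ.symm (χ p) :=
      mdifferentiableOn_chart_symm.mdifferentiableAt
        (χ.open_target.mem_nhds (χ.map_source hpx))
    have h4 : MDifferentiableAt 𝓘(ℂ, Fin (n + 1) → ℂ) 𝓘(ℂ, Fin (n + 1) → ℂ) ψ (χ.symm (χ p)) := by
      rw [χ.left_inv hpx]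
      exact mdifferentiableOn_chart.mdifferentiableAt (ψ.open_source.mem_nhds hpp)
    exact h4.comp _ h3
  have h1' : HasFDerivAt (fun z => Q.comb a j (ψ.symm z)) (0 : (Fin (n + 1) → ℂ) →L[ℂ] ℂ)
      (ψ (χ.symm (χ p))) := by rwa [χ.left_inv hpx]
  have h5 := h1'.comp (χ p) h2.hasFDerivAt
  have h6 : (fun z => Q.comb a j (χ.symm z)) =ᶠ[𝓝 (χ p)]
      (fun z => Q.comb a j (ψ.symm z)) ∘ fun z => ψ (χ.symm z) := by
    have h7 : χ.symm ⁻¹' ψ.source ∈ 𝓝 (χ p) := by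
      refine (χ.continuousAt_symm (χ.map_source hpx)).preimage_mem_nhds ?_
      rw [χ.left_inv hpx]
      exact ψ.open_source.mem_nhds hpp
    filter_upwards [h7] with z hz
    simp only [Function.comp_apply, ψ.left_inv hz]
  have h8 := (Q.hasFDerivAt_comb a (Q.mem_T hpx hpj)).unique (h5.congr_of_eventuallyEq h6)
  rw [ContinuousLinearMap.zero_comp, neg_eq_zero] at h8
  exact h8

/-- The pullback of the Fubini–Study form by a map with affine coordinates `Q.R`. -/
theorem pullback_fubiniStudy (J : M → Fin (e + 1)) (hJ : ∀ y, y ∈ Q.W (J y)) (x : M)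
    (j : Fin (e + 1)) {z : Fin (n + 1) → ℂ} (hz : z ∈ Q.T x j) :
    pullback (chartAt (Fin (n + 1) → ℂ) x).symm (fun y => (fubiniStudy (e + 1)
      (Q.R (J y) y)).compLinearMap (realLinear (mfderiv 𝓘(ℂ, Fin (n + 1) → ℂ)
        𝓘(ℂ, Fin (e + 1) → ℂ) (Q.R (J y)) y))) z =
      (fubiniStudy (e + 1) (Q.G x j z)).compLinearMap (realLinear (fderiv ℂ (Q.G x j) z)) := by
  set χ := chartAt (Fin (n + 1) → ℂ) x
  set i := J (χ.symm z) with hi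
  have hzi : z ∈ Q.T x i := ⟨hz.1, hJ _⟩
  have hG := (Q.differentiableOn_G x j).differentiableAt ((Q.isOpen_T x j).mem_nhds hz)
  have hGi := (Q.differentiableOn_G x i).differentiableAt ((Q.isOpen_T x i).mem_nhds hzi)
  have h1 : MDifferentiableAt 𝓘(ℂ, Fin (n + 1) → ℂ) 𝓘(ℂ, Fin (n + 1) → ℂ) χ.symm z :=
    mdifferentiableOn_chart_symm.mdifferentiableAt (χ.open_target.mem_nhds hz.1)
  have h2 : MDifferentiableAt 𝓘(ℂ, Fin (n + 1) → ℂ) 𝓘(ℂ, Fin (e + 1) → ℂ) (Q.R i) (χ.symm z) :=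
    (Q.mdiff i).mdifferentiableAt ((Q.isOpen_W i).mem_nhds hzi.2)
  have h3 : fderiv ℂ (Q.G x i) z = (mfderiv 𝓘(ℂ, Fin (n + 1) → ℂ) 𝓘(ℂ, Fin (e + 1) → ℂ) (Q.R i)
      (χ.symm z)).comp (mfderiv 𝓘(ℂ, Fin (n + 1) → ℂ) 𝓘(ℂ, Fin (n + 1) → ℂ) χ.symm z) := by
    rw [← mfderiv_eq_fderiv]
    exact mfderiv_comp z h2 h1
  have hu : Q.G x j z i * Q.G x i z j = 1 := by
    have h4 := congrFun (Q.transition i j _ hzi.2 hz.2) j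
    rw [Q.R_self j _ hz.2] at h4
    exact h4.symm
  have hu0 : Q.G x i z j ≠ 0 := right_ne_zero_of_mul_eq_one hu
  -- Two affine lifts differ by a holomorphic factor. Differentiating the factor adds a multiple of
  -- the lift itself, which the Fubini–Study form ignores.
  have hev : Q.G x i =ᶠ[𝓝 z] fun z => Q.G x i z j • Q.G x j z := by
    filter_upwards [(Q.isOpen_T x j).mem_nhds hz, (Q.isOpen_T x i).mem_nhds hzi] with y hy hyi
    exact Q.transition j i _ hy.2 hyi.2
  have hd := ((hasFDerivAt_pi'.mp hGi.hasFDerivAt j).smul hG.hasFDerivAt).congr_of_eventuallyEq hev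
  have hw : Q.G x j z ≠ 0 := fun h0 => by simpa [h0] using Q.G_self z hz
  ext v
  have hL : pullback χ.symm (fun y => (fubiniStudy (e + 1)
      (Q.R (J y) y)).compLinearMap (realLinear (mfderiv 𝓘(ℂ, Fin (n + 1) → ℂ)
        𝓘(ℂ, Fin (e + 1) → ℂ) (Q.R (J y)) y))) z v =
      fubiniStudy (e + 1) (Q.G x i z) fun k => fderiv ℂ (Q.G x i) z (v k) := by
    rw [h3]
    rfl
  rw [hL, hev.eq_of_nhds, hd.fderiv]
  exact fubiniStudy_smul _ hw _ hu0 (fun k => fderiv ℂ (Q.G x j) z (v k))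
    (fun k => fderiv ℂ (Q.G x i) z (v k) j)

end RatioSystem

end RandomZeros

end

noncomputable section

namespace RandomZeros

section Pi

variable {m k : ℕ} {M : Type*} [TopologicalSpace M] [ChartedSpace (Fin m → ℂ) M]

theorem mdifferentiableOn_pi {f : M → (Fin k → ℂ)} {U : Set M}
    (h : ∀ i, MDifferentiableOn 𝓘(ℂ, Fin m → ℂ) 𝓘(ℂ, ℂ) (fun y => f y i) U) :
    MDifferentiableOn 𝓘(ℂ, Fin m → ℂ) 𝓘(ℂ, Fin k → ℂ) f U := by
  intro y hy
  refine ⟨continuousWithinAt_pi.mpr fun i => (h i y hy).continuousWithinAt, ?_⟩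
  exact differentiableWithinAt_pi.mpr fun i => (h i y hy).2

end Pi

/-! ### Frames and coefficients of sections. -/

section Bundle

variable {m : ℕ} {M : Type*} [TopologicalSpace M] [ChartedSpace (Fin m → ℂ) M]
  (L : M → Type*) [∀ x, AddCommGroup (L x)] [∀ x, Module ℂ (L x)]
  [∀ x, TopologicalSpace (L x)] [TopologicalSpace (Bundle.TotalSpace ℂ L)]
  [FiberBundle ℂ L] [VectorBundle ℂ ℂ L]

theorem coeff_tprod (N : ℕ) (x₀ y : M) (v : Fin N → L y) :
    coeff L N x₀ y (PiTensorProduct.tprod ℂ v) =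
      ∏ i, (trivializationAt ℂ L x₀).linearMapAt ℂ y (v i) := by
  simp [coeff]

/-- The coefficients with respect to two frames are proportional. -/
theorem coeff_eq_smul (N : ℕ) {x₀ y : M} (hy : y ∈ (trivializationAt ℂ L x₀).baseSet) :
    ∃ c : ℂ, c ≠ 0 ∧ coeff L N x₀ y = c • coeff L N y y := by
  set A := (trivializationAt ℂ L x₀).linearEquivAt ℂ y hy
  have hyy : y ∈ (trivializationAt ℂ L y).baseSet := FiberBundle.mem_baseSet_trivializationAt' y
  set B := (trivializationAt ℂ L y).linearEquivAt ℂ y hyy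
  have hA : ∀ v, (trivializationAt ℂ L x₀).linearMapAt ℂ y v = A v := fun v => by
    simp [A, (trivializationAt ℂ L x₀).linearMapAt_apply, hy]
  have hB : ∀ v, (trivializationAt ℂ L y).linearMapAt ℂ y v = B v := fun v => by
    simp [B, (trivializationAt ℂ L y).linearMapAt_apply, hyy]
  obtain ⟨c, hc0, hAB⟩ : ∃ c : ℂ, c ≠ 0 ∧ ∀ v, A v = c * B v := by
    refine ⟨A (B.symm 1), by simp, fun v => ?_⟩
    have : v = B v • B.symm 1 := by
      apply B.injective
      simp
    conv_lhs => rw [this]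
    rw [map_smul, smul_eq_mul, mul_comm]
  refine ⟨c ^ N, pow_ne_zero _ hc0, ?_⟩
  apply PiTensorProduct.ext
  ext v
  simp only [LinearMap.compMultilinearMap_apply, LinearMap.smul_apply, coeff_tprod, hA, hB,
    smul_eq_mul, hAB, Finset.prod_mul_distrib]
  simp

theorem coeff_eq_zero_iff (N : ℕ) {x₀ y : M} (hy : y ∈ (trivializationAt ℂ L x₀).baseSet)
    (t : ⨂[ℂ]^N (L y)) : coeff L N x₀ y t = 0 ↔ t = 0 := by
  obtain ⟨c, hc, h⟩ := coeff_eq_smul L N hy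
  rw [h, LinearMap.smul_apply, smul_eq_mul, mul_eq_zero, or_iff_right hc]
  exact ⟨fun h0 => coeff_injective L N y (by rw [h0, map_zero]), fun h0 => by rw [h0, map_zero]⟩

theorem coeff_div (N : ℕ) {x₀ y : M} (hy : y ∈ (trivializationAt ℂ L x₀).baseSet)
    (s t : ⨂[ℂ]^N (L y)) :
    coeff L N x₀ y s / coeff L N x₀ y t = coeff L N y y s / coeff L N y y t := by
  obtain ⟨c, hc, h⟩ := coeff_eq_smul L N hy
  simp only [h, LinearMap.smul_apply, smul_eq_mul]
  exact mul_div_mul_left _ _ hc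

variable {L}

theorem isOpen_ne_zero {N : ℕ} {s : ∀ x, ⨂[ℂ]^N (L x)} (hs : s ∈ H0 m L N) :
    IsOpen {y | s y ≠ 0} := by
  rw [isOpen_iff_mem_nhds]
  intro x hx
  have hb := (trivializationAt ℂ L x).open_baseSet.mem_nhds
    (FiberBundle.mem_baseSet_trivializationAt' (F := ℂ) (E := L) x)
  have hc := ((hs x).mdifferentiableAt hb).continuousAt
  have h0 : coeff L N x x (s x) ≠ 0 := fun h =>
    hx ((coeff_eq_zero_iff L N (FiberBundle.mem_baseSet_trivializationAt' x) _).mp h)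
  filter_upwards [hc.eventually_ne h0] with y hy h
  exact hy (by rw [h, map_zero])

end Bundle

/-! ### Sections of `L^N` as a system of ratios. -/

section Ratio

variable {n e N : ℕ} {M : Type*} [TopologicalSpace M] [ChartedSpace (Fin (n + 1) → ℂ) M]
  {L : M → Type*} [∀ x, AddCommGroup (L x)] [∀ x, Module ℂ (L x)]
  [∀ x, TopologicalSpace (L x)] [TopologicalSpace (Bundle.TotalSpace ℂ L)]
  [FiberBundle ℂ L] [VectorBundle ℂ ℂ L]

/-- The ratios of holomorphic sections of `L^N` without common zeros. -/
def ratioSystem (S : Fin (e + 1) → ∀ x, ⨂[ℂ]^N (L x)) (hS : ∀ j, S j ∈ H0 (n + 1) L N)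
    (hΦ : ∀ x, ∃ j, S j x ≠ 0) : RatioSystem n e M where
  W j := {y | S j y ≠ 0}
  R j y k := coeff L N y y (S k y) / coeff L N y y (S j y)
  isOpen_W j := isOpen_ne_zero (hS j)
  exists_mem_W := hΦ
  mdiff j := by
    refine mdifferentiableOn_pi fun k x hx => ?_
    have hxb : x ∈ (trivializationAt ℂ L x).baseSet := FiberBundle.mem_baseSet_trivializationAt' x
    have hb := (trivializationAt ℂ L x).open_baseSet.mem_nhds hxb
    have h1 := (hS k x).mdifferentiableAt hb
    have h2 := (hS j x).mdifferentiableAt hb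
    have h0 : coeff L N x x (S j x) ≠ 0 := fun h => hx ((coeff_eq_zero_iff L N hxb _).mp h)
    have h3 : MDifferentiableAt 𝓘(ℂ, ℂ) 𝓘(ℂ, ℂ) (fun t : ℂ => t⁻¹) (coeff L N x x (S j x)) :=
      (differentiableAt_inv h0).mdifferentiableAt
    have h4 := h1.mul (h3.comp x h2)
    -- The ratio is written in the frame at the moving point `y`, which need not vary
    -- holomorphically; by `coeff_div` it equals the ratio in the fixed frame around `x`.
    refine (h4.congr_of_eventuallyEq ?_).mdifferentiableWithinAt
    filter_upwards [hb] with y hy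
    rw [← coeff_div L N hy, div_eq_mul_inv]
    rfl
  R_self j y hy := by
    refine div_self fun h => hy ?_
    exact (coeff_eq_zero_iff L N (FiberBundle.mem_baseSet_trivializationAt' y) _).mp h
  transition j j' y hy hy' := by
    have h0 : coeff L N y y (S j y) ≠ 0 := fun h => hy
      ((coeff_eq_zero_iff L N (FiberBundle.mem_baseSet_trivializationAt' y) _).mp h)
    ext k
    simp only [Pi.smul_apply, smul_eq_mul]
    field_simp

variable (S : Fin (e + 1) → ∀ x, ⨂[ℂ]^N (L x)) (hS : ∀ j, S j ∈ H0 (n + 1) L N)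
    (hΦ : ∀ x, ∃ j, S j x ≠ 0)

/-- The chosen representative of a projective point differs from the vector of coefficients by a
unit, which cancels. Where the `j`-th section vanishes, both sides are 0 because inversion sends 0
to 0. -/
theorem affineLift_kodairaMap (j : Fin (e + 1)) (y : M) :
    affineLift j (kodairaMap S hΦ y) = (ratioSystem (n := n) S hS hΦ).R j y := by
  obtain ⟨c, hc⟩ := Projectivization.exists_smul_eq_mk_rep ℂ
    (fun j => coeff L N y y (S j y)) (by
      obtain ⟨j, hj⟩ := hΦ y
      intro h0
      apply hj
      apply coeff_injective L N y
      simpa using congrFun h0 j)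
  have hc' : (kodairaMap S hΦ y).rep = (c : ℂ) • fun j => coeff L N y y (S j y) := hc.symm
  ext k
  have hc0 : (c : ℂ) ≠ 0 := c.ne_zero
  rw [affineLift, hc']
  simp only [Pi.smul_apply, smul_eq_mul, mul_inv, ratioSystem]
  rw [div_eq_inv_mul, mul_mul_mul_comm, inv_mul_cancel₀ hc0, one_mul]

theorem rep_kodairaMap_ne_zero {j : Fin (e + 1)} {y : M} (h : (kodairaMap S hΦ y).rep j ≠ 0) :
    y ∈ (ratioSystem (n := n) S hS hΦ).W j := by
  intro h0
  -- If the section vanished, the ratio would be 0 by the convention for division by zero, whereas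
  -- the `j`-th affine coordinate is 1.
  have h1 := congrFun (affineLift_kodairaMap (n := n) S hS hΦ j y) j
  simp only [affineLift, Pi.smul_apply, smul_eq_mul, inv_mul_cancel₀ h, ratioSystem, h0, map_zero,
    div_zero] at h1
  exact one_ne_zero h1

theorem coeff_sectionOf (a : EuclideanSpace ℂ (Fin (e + 1))) {x₀ y : M}
    (hy : y ∈ (trivializationAt ℂ L x₀).baseSet) {j : Fin (e + 1)} (hj : S j y ≠ 0) :
    coeff L N x₀ y (sectionOf S a y) = coeff L N x₀ y (S j y) *
      (ratioSystem (n := n) S hS hΦ).comb (fun k => a k) j y := by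
  have h0 : coeff L N x₀ y (S j y) ≠ 0 := fun h => hj ((coeff_eq_zero_iff L N hy _).mp h)
  simp only [sectionOf, Finset.sum_apply, Pi.smul_apply, map_sum, map_smul, RatioSystem.comb,
    ratioSystem, ← coeff_div L N hy, Finset.mul_sum, smul_eq_mul]
  refine Finset.sum_congr rfl fun k _ => ?_
  field_simp

theorem zeroSet_sectionOf (a : EuclideanSpace ℂ (Fin (e + 1))) :
    zeroSet (sectionOf S a) = (ratioSystem (n := n) S hS hΦ).zeros fun k => a k := by
  ext y
  obtain ⟨j, hj⟩ := hΦ y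
  have hb : y ∈ (trivializationAt ℂ L y).baseSet := FiberBundle.mem_baseSet_trivializationAt' y
  rw [RatioSystem.mem_zeros_iff (j := j) _ _ hj]
  have h0 : coeff L N y y (S j y) ≠ 0 := fun h => hj ((coeff_eq_zero_iff L N hb _).mp h)
  have h1 := coeff_sectionOf S hS hΦ a hb hj
  change sectionOf S a y = 0 ↔ _
  rw [← coeff_eq_zero_iff L N hb, h1, mul_eq_zero, or_iff_right h0]

theorem vanishingOrder_eq_one {k : ℕ} {ψ : (Fin k → ℂ) → ℂ} {z : Fin k → ℂ} (h0 : ψ z = 0)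
    (h1 : fderiv ℂ ψ z ≠ 0) : vanishingOrder ψ z = 1 := by
  have hz : 0 ∉ {j : ℕ | iteratedFDeriv ℂ j ψ z ≠ 0} := by
    intro h
    apply h
    ext v
    simp [h0]
  have ho : 1 ∈ {j : ℕ | iteratedFDeriv ℂ j ψ z ≠ 0} := by
    intro h
    apply h1
    ext v
    have := DFunLike.congr_fun h fun _ => v
    rwa [iteratedFDeriv_one_apply] at this
  refine le_antisymm (Nat.sInf_le ho) ?_
  refine Nat.one_le_iff_ne_zero.mpr fun h => ?_
  rcases Nat.sInf_eq_zero.mp h with h | h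
  · exact hz h
  · rw [h] at ho
    exact ho

/-- Locally the section is a nonvanishing `S j` times its affine expression. At a zero the product
rule leaves `S j` times the derivative of the latter, which is nonzero in the preferred chart by
`Regular.fderiv_comb_ne_zero`. -/
theorem zeroMultiplicity_sectionOf [IsManifold 𝓘(ℂ, Fin (n + 1) → ℂ) ω M]
    (a : EuclideanSpace ℂ (Fin (e + 1)))
    (ha : (ratioSystem (n := n) S hS hΦ).Regular fun k => a k) {p : M}
    (hp : p ∈ (ratioSystem (n := n) S hS hΦ).zeros fun k => a k) :
    zeroMultiplicity (n := n) (sectionOf S a) p = 1 := by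
  set Q := ratioSystem (n := n) S hS hΦ
  obtain ⟨j, hj, hd⟩ := ha.fderiv_comb_ne_zero Q hp
  set χ := chartAt (Fin (n + 1) → ℂ) p
  have hpp : p ∈ χ.source := mem_chart_source _ p
  have hb : p ∈ (trivializationAt ℂ L p).baseSet := FiberBundle.mem_baseSet_trivializationAt' p
  have hbn := (trivializationAt ℂ L p).open_baseSet.mem_nhds hb
  have hcomb0 : Q.comb (fun k => a k) j p = 0 := hp j hj
  have hcont : ContinuousAt χ.symm (χ p) := χ.continuousAt_symm (χ.map_source hpp)
  have hev : (fun z => coeff L N p (χ.symm z) (sectionOf S a (χ.symm z))) =ᶠ[𝓝 (χ p)]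
      fun z => coeff L N p (χ.symm z) (S j (χ.symm z)) * Q.comb (fun k => a k) j (χ.symm z) := by
    have h1 : χ.symm ⁻¹' ((trivializationAt ℂ L p).baseSet ∩ Q.W j) ∈ 𝓝 (χ p) := by
      refine hcont.preimage_mem_nhds ?_
      rw [χ.left_inv hpp]
      exact Filter.inter_mem hbn ((Q.isOpen_W j).mem_nhds hj)
    filter_upwards [h1] with z hz
    exact coeff_sectionOf S hS hΦ a hz.1 hz.2
  have hd1 : DifferentiableAt ℂ (fun z => coeff L N p (χ.symm z) (S j (χ.symm z))) (χ p) := by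
    rw [← mdifferentiableAt_iff_differentiableAt]
    have h3 : MDifferentiableAt 𝓘(ℂ, Fin (n + 1) → ℂ) 𝓘(ℂ, Fin (n + 1) → ℂ) χ.symm (χ p) :=
      mdifferentiableOn_chart_symm.mdifferentiableAt
        (χ.open_target.mem_nhds (χ.map_source hpp))
    have h4 : MDifferentiableAt 𝓘(ℂ, Fin (n + 1) → ℂ) 𝓘(ℂ, ℂ)
        (fun y => coeff L N p y (S j y)) (χ.symm (χ p)) := by
      rw [χ.left_inv hpp]
      exact (hS j p).mdifferentiableAt hbn
    exact h4.comp _ h3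
  have hd2 : DifferentiableAt ℂ (fun z => Q.comb (fun k => a k) j (χ.symm z)) (χ p) :=
    (Q.hasFDerivAt_comb (fun k => a k) (Q.mem_T hpp hj)).differentiableAt
  have h0 : coeff L N p (χ.symm (χ p)) (S j (χ.symm (χ p))) ≠ 0 := by
    rw [χ.left_inv hpp]
    exact fun h => hj ((coeff_eq_zero_iff L N hb _).mp h)
  refine vanishingOrder_eq_one ?_ ?_
  · refine hev.eq_of_nhds.trans ?_
    rw [χ.left_inv hpp, hcomb0, mul_zero]
  · intro h
    have h5 : fderiv ℂ (fun z => coeff L N p (χ.symm z) (S j (χ.symm z)) *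
        Q.comb (fun k => a k) j (χ.symm z)) (χ p) = 0 := by
      rw [← hev.fderiv_eq]; exact h
    rw [fderiv_fun_mul hd1 hd2] at h5
    have h6 : Q.comb (fun k => a k) j (χ.symm (χ p)) = 0 := by rwa [χ.left_inv hpp]
    apply hd
    ext v
    have h7 := DFunLike.congr_fun h5 v
    simp only [add_apply, smul_apply, h6, smul_eq_mul, zero_mul, add_zero, zero_apply] at h7
    exact (mul_eq_zero.mp h7).resolve_left h0

end Ratio

end RandomZeros

end

noncomputable section

namespace RandomZeros

/-! ### The expected zero current. -/

section Expectation

variable {n e N : ℕ} {M : Type*} [TopologicalSpace M] [ChartedSpace (Fin (n + 1) → ℂ) M]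
  {L : M → Type*} [∀ x, AddCommGroup (L x)] [∀ x, Module ℂ (L x)]
  [∀ x, TopologicalSpace (L x)] [TopologicalSpace (Bundle.TotalSpace ℂ L)]
  [FiberBundle ℂ L] [VectorBundle ℂ ℂ L] [IsManifold 𝓘(ℂ, Fin (n + 1) → ℂ) ω M]
  (S : Fin (e + 1) → ∀ x, ⨂[ℂ]^N (L x))

/-- The zero current of a section with simple zeros is integration over its zero set. -/
theorem zeroCurrent_sectionOf (hS : ∀ j, S j ∈ H0 (n + 1) L N) (hΦ : ∀ x, ∃ j, S j x ≠ 0)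
    (a : EuclideanSpace ℂ (Fin (e + 1)))
    (ha : (ratioSystem (n := n) S hS hΦ).Regular fun k => a k) (φ : Form (n + 1) M (2 * n)) :
    zeroCurrent (sectionOf S a) φ =
      formIntegral (k := n) ((ratioSystem (n := n) S hS hΦ).zeros fun k => a k) φ ∧
    (FormIntegrable (k := n) ((ratioSystem (n := n) S hS hΦ).zeros fun k => a k) φ →
      ZeroCurrentConverges (sectionOf S a) φ) := by
  have hφ : ∀ x ∈ (ratioSystem (n := n) S hS hΦ).zeros fun k => a k,
      φ x = (zeroMultiplicity (n := n) (sectionOf S a) x : ℂ) • φ x := fun x hx => by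
    rw [zeroMultiplicity_sectionOf S hS hΦ a ha hx, Nat.cast_one, one_smul]
  rw [zeroCurrent, ZeroCurrentConverges, zeroSet_sectionOf S hS hΦ,
    RatioSystem.regularPart_zeros _ ha]
  exact ⟨(formIntegral_congr hφ).symm, FormIntegrable.congr hφ⟩

theorem expectedZeroCurrent_eq [T2Space M] [CompactSpace M] [Nonempty M]
    (hS : ∀ j, S j ∈ H0 (n + 1) L N) (hΦ : ∀ x, ∃ j, S j x ≠ 0)
    (φ : Form (n + 1) M (2 * n)) (hφ : IsTestForm φ) :
    (∀ᵐ a ∂(sphereMeasure (e + 1)), ZeroCurrentConverges (sectionOf S a.1) φ) ∧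
    Integrable (fun a : Metric.sphere (0 : EuclideanSpace ℂ (Fin (e + 1))) 1 =>
      normalizedZeroCurrent (sectionOf S a.1) φ) (sphereMeasure (e + 1)) ∧
    expectedZeroCurrent S φ =
      currentOf (fun x => (1 / (N : ℂ)) • pullbackFS (kodairaMap S hΦ) x) φ := by
  set Q := ratioSystem (n := n) S hS hΦ
  let J : M → Fin (e + 1) := fun x => (exists_rep_ne_zero (kodairaMap S hΦ x)).choose
  -- The definition of `pullbackFS` chooses an affine chart point by point; it is enough that the
  -- corresponding section does not vanish there.
  have hJ : ∀ y, y ∈ Q.W (J y) := fun y =>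
    rep_kodairaMap_ne_zero S hS hΦ (exists_rep_ne_zero (kodairaMap S hΦ y)).choose_spec
  have hFS : (pullbackFS (kodairaMap S hΦ) : Form (n + 1) M 2) = fun y => (fubiniStudy (e + 1)
      (Q.R (J y) y)).compLinearMap (realLinear (mfderiv 𝓘(ℂ, Fin (n + 1) → ℂ)
        𝓘(ℂ, Fin (e + 1) → ℂ) (Q.R (J y)) y)) := by
    funext y
    have h : (fun y' => affineLift (J y) (kodairaMap S hΦ y')) = Q.R (J y) :=
      funext fun y' => affineLift_kodairaMap S hS hΦ (J y) y'
    rw [← h]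
    rfl
  obtain ⟨h1, h2, h3⟩ := Q.gaussian_average φ (fun x v => (hφ.smooth x v).continuousOn)
    (pullbackFS (kodairaMap S hΦ))
    (fun x j z hz => by rw [hFS]; exact Q.pullback_fubiniStudy J hJ x j hz)
  have hae := ae_sphereMeasure (P := fun a => Q.Regular a ∧ FormIntegrable (k := n) (Q.zeros a) φ)
    (fun r hr a h => ⟨RatioSystem.Regular.of_smul Q hr h.1, by rw [← Q.zeros_smul hr]; exact h.2⟩) h1
  obtain ⟨h4, h5⟩ := integral_sphereMeasure
    (F := fun a => formIntegral (k := n) (Q.zeros a) φ)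
    (fun r hr a => by simp only [Q.zeros_smul hr]) h2
  have hcur : (fun a : Metric.sphere (0 : EuclideanSpace ℂ (Fin (e + 1))) 1 =>
      1 / (N : ℂ) * formIntegral (k := n) (Q.zeros fun k => a.1 k) φ) =ᵐ[sphereMeasure (e + 1)]
      fun a => normalizedZeroCurrent (sectionOf S a.1) φ := by
    filter_upwards [hae] with a ha
    rw [normalizedZeroCurrent, (zeroCurrent_sectionOf S hS hΦ a.1 ha.1 φ).1]
  refine ⟨?_, (h4.const_mul _).congr hcur, ?_⟩
  · filter_upwards [hae] with a ha
    exact (zeroCurrent_sectionOf S hS hΦ a.1 ha.1 φ).2 ha.2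
  · have hpi : (Real.pi : ℂ) ^ (e + 1) ≠ 0 := pow_ne_zero _ (by exact_mod_cast Real.pi_ne_zero)
    rw [expectedZeroCurrent, ← integral_congr_ae hcur, integral_const_mul,
      mul_left_cancel₀ hpi (h5.trans h3), currentOf]
    simp only [wedge_smul_left]
    rw [formIntegral_smul]

end Expectation

/-! ### The empty manifold. -/

section Empty

variable {n : ℕ} {M : Type*} [TopologicalSpace M] [ChartedSpace (Fin (n + 1) → ℂ) M]
  [IsEmpty M]

theorem formIntegral_of_isEmpty {k : ℕ} (S : Set M) (η : Form (n + 1) M (2 * k)) :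
    formIntegral S η = 0 := by
  unfold formIntegral
  split_ifs with h
  · exact (IsEmpty.false (h.some.g 0 0)).elim
  · rfl

end Empty

end RandomZeros

end

theorem lemma3p1 {n : ℕ} {M : Type*} [TopologicalSpace M] [T2Space M] [CompactSpace M]
    [ChartedSpace (Fin (n + 1) → ℂ) M] [IsManifold 𝓘(ℂ, Fin (n + 1) → ℂ) ω M]
    {L : M → Type*} [∀ x, AddCommGroup (L x)] [∀ x, Module ℂ (L x)]
    [∀ x, TopologicalSpace (L x)] [TopologicalSpace (Bundle.TotalSpace ℂ L)]
    [FiberBundle ℂ L] [VectorBundle ℂ ℂ L]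
    [ContMDiffVectorBundle ω ℂ L 𝓘(ℂ, Fin (n + 1) → ℂ)]
    (h : RandomZeros.HermitianMetric (n + 1) L) (_hpos : h.IsPositive)
    (N : ℕ) (_hN : 0 < N) (d : ℕ)
    (S : Module.Basis (Fin d) ℂ (RandomZeros.H0 (n + 1) L N))
    (_hS : ∀ i j, h.l2Inner N (S i).1 (S j).1 = if i = j then 1 else 0)
    (hΦ : ∀ x : M, ∃ j, (S j).1 x ≠ 0)
    (φ : RandomZeros.Form (n + 1) M (2 * n)) (_hφ : RandomZeros.IsTestForm φ) :
    (∀ᵐ a ∂(RandomZeros.sphereMeasure d), RandomZeros.ZeroCurrentConverges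
      (RandomZeros.sectionOf (fun j => (S j).1) a.1) φ) ∧
    MeasureTheory.Integrable (fun a : Metric.sphere (0 : EuclideanSpace ℂ (Fin d)) 1 =>
      RandomZeros.normalizedZeroCurrent (RandomZeros.sectionOf (fun j => (S j).1) a.1) φ)
      (RandomZeros.sphereMeasure d) ∧
    RandomZeros.expectedZeroCurrent (fun j => (S j).1) φ =
      RandomZeros.currentOf (fun x => (1 / (N : ℂ)) •
        RandomZeros.pullbackFS (RandomZeros.kodairaMap (fun j => (S j).1) hΦ) x) φ := by
  rcases isEmpty_or_nonempty M with hM | hM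
  -- Over the empty manifold the space of sections is zero, so `d = 0` and the unit sphere is empty;
  -- every integral is then 0.
  · have hH : Subsingleton (RandomZeros.H0 (n + 1) L N) :=
      ⟨fun s t => Subtype.ext (funext fun x => (hM.false x).elim)⟩
    have hd : d = 0 := by
      by_contra h0
      exact S.ne_zero ⟨0, Nat.pos_of_ne_zero h0⟩ (Subsingleton.elim _ _)
    subst hd
    have hE : IsEmpty (Metric.sphere (0 : EuclideanSpace ℂ (Fin 0)) 1) :=
      ⟨fun a => by
        have h1 := a.2
        rw [Subsingleton.elim a.1 0] at h1
        simp at h1⟩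
    have hμ : RandomZeros.sphereMeasure 0 = 0 := MeasureTheory.Measure.eq_zero_of_isEmpty _
    refine ⟨?_, ?_, ?_⟩
    · rw [hμ]
      simp
    · rw [hμ]
      exact MeasureTheory.integrable_zero_measure
    · rw [RandomZeros.expectedZeroCurrent, hμ, MeasureTheory.integral_zero_measure,
        RandomZeros.currentOf, RandomZeros.formIntegral_of_isEmpty]
  -- At a point of `M` some basis section is nonzero, so there is at least one.
  · obtain ⟨e, rfl⟩ : ∃ e, d = e + 1 := by
      obtain ⟨x⟩ := hM
      obtain ⟨j, -⟩ := hΦ x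
      exact Nat.exists_eq_succ_of_ne_zero j.pos.ne'
    exact RandomZeros.expectedZeroCurrent_eq (fun j => (S j).1) (fun j => (S j).2) hΦ φ _hφ
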